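/- For $N\ge 1$ let $\mathbb{GT}_N$ be the set of signatures of length $N$, i.e. of integer $N$-tuples $\lambda=(\lambda_1\ge\dots\ge\lambda_N)$, and let $$s_\lambda(x_1,\dots,x_N)=\frac{\det\big[x_i^{\lambda_j+N-j}\big]_{i,j=1}^N}{\prod_{1\le i<j\le N}(x_i-x_j)}$$ be the Schur function of $\lambda$, a symmetric Laurent polynomial. Let $\rho=\{\rho_N\}_{N\ge1}$ be a sequence of probability measures, $\rho_N$ on $\mathbb{GT}_N$, such that for every $N$ the Schur generating function $$S_{\rho_N}(x_1,\dots,x_N)=\sum_{\lambda\in\mathbb{GT}_N}\rho_N(\lambda)\,\frac{s_\lambda(x_1,\dots,x_N)}{s_\lambda(1^N)}$$ converges uniformly in an open complex neighborhood of $1^N=(1,\dots,1)$. Assume that $\rho$ is CLT-appropriate, that is, there are reals $\mathbf c_k$ $(k\ge1)$ and $\mathbf d_{k,l}$ $(k,l\ge1)$ such that: 1. for every $N$, $\log S_{\rho_N}$ (the branch vanishing at $1^N$) is holomorphic in an open complex neighborhood of $1^N$; 2. for every fixed index $i$ and every $k\ge1$, $\lim_{N\to\infty}\frac1N\,\partial_i^k\log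 S_{\rho_N}(\vec x)\big|_{\vec x=1^N}=\mathbf c_k$; 3. for all fixed distinct indices $i\ne j$ and all $k,l\ge1$, $\lim_{N\to\infty}\partial_i^k\partial_j^l\log S_{\rho_N}(\vec x)\big|_{\vec x=1^N}=\mathbf d_{k,l}$; 4. for all fixed indices $i_1,\dots,i_s$ among which at least three are distinct, $\lim_{N\to\infty}\partial_{i_1}\cdots\partial_{i_s}\log S_{\rho_N}(\vec x)\big|_{\vec x=1^N}=0$; 5. the power series $$F_\rho(x)=\sum_{k\ge1}\frac{\mathbf c_k}{(k-1)!}(x-1)^{k-1},\qquad G_\rho(x,y)=\sum_{k,l\ge1}\frac{\mathbf d_{k,l}}{(k-1)!\,(l-1)!}(x-1)^{k-1}(y-1)^{l-1}$$ converge (absolutely) in open complex neighborhoods of $x=1$ and $(x,y)=(1,1)$, respectively. Put $Q_\rho(x,y)=G_\rho(1+x,1+y)+\frac1{(x-y)^2}$ and, for a $\rho_N$-distributed $\lambda$ and $k\ge1$, $p_k^{(N)}=\sum_{i=1}^N(\lambda_i+N-i)^k$. Then all joint moments of the random variables $p_k^{(N)}$, $k\ge1$, are finite, and the collection $\{N^{-k}(p_k^{(N)}-\mathbf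 E p_k^{(N)})\}_{k\ge1}$ converges, as $N\to\infty$, in the sense of (joint) moments to a centered Gaussian vector $(\xi_k)_{k\ge1}$: for all $s\ge 0$ and $k_1,\dots,k_s\ge1$, $$\lim_{N\to\infty}\mathbf E\prod_{a=1}^sN^{-k_a}\big(p_{k_a}^{(N)}-\mathbf Ep_{k_a}^{(N)}\big)=\mathbf E\prod_{a=1}^s\xi_{k_a}.$$ Its covariance is given, for all sufficiently small $\epsilon>0$ (uniformly in $k_1,k_2$) and all $k_1,k_2\ge1$, by $$\mathbf E\,\xi_{k_1}\xi_{k_2}=\lim_{N\to\infty}\frac{\mathrm{cov}\big(p_{k_1}^{(N)},p_{k_2}^{(N)}\big)}{N^{k_1+k_2}}=\frac1{(2\pi\mathbf i)^2}\oint_{|z|=\epsilon}\oint_{|w|=2\epsilon}\Big(\frac1z+1+(1+z)F_\rho(1+z)\Big)^{k_1}\Big(\frac1w+1+(1+w)F_\rho(1+w)\Big)^{k_2}Q_\rho(z,w)\,dz\,dw,$$ where both contours are oriented counter-clockwise. -/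

import Mathlib

open MeasureTheory ProbabilityTheory Filter Topology
open scoped BigOperators Nat

noncomputable section

namespace SchurCLT

/-- Signatures of length `N`: non-increasing `N`-tuples of integers
`l 0 ≥ l 1 ≥ … ≥ l (N - 1)` (indices start from `0`). -/
abbrev Signature (N : ℕ) : Type := {l : Fin N → ℤ // Antitone l}

/-! ### Schur functions -/

/-- The polynomial Vandermonde product `∏_{i < j} (X i - X j)`. -/
def vandermondePoly (N : ℕ) : MvPolynomial (Fin N) ℂ :=
  ∏ p : Fin N × Fin N with p.1 < p.2, (MvPolynomial.X p.1 - MvPolynomial.X p.2)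

/-- A nonnegative integer `m` such that all parts `l i + m` are nonnegative. -/
def Signature.shift {N : ℕ} (l : Signature N) : ℕ := ∑ i, (l.1 i).natAbs

/-- The polynomial `det [X i ^ (l j + m + N - j)]` (with `j = 1, …, N`), where `m = l.shift`. -/
def alternantPoly {N : ℕ} (l : Signature N) : MvPolynomial (Fin N) ℂ :=
  Matrix.det (Matrix.of fun i j : Fin N =>
    (MvPolynomial.X i : MvPolynomial (Fin N) ℂ) ^ (l.1 j + l.shift + (N - 1 - (j : ℕ) : ℕ)).toNat)

theorem X_sub_X_irreducible {N : ℕ} {i j : Fin N} (h : i ≠ j) :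
    Irreducible (MvPolynomial.X i - MvPolynomial.X j : MvPolynomial (Fin N) ℂ) := by
  have hs : (Finsupp.single i (1 : ℂ) - Finsupp.single j 1).support = {i, j} := by
    ext a
    simp only [Finsupp.mem_support_iff, Finsupp.coe_sub, Pi.sub_apply, Finsupp.single_apply,
      Finset.mem_insert, Finset.mem_singleton]
    grind
  have hi : (Finsupp.single i (1 : ℂ) - Finsupp.single j 1 : Fin N →₀ ℂ) i = 1 := by
    simp [h.symm]
  have := MvPolynomial.irreducible_sumSMulX (R := ℂ)
    (c := Finsupp.single i (1 : ℂ) - Finsupp.single j 1)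
    (by rw [hs]; simp)
    (by
      intro r hr
      exact isUnit_of_dvd_one (hi ▸ hr i))
  convert this using 1
  rw [map_sub]
  simp [MvPolynomial.sumSMulX]

theorem X_sub_X_dvd_alternantPoly {N : ℕ} (l : Signature N) {i j : Fin N} (h : i ≠ j) :
    (MvPolynomial.X i - MvPolynomial.X j : MvPolynomial (Fin N) ℂ) ∣ alternantPoly l := by
  unfold alternantPoly
  rw [← Matrix.det_updateRow_add_smul_self _ h (-1)]
  have hd : ∀ k : Fin N, ∃ q : MvPolynomial (Fin N) ℂ,
      (MvPolynomial.X i : MvPolynomial (Fin N) ℂ) ^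
          (l.1 k + l.shift + (N - 1 - (k : ℕ) : ℕ)).toNat
        - MvPolynomial.X j ^ (l.1 k + l.shift + (N - 1 - (k : ℕ) : ℕ)).toNat
      = (MvPolynomial.X i - MvPolynomial.X j) * q :=
    fun k => sub_dvd_pow_sub_pow _ _ _
  choose q hq using hd
  refine ⟨Matrix.det (Matrix.updateRow (Matrix.of fun i j : Fin N =>
    (MvPolynomial.X i : MvPolynomial (Fin N) ℂ) ^
      (l.1 j + l.shift + (N - 1 - (j : ℕ) : ℕ)).toNat) i q), ?_⟩
  rw [← Matrix.det_updateRow_smul]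
  congr 2
  funext k
  simp only [Pi.add_apply, Pi.smul_apply, Matrix.of_apply, smul_eq_mul, neg_smul, one_smul,
    Pi.neg_apply]
  rw [← hq k, sub_eq_add_neg]

/-- The Vandermonde product divides every alternant. -/
theorem vandermondePoly_dvd_alternantPoly {N : ℕ} (l : Signature N) :
    vandermondePoly N ∣ alternantPoly l := by
  refine Finset.prod_dvd_of_isRelPrime ?_ ?_
  · rintro ⟨i, j⟩ hij ⟨k, m⟩ hkm hne
    simp only [Finset.coe_filter, Finset.mem_univ, true_and, Set.mem_ofPred_eq] at hij hkm
    refine ((X_sub_X_irreducible hij.ne).dvd_or_isRelPrime).resolve_left ?_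
    intro hdvd
    have hpt : ∃ x : Fin N → ℂ, x i = x j ∧ x k ≠ x m := by
      by_cases hk : k = i ∨ k = j
      · refine ⟨Pi.single m 1, ?_, ?_⟩ <;> simp only [Pi.single_apply] <;> grind
      · refine ⟨Pi.single k 1, ?_, ?_⟩ <;> simp only [Pi.single_apply] <;> grind
    obtain ⟨x, hx, hx'⟩ := hpt
    have := map_dvd (MvPolynomial.eval x) hdvd
    simp only [map_sub, MvPolynomial.eval_X, hx, sub_self, zero_dvd_iff] at this
    exact hx' (sub_eq_zero.1 this)
  · rintro ⟨i, j⟩ hij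
    simp only [Finset.mem_filter, Finset.mem_univ, true_and] at hij
    exact X_sub_X_dvd_alternantPoly l hij.ne

/-- The quotient `det [X i ^ (l j + m + N - j)] / ∏_{i < j} (X i - X j)`, where `m = l.shift`,
as a polynomial. -/
def schurPoly {N : ℕ} (l : Signature N) : MvPolynomial (Fin N) ℂ :=
  (vandermondePoly_dvd_alternantPoly l).choose

/-- The Schur function of a signature: the symmetric Laurent polynomial
`det [x i ^ (l j + N - j)] / ∏_{i < j} (x i - x j)`, see `schur_mul_vandermonde`. -/
def schur {N : ℕ} (l : Signature N) (x : Fin N → ℂ) : ℂ :=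
  (∏ i, x i) ^ (-(l.shift : ℤ)) * MvPolynomial.eval x (schurPoly l)

/-- The defining relation of the Schur function (with `0`-based column index `j`). -/
theorem schur_mul_vandermonde {N : ℕ} (l : Signature N) (x : Fin N → ℂ) (hx : ∀ i, x i ≠ 0) :
    schur l x * ∏ p : Fin N × Fin N with p.1 < p.2, (x p.1 - x p.2)
      = Matrix.det (Matrix.of fun i j : Fin N => x i ^ (l.1 j + N - 1 - (j : ℕ))) := by
  have h1 : MvPolynomial.eval x (schurPoly l) *
      ∏ p : Fin N × Fin N with p.1 < p.2, (x p.1 - x p.2)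
      = MvPolynomial.eval x (alternantPoly l) := by
    have h := (vandermondePoly_dvd_alternantPoly l).choose_spec
    change alternantPoly l = vandermondePoly N * schurPoly l at h
    rw [h, map_mul, mul_comm]
    simp [vandermondePoly]
  have h2 : MvPolynomial.eval x (alternantPoly l) =
      Matrix.det (Matrix.of fun i j : Fin N =>
        x i ^ (l.shift : ℤ) * (Matrix.of fun i j : Fin N => x i ^ (l.1 j + N - 1 - (j : ℕ))) i j)
      := by
    unfold alternantPoly
    rw [RingHom.map_det]
    congr 1
    ext i j
    simp only [RingHom.mapMatrix_apply, Matrix.map_apply, Matrix.of_apply, map_pow,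
      MvPolynomial.eval_X]
    rw [← zpow_natCast, ← zpow_add₀ (hx i)]
    congr 1
    have hj : (l.1 j).natAbs ≤ l.shift :=
      Finset.single_le_sum (f := fun i => (l.1 i).natAbs) (fun _ _ => Nat.zero_le _)
        (Finset.mem_univ j)
    have := j.2
    omega
  unfold schur
  rw [mul_assoc, h1, h2, Matrix.det_mul_column, ← mul_assoc]
  have h3 : (∏ i, x i) ≠ 0 := Finset.prod_ne_zero_iff.2 fun i _ => hx i
  rw [Finset.prod_zpow, ← zpow_add₀ h3]
  simp

/-! ### Schur generating functions -/

/-- The term of the signature `l` in the Schur generating function of `ρ`: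
`ρ(l) s_l(x) / s_l(1, …, 1)`. -/
def schurTerm {N : ℕ} (ρ : Measure (Signature N)) (l : Signature N) (x : Fin N → ℂ) : ℂ :=
  (ρ.real {l} : ℂ) * (schur l x / schur l 1)

/-- The Schur generating function of a measure on signatures. -/
def schurGF {N : ℕ} (ρ : Measure (Signature N)) (x : Fin N → ℂ) : ℂ :=
  ∑' l : Signature N, schurTerm ρ l x

/-- The series defining the Schur generating function converges uniformly in an open neighborhood
of `(1, …, 1)`. -/
def ConvergesNearOne {N : ℕ} (ρ : Measure (Signature N)) : Prop :=
  ∃ U : Set (Fin N → ℂ), IsOpen U ∧ 1 ∈ U ∧ SummableUniformlyOn (schurTerm ρ) U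

/-- The logarithm of the Schur generating function. As `schurGF ρ 1 = 1`, the principal branch is
the branch near `(1, …, 1)` which vanishes at that point. -/
def logSchurGF {N : ℕ} (ρ : Measure (Signature N)) (x : Fin N → ℂ) : ℂ :=
  Complex.log (schurGF ρ x)

/-- The partial derivative with respect to the `i`-th variable (`0`-based; it is `0` if `N ≤ i`,
which does not matter for limits as `N → ∞`). -/
def partialD {N : ℕ} (i : ℕ) (f : (Fin N → ℂ) → ℂ) : (Fin N → ℂ) → ℂ :=
  fun x => lineDeriv ℂ f x (fun j => if (j : ℕ) = i then 1 else 0)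

/-- The iterated partial derivative `∂_{i₁} ⋯ ∂_{iₛ} f` for the list `[i₁, …, iₛ]`. -/
def iterPartialD {N : ℕ} : List ℕ → ((Fin N → ℂ) → ℂ) → (Fin N → ℂ) → ℂ
  | [], f => f
  | i :: L, f => partialD i (iterPartialD L f)

/-! ### CLT-appropriate sequences of measures -/

/-- The sequence `ρ` of measures on signatures is CLT-appropriate with constants `c k`, `d k l`,
`k, l ≥ 1` (the values of `c` and `d` at index `0` play no role). -/
structure IsCLTAppropriate (ρ : (N : ℕ) → Measure (Signature N)) (c : ℕ → ℝ) (d : ℕ → ℕ → ℝ) :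
    Prop where
  holomorphic : ∀ N, 1 ≤ N → ∃ U : Set (Fin N → ℂ), IsOpen U ∧ 1 ∈ U ∧
    DifferentiableOn ℂ (logSchurGF (ρ N)) U
  limit_one : ∀ i k : ℕ, 1 ≤ k →
    Tendsto (fun N : ℕ => iterPartialD (List.replicate k i) (logSchurGF (ρ N)) 1 / (N : ℂ))
      atTop (𝓝 (c k : ℂ))
  limit_two : ∀ i j k l : ℕ, i ≠ j → 1 ≤ k → 1 ≤ l →
    Tendsto (fun N : ℕ =>
        iterPartialD (List.replicate k i ++ List.replicate l j) (logSchurGF (ρ N)) 1)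
      atTop (𝓝 (d k l : ℂ))
  limit_three : ∀ L : List ℕ, 3 ≤ L.toFinset.card →
    Tendsto (fun N : ℕ => iterPartialD L (logSchurGF (ρ N)) 1) atTop (𝓝 0)
  summable_one : ∃ r > 0, ∀ x : ℂ, ‖x - 1‖ < r →
    Summable fun k : ℕ => (c (k + 1) : ℂ) / (k ! : ℂ) * (x - 1) ^ k
  summable_two : ∃ r > 0, ∀ x y : ℂ, ‖x - 1‖ < r → ‖y - 1‖ < r →
    Summable fun p : ℕ × ℕ => (d (p.1 + 1) (p.2 + 1) : ℂ) / ((p.1 ! : ℂ) * (p.2 ! : ℂ)) *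
      (x - 1) ^ p.1 * (y - 1) ^ p.2

/-- `F(x) = ∑_{k ≥ 1} c k / (k - 1)! (x - 1) ^ (k - 1)`. -/
def limitF (c : ℕ → ℝ) (x : ℂ) : ℂ :=
  ∑' k : ℕ, (c (k + 1) : ℂ) / (k ! : ℂ) * (x - 1) ^ k

/-- `G(x, y) = ∑_{k, l ≥ 1} d k l / ((k - 1)! (l - 1)!) (x - 1) ^ (k - 1) (y - 1) ^ (l - 1)`. -/
def limitG (d : ℕ → ℕ → ℝ) (x y : ℂ) : ℂ :=
  ∑' p : ℕ × ℕ, (d (p.1 + 1) (p.2 + 1) : ℂ) / ((p.1 ! : ℂ) * (p.2 ! : ℂ)) *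
    (x - 1) ^ p.1 * (y - 1) ^ p.2

/-- `Q(x, y) = G(1 + x, 1 + y) + 1 / (x - y) ^ 2`. -/
def limitQ (d : ℕ → ℕ → ℝ) (x y : ℂ) : ℂ :=
  limitG d (1 + x) (1 + y) + 1 / (x - y) ^ 2

/-- The double contour integral over `|z| = ε`, `|w| = 2 ε` giving the limiting covariance. -/
def covIntegral (c : ℕ → ℝ) (d : ℕ → ℕ → ℝ) (ε : ℝ) (k₁ k₂ : ℕ) : ℂ :=
  1 / (2 * (Real.pi : ℂ) * Complex.I) ^ 2 * ∮ z in C(0, ε), ∮ w in C(0, 2 * ε),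
    (1 / z + 1 + (1 + z) * limitF c (1 + z)) ^ k₁ *
    (1 / w + 1 + (1 + w) * limitF c (1 + w)) ^ k₂ * limitQ d z w

/-! ### Shifted power sums -/

/-- `p_k(l) = ∑_{i=1}^N (l i + N - i) ^ k`, with `0`-based index `i` in the code. -/
def powerSum {N : ℕ} (k : ℕ) (l : Signature N) : ℝ :=
  ∑ i : Fin N, ((l.1 i : ℝ) + (N : ℝ) - 1 - ((i : ℕ) : ℝ)) ^ k

/-- The centered and rescaled power sum `N ^ (-k) (p_k - E p_k)`. -/
def fluctuation {N : ℕ} (ρ : Measure (Signature N)) (k : ℕ) (l : Signature N) : ℝ :=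
  (powerSum k l - ∫ l', powerSum k l' ∂ρ) / (N : ℝ) ^ k

end SchurCLT

end

/-! The proof turns the moments into vacuum expectations of free fermions and then bosonizes. Let V
be the Vandermonde determinant and S the Schur generating function. Up to sign, V·s_λ is the
alternant with exponents λ_j + N - j, so the operators ∑_i (x_i ∂_i)^k act on it diagonally, with
the shifted power sums p_k(λ) as eigenvalues. Applied to V·S and read off at 1^N through the
coefficient of lowest order (`leadCoeff`), products of these operators give the joint moments of the
p_k (`hasSum_eulerProd`). Termwise differentiation of the series is justified by Cauchy's estimate
(`UnifSum`), and this also yields integrability.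

In the coordinate X = x - 1 the symmetric function log S has, to any finite order, the form N ∑ α_j
p_j(X) + w, where p_j(X) is the j-th power sum of the X_i and w is a polynomial in these power sums
(`symTaylor_eq`). The hypotheses say that α_j → c_j/j! and that w tends to the quadratic form with
coefficients d_{ij}/(2 i! j!). Conjugation by exp(N ∑ α_j p_j) turns x_i ∂_i into N·A_i, where A =
(1 + T)(D + ∑ j α_j T^(j-1)), T is multiplication by X_i and D = N⁻¹ ∂_i. Therefore E ∏ (p_k/N^k -
y_k) is the coefficient of the staircase monomial in ∏ (∑_i A_i^k - y_k) applied to e^w V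
(`hasSum_powerSum`); e^w may be truncated because the operators have finite order.

V is the fermionic vacuum, with levels 0, …, N-1 filled. Antisymmetric polynomials have no monomials
with a repeated exponent, so lowering operators annihilate V and raising operators are annihilated
by the staircase coefficient. As [T, D] = -1/N, commutators of one-body operators carry a factor
1/N; the centred part of the commutator disappears in the limit, and its vacuum trace converges to a
scalar, `pairing` f g = ∑ n f_{-n} g_n, produced by the n levels next to the top one, on which D
acts almost as T⁻¹ (`Homog.tendsto_vacTrace_comm`). The limit is a Heisenberg algebra whose creation
operators are the power sums, and its expectations obey Wick's theorem (`isTest_vac`). The factor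
e^w becomes the exponential of a quadratic form in the creation operators, which adds the β-term to
the covariance (`gwick_truncExp`). The limiting joint moments thus satisfy the Gaussian recursion
`wickRec` with covariance `covForm`.

This covariance is a limit of covariances, hence positive semidefinite, and a Cholesky factorization
realizes it by a Gaussian process (`exists_gaussian`). Finally the contour integral is expanded
termwise: 1/(z - w)² = ∑ (n+1) zⁿ w^(-n-2) for |z| < |w| reproduces the pairing, and the Taylor
series of G reproduces the β-term (`covIntegral_eq`). -/

noncomputable section

namespace SchurCLT

/-! ### Free fermions: operators on antisymmetric polynomials, their symbols and the vacuum. -/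

/-! ### One-body operators and their symbols -/

/-- A family of operators, one for each number `N` of variables and each variable. -/
abbrev OneBody : Type := ∀ N : ℕ, Fin N → Module.End ℂ (MvPolynomial (Fin N) ℂ)

/-- Multiplication by the variable. -/
def shiftOp : OneBody := fun _ i => LinearMap.mulLeft ℂ (MvPolynomial.X i)

/-- The partial derivative, divided by the number of variables. -/
def derivOp : OneBody := fun N i => (N : ℂ)⁻¹ • (MvPolynomial.pderiv i).toLinearMap

/-- Multiplication by a scalar depending on the number of variables. -/
def scalarOp (c : ℕ → ℂ) : OneBody := fun N _ => algebraMap ℂ _ (c N)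

theorem scalarOp_mul_comm (c : ℕ → ℂ) (X : OneBody) : scalarOp c * X = X * scalarOp c := by
  funext N i
  exact Algebra.commutes (c N) (X N i)

/-- Homogeneous operators of a given weight, with their leading coefficient in the regime where
the exponent of the variable is close to `N`. -/
inductive Homog : ℤ → OneBody → ℂ → Prop
  | shift : Homog 1 shiftOp 1
  | deriv : Homog (-1) derivOp 1
  | scalar {c : ℕ → ℂ} {l : ℂ} (h : Tendsto c atTop (𝓝 l)) : Homog 0 (scalarOp c) l
  | zero (w : ℤ) : Homog w 0 0
  | add {w : ℤ} {X Y : OneBody} {a b : ℂ} (hX : Homog w X a) (hY : Homog w Y b) :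
      Homog w (X + Y) (a + b)
  | mul {v w : ℤ} {X Y : OneBody} {a b : ℂ} (hX : Homog v X a) (hY : Homog w Y b) :
      Homog (v + w) (X * Y) (a * b)

theorem Homog.cast {v w : ℤ} {X Y : OneBody} {a b : ℂ} (h : Homog v X a) (hv : v = w) (hX : X = Y)
    (ha : a = b) : Homog w Y b := by
  subst hv hX ha; exact h

/-- Operators with a Laurent polynomial symbol: finite sums of homogeneous operators. -/
inductive Symb : OneBody → LaurentPolynomial ℂ → Prop
  | homog {w : ℤ} {X : OneBody} {a : ℂ} (h : Homog w X a) :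
      Symb X (LaurentPolynomial.C a * LaurentPolynomial.T w)
  | add {X Y : OneBody} {f g : LaurentPolynomial ℂ} (hX : Symb X f) (hY : Symb Y g) :
      Symb (X + Y) (f + g)

theorem Symb.zero : Symb 0 0 := by
  simpa using Symb.homog (Homog.zero 0)

theorem Symb.scalar {c : ℕ → ℂ} {l : ℂ} (h : Tendsto c atTop (𝓝 l)) :
    Symb (scalarOp c) (LaurentPolynomial.C l) := by
  simpa using Symb.homog (Homog.scalar h)

theorem Symb.shift : Symb shiftOp (LaurentPolynomial.T 1) := by
  simpa using Symb.homog Homog.shift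

theorem Symb.deriv : Symb derivOp (LaurentPolynomial.T (-1)) := by
  simpa using Symb.homog Homog.deriv

theorem Symb.one : Symb 1 1 := by
  have := Symb.scalar (c := fun _ => 1) (l := 1) tendsto_const_nhds
  convert this using 1
  · funext N i
    simp [scalarOp]
  · simp

/-- Near the top level the matrix entries are asymptotically constant, so only weights and leading
coefficients matter and noncommuting operators have commuting symbols. -/
theorem Symb.mul {X Y : OneBody} {f g : LaurentPolynomial ℂ} (hX : Symb X f) (hY : Symb Y g) :
    Symb (X * Y) (f * g) := by
  induction hX with
  | @homog w X a h =>
    induction hY with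
    | @homog v Y b h' =>
      have := Symb.homog (h.mul h')
      convert this using 1
      rw [map_mul, LaurentPolynomial.T_add]
      ring
    | add _ _ h1 h2 => rw [mul_add, mul_add]; exact h1.add h2
  | add _ _ h1 h2 => rw [add_mul, add_mul]; exact h1.add h2

theorem Symb.pow {X : OneBody} {f : LaurentPolynomial ℂ} (hX : Symb X f) (k : ℕ) :
    Symb (X ^ k) (f ^ k) := by
  induction k with
  | zero => simpa using Symb.one
  | succ k ih => rw [pow_succ, pow_succ]; exact ih.mul hX

theorem Symb.sum {ι : Type*} (s : Finset ι) {X : ι → OneBody} {f : ι → LaurentPolynomial ℂ}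
    (h : ∀ i ∈ s, Symb (X i) (f i)) : Symb (∑ i ∈ s, X i) (∑ i ∈ s, f i) := by
  classical
  induction s using Finset.induction_on with
  | empty => simpa using Symb.zero
  | insert a s ha ih =>
    rw [Finset.sum_insert ha, Finset.sum_insert ha]
    exact (h a (by simp)).add (ih fun i hi => h i (by simp [hi]))

/-! ### Commutators -/

/-- The canonical commutation relation. It is the only source of the factors N⁻¹ in all later
commutators. -/
theorem shiftOp_derivOp : shiftOp * derivOp =
    derivOp * shiftOp + scalarOp (fun N => (N : ℂ)⁻¹) * scalarOp (fun _ => -1) := by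
  funext N i
  refine LinearMap.ext fun p => ?_
  simp [shiftOp, derivOp, scalarOp, Derivation.leibniz]

/-- The commutator of `X` and `Y` is of the form `N⁻¹ Z`. -/
def CommEq (X Y Z : OneBody) : Prop :=
  X * Y = Y * X + scalarOp (fun N => (N : ℂ)⁻¹) * Z

theorem CommEq.symm {X Y Z : OneBody} (h : CommEq X Y Z) :
    CommEq Y X (scalarOp (fun _ => -1) * Z) := by
  unfold CommEq at *
  rw [h]
  funext N i
  refine LinearMap.ext fun p => ?_
  simp [scalarOp]

theorem CommEq.add_right {X Y Z Y' Z' : OneBody} (h : CommEq X Y Z) (h' : CommEq X Y' Z') :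
    CommEq X (Y + Y') (Z + Z') := by
  unfold CommEq at *
  rw [mul_add X, h, h']
  noncomm_ring

theorem CommEq.mul_right {X Y Z Y' Z' : OneBody} (h : CommEq X Y Z) (h' : CommEq X Y' Z') :
    CommEq X (Y * Y') (Z * Y' + Y * Z') := by
  unfold CommEq at *
  rw [← mul_assoc X, h, add_mul, mul_assoc Y X, h', mul_add Y, ← mul_assoc Y (scalarOp _),
    ← scalarOp_mul_comm _ Y]
  noncomm_ring

theorem CommEq.zero_of_comm {X Y : OneBody} (h : X * Y = Y * X) : CommEq X Y 0 := by
  simp [CommEq, h]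

/-- The commutator is of the form `N⁻¹ Z` with `Z` homogeneous. -/
def CommGain (v w : ℤ) (X Y : OneBody) : Prop :=
  ∃ Z c, Homog (v + w) Z c ∧ CommEq X Y Z

theorem CommGain.symm {v w : ℤ} {X Y : OneBody} (h : CommGain v w X Y) : CommGain w v Y X := by
  obtain ⟨Z, c, hZ, h⟩ := h
  exact ⟨_, _, ((Homog.scalar (c := fun _ => -1) tendsto_const_nhds).mul hZ).cast (by ring) rfl rfl,
    h.symm⟩

/-- The commutator with a fixed operator is a derivation, so the generators suffice; scalars commute
with everything. -/
theorem CommGain.of_gens {v : ℤ} {X : OneBody}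
    (h1 : CommGain v 1 X shiftOp) (h2 : CommGain v (-1) X derivOp) {w : ℤ} {Y : OneBody} {b : ℂ}
    (hY : Homog w Y b) : CommGain v w X Y := by
  induction hY with
  | shift => exact h1
  | deriv => exact h2
  | scalar h => exact ⟨0, 0, Homog.zero _, .zero_of_comm (scalarOp_mul_comm _ _).symm⟩
  | zero w => exact ⟨0, 0, Homog.zero _, .zero_of_comm (by simp)⟩
  | add _ _ i1 i2 =>
    obtain ⟨Z, c, hZ, e⟩ := i1
    obtain ⟨Z', c', hZ', e'⟩ := i2
    exact ⟨Z + Z', c + c', hZ.add hZ', e.add_right e'⟩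
  | @mul w w' Y Y' b b' hY hY' i1 i2 =>
    obtain ⟨Z, c, hZ, e⟩ := i1
    obtain ⟨Z', c', hZ', e'⟩ := i2
    exact ⟨Z * Y' + Y * Z', c * b' + b * c',
      ((hZ.mul hY').cast (add_assoc _ _ _) rfl rfl).add
        ((hY.mul hZ').cast (by ring) rfl rfl), e.mul_right e'⟩

/-- The reduction to generators is applied in each slot in turn; it leaves only the pair `shiftOp`,
`derivOp`, since each generator commutes with itself. -/
theorem Homog.commGain {v w : ℤ} {X Y : OneBody} {a b : ℂ} (hX : Homog v X a) (hY : Homog w Y b) :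
    CommGain v w X Y := by
  have hsd : CommGain 1 (-1) shiftOp derivOp :=
    ⟨_, -1, (Homog.scalar tendsto_const_nhds).cast (by norm_num) rfl rfl, shiftOp_derivOp⟩
  have hs : CommGain 1 w shiftOp Y :=
    CommGain.of_gens ⟨0, 0, Homog.zero _, .zero_of_comm rfl⟩ hsd hY
  have hd : CommGain (-1) w derivOp Y :=
    CommGain.of_gens hsd.symm ⟨0, 0, Homog.zero _, .zero_of_comm rfl⟩ hY
  exact (CommGain.of_gens hs.symm hd.symm hX).symm

theorem Homog.comm_symb {v : ℤ} {X Y : OneBody} {a : ℂ} {g : LaurentPolynomial ℂ}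
    (hX : Homog v X a) (hY : Symb Y g) : ∃ Z f, Symb Z f ∧ CommEq X Y Z := by
  induction hY with
  | homog h =>
    obtain ⟨Z, c, hZ, e⟩ := hX.commGain h
    exact ⟨Z, _, Symb.homog hZ, e⟩
  | add _ _ i1 i2 =>
    obtain ⟨Z, c, hZ, e⟩ := i1
    obtain ⟨Z', c', hZ', e'⟩ := i2
    exact ⟨Z + Z', _, hZ.add hZ', e.add_right e'⟩

/-! ### Locality and equivariance -/

theorem shiftOp_commute_derivOp {N : ℕ} {i j : Fin N} (h : i ≠ j) :
    Commute (shiftOp N i) (derivOp N j) := by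
  refine LinearMap.ext fun p => ?_
  simp [shiftOp, derivOp, Derivation.leibniz, MvPolynomial.pderiv_X, h]

theorem derivOp_commute_derivOp {N : ℕ} {i j : Fin N} : Commute (derivOp N i) (derivOp N j) := by
  refine LinearMap.ext fun p => ?_
  have : (MvPolynomial.pderiv i) (MvPolynomial.pderiv j p)
      = (MvPolynomial.pderiv j) (MvPolynomial.pderiv i p) := by
    let D (k : Fin N) : Derivation ℂ (MvPolynomial (Fin N) ℂ) (MvPolynomial (Fin N) ℂ) :=
      MvPolynomial.pderiv k
    have h : ⁅D i, D j⁆ = 0 := by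
      refine MvPolynomial.derivation_ext fun k => ?_
      simp only [D, Derivation.commutator_apply, MvPolynomial.pderiv_X, Pi.single_apply]
      split_ifs <;> simp
    have := congrArg (fun D => D p) h
    simpa [D, Derivation.commutator_apply, sub_eq_zero] using this
  simp [derivOp, this, smul_smul]

theorem Homog.commute_of_gens {N : ℕ} {i : Fin N} {A : Module.End ℂ (MvPolynomial (Fin N) ℂ)}
    (h1 : Commute A (shiftOp N i)) (h2 : Commute A (derivOp N i)) {w : ℤ} {Y : OneBody} {b : ℂ}
    (hY : Homog w Y b) : Commute A (Y N i) := by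
  induction hY with
  | shift => exact h1
  | deriv => exact h2
  | scalar _ => exact (Algebra.commutes _ _).symm
  | zero => exact Commute.zero_right _
  | add _ _ i1 i2 => exact i1.add_right i2
  | mul _ _ i1 i2 => exact i1.mul_right i2

theorem Homog.commute {v w : ℤ} {X Y : OneBody} {a b : ℂ} (hX : Homog v X a) (hY : Homog w Y b)
    {N : ℕ} {i j : Fin N} (h : i ≠ j) : Commute (X N i) (Y N j) := by
  have hss : Commute (shiftOp N i) (shiftOp N j) := by
    refine LinearMap.ext fun p => ?_
    simp [shiftOp, mul_left_comm]
  refine Homog.commute_of_gens ?_ ?_ hY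
  · exact (Homog.commute_of_gens hss.symm (shiftOp_commute_derivOp h.symm) hX).symm
  · exact (Homog.commute_of_gens (shiftOp_commute_derivOp h).symm derivOp_commute_derivOp hX).symm

theorem Symb.commute {X Y : OneBody} {f g : LaurentPolynomial ℂ} (hX : Symb X f) (hY : Symb Y g)
    {N : ℕ} {i j : Fin N} (h : i ≠ j) : Commute (X N i) (Y N j) := by
  induction hX with
  | homog hX =>
    induction hY with
    | homog hY => exact hX.commute hY h
    | add _ _ h1 h2 => exact h1.add_right h2
  | add _ _ h1 h2 => exact h1.add_left h2

/-- The second quantization of a one-body operator. -/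
def secondQ (X : OneBody) (N : ℕ) : Module.End ℂ (MvPolynomial (Fin N) ℂ) := ∑ i, X N i

@[simp] theorem secondQ_add (X Y : OneBody) (N : ℕ) :
    secondQ (X + Y) N = secondQ X N + secondQ Y N := by
  simp [secondQ, Finset.sum_add_distrib]

theorem secondQ_scalarOp_mul (c : ℕ → ℂ) (X : OneBody) (N : ℕ) :
    secondQ (scalarOp c * X) N = c N • secondQ X N := by
  simp [secondQ, scalarOp, Algebra.smul_def, Finset.mul_sum]

/-- Operators in different variables commute, so only the diagonal terms of the double sum
contribute: second quantization respects commutators. -/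
theorem secondQ_comm {X Y Z : OneBody} {f g : LaurentPolynomial ℂ} (hX : Symb X f) (hY : Symb Y g)
    (h : CommEq X Y Z) (N : ℕ) :
    secondQ X N * secondQ Y N = secondQ Y N * secondQ X N + (N : ℂ)⁻¹ • secondQ Z N := by
  rw [← secondQ_scalarOp_mul (fun N => (N : ℂ)⁻¹)]
  simp only [secondQ, Finset.sum_mul_sum]
  rw [Finset.sum_comm (f := fun i j => Y N i * X N j), ← Finset.sum_add_distrib]
  refine Finset.sum_congr rfl fun i _ => ?_
  rw [← Finset.add_sum_erase _ _ (Finset.mem_univ i),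
    ← Finset.add_sum_erase _ (fun j => Y N j * X N i) (Finset.mem_univ i)]
  have h1 : X N i * Y N i = Y N i * X N i + (scalarOp (fun N => (N : ℂ)⁻¹) * Z) N i :=
    congrFun (congrFun h N) i
  rw [h1, Finset.sum_congr rfl fun j hj => (hX.commute hY (Finset.ne_of_mem_erase hj).symm).eq]
  abel

theorem Homog.rename {w : ℤ} {X : OneBody} {a : ℂ} (hX : Homog w X a) {N : ℕ}
    (σ : Equiv.Perm (Fin N)) (i : Fin N) (p : MvPolynomial (Fin N) ℂ) :
    MvPolynomial.rename σ (X N i p) = X N (σ i) (MvPolynomial.rename σ p) := by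
  induction hX generalizing p with
  | shift => simp [shiftOp]
  | deriv => simp [derivOp, MvPolynomial.pderiv_rename σ.injective]
  | scalar _ => simp [scalarOp]
  | zero => simp
  | add _ _ h1 h2 => simp [h1, h2]
  | mul _ _ h1 h2 => simp [h1, h2]

theorem Symb.rename {X : OneBody} {f : LaurentPolynomial ℂ} (hX : Symb X f) {N : ℕ}
    (σ : Equiv.Perm (Fin N)) (i : Fin N) (p : MvPolynomial (Fin N) ℂ) :
    MvPolynomial.rename σ (X N i p) = X N (σ i) (MvPolynomial.rename σ p) := by
  induction hX with
  | homog h => exact h.rename σ i p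
  | add _ _ h1 h2 => simp [h1, h2]

/-- Antisymmetric polynomials. -/
def Antisym {N : ℕ} (F : MvPolynomial (Fin N) ℂ) : Prop :=
  ∀ i j : Fin N, i ≠ j → MvPolynomial.rename (Equiv.swap i j) F = -F

theorem Antisym.secondQ {X : OneBody} {f : LaurentPolynomial ℂ} (hX : Symb X f) {N : ℕ}
    {F : MvPolynomial (Fin N) ℂ} (hF : Antisym F) : Antisym (secondQ X N F) := by
  intro i j hij
  simp only [SchurCLT.secondQ, LinearMap.sum_apply, map_sum, hX.rename, hF i j hij, map_neg,
    Finset.sum_neg_distrib, neg_inj]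
  exact Equiv.sum_comp (Equiv.swap i j) fun k => X N k F

theorem Antisym.add {N : ℕ} {F G : MvPolynomial (Fin N) ℂ} (hF : Antisym F) (hG : Antisym G) :
    Antisym (F + G) := fun i j h => by
  rw [map_add, hF i j h, hG i j h]; abel

theorem Antisym.smul {N : ℕ} {F : MvPolynomial (Fin N) ℂ} (c : ℂ) (hF : Antisym F) :
    Antisym (c • F) := fun i j h => by
  rw [map_smul, hF i j h, smul_neg]

/-- The Pauli exclusion principle: swapping two equal exponents fixes the monomial and negates its
coefficient. -/
theorem Antisym.coeff_eq_zero {N : ℕ} {F : MvPolynomial (Fin N) ℂ} (hF : Antisym F)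
    {κ : Fin N →₀ ℕ} {i j : Fin N} (hij : i ≠ j) (h : κ i = κ j) :
    MvPolynomial.coeff κ F = 0 := by
  have h1 := congrArg (MvPolynomial.coeff (κ.mapDomain (Equiv.swap i j))) (hF i j hij)
  rw [MvPolynomial.coeff_rename_mapDomain _ (Equiv.injective _), MvPolynomial.coeff_neg] at h1
  have h2 : κ.mapDomain (Equiv.swap i j) = κ := by
    ext k
    rw [← Finsupp.equivMapDomain_eq_mapDomain, Finsupp.equivMapDomain_apply, Equiv.symm_swap,
      Equiv.swap_apply_def]
    split_ifs <;> simp_all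
  rw [h2] at h1
  exact self_eq_neg.1 h1

/-! ### Matrix entries and the vacuum -/

/-- The matrix entries of a homogeneous operator in the monomial basis. -/
def HasEntries (w : ℤ) (X : OneBody) (e : ℕ → ℤ → ℂ) : Prop :=
  (∀ N (i : Fin N) (κ : Fin N →₀ ℕ), X N i (MvPolynomial.monomial κ 1) =
    e N (κ i) • MvPolynomial.monomial (κ.update i ((κ i : ℤ) + w).toNat) 1) ∧
  ∀ N (m : ℕ), (m : ℤ) + w < 0 → e N m = 0

/-- The truncation by `toNat` is harmless: if the intermediate exponent would be negative, the entry
of Y there is already zero. -/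
theorem HasEntries.mul {v w : ℤ} {X Y : OneBody} {e f : ℕ → ℤ → ℂ} (hX : HasEntries v X e)
    (hY : HasEntries w Y f) : HasEntries (v + w) (X * Y) (fun N m => e N (m + w) * f N m) := by
  constructor
  · intro N i κ
    change X N i (Y N i _) = _
    rw [hY.1, map_smul, hX.1]
    rcases lt_or_ge ((κ i : ℤ) + w) 0 with h | h
    · simp [hY.2 N _ h]
    · have h1 : (((κ i : ℤ) + w).toNat : ℤ) = κ i + w := Int.toNat_of_nonneg h
      simp only [Finsupp.coe_update, Function.update_self, h1, smul_smul]
      rw [mul_comm]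
      congr 3
      · ext j
        rcases eq_or_ne j i with rfl | hj
        · simp [add_assoc, add_comm]
        · simp [hj]
  · intro N m hm
    rcases lt_or_ge ((m : ℤ) + w) 0 with h | h
    · simp [hY.2 N _ h]
    · have h1 : (((m : ℤ) + w).toNat : ℤ) = m + w := Int.toNat_of_nonneg h
      have := hX.2 N ((m : ℤ) + w).toNat (by omega)
      rw [h1] at this
      simp [this]

/-- The limit is taken at exponents N + j with j fixed, that is, next to the highest filled level.
No other entries enter the limiting commutators. -/
theorem Homog.exists_entries {w : ℤ} {X : OneBody} {a : ℂ} (hX : Homog w X a) :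
    ∃ e, HasEntries w X e ∧ ∀ j : ℤ, Tendsto (fun N : ℕ => e N (N + j)) atTop (𝓝 a) := by
  induction hX with
  | shift =>
    refine ⟨fun _ _ => 1, ⟨fun N i κ => ?_, fun N m h => by omega⟩, fun j => tendsto_const_nhds⟩
    simp only [shiftOp, LinearMap.mulLeft_apply, MvPolynomial.X, MvPolynomial.monomial_mul, mul_one,
      one_smul]
    refine congrArg (fun κ => MvPolynomial.monomial κ (1 : ℂ)) (Finsupp.ext fun j => ?_)
    rcases eq_or_ne j i with rfl | hj
    · simp only [Finsupp.add_apply, Finsupp.single_eq_same, Finsupp.coe_update,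
        Function.update_self]
      omega
    · simp [hj]
  | deriv =>
    refine ⟨fun N m => (N : ℂ)⁻¹ * m, ⟨fun N i κ => ?_, fun N m h => ?_⟩, fun j => ?_⟩
    · simp only [derivOp, LinearMap.smul_apply, Derivation.coeFn_coe,
        MvPolynomial.pderiv_monomial, one_mul, mul_smul]
      congr 1
      rw [MvPolynomial.smul_monomial]
      rcases Nat.eq_zero_or_pos (κ i) with h | h
      · simp [h]
      · have : κ - Finsupp.single i 1 = κ.update i ((κ i : ℤ) + -1).toNat := by
          ext j
          rcases eq_or_ne j i with rfl | hj
          · simp only [Finsupp.coe_tsub, Pi.sub_apply, Finsupp.single_eq_same, Finsupp.coe_update,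
              Function.update_self]
            omega
          · simp [hj]
        rw [this]
        simp
    · have : m = 0 := by omega
      simp [this]
    -- The entry of N⁻¹ ∂ at exponent N + j is (N + j)/N = 1 + j/N.
    · have h1 : Tendsto (fun N : ℕ => 1 + (j : ℂ) * ((N : ℂ)⁻¹)) atTop (𝓝 (1 + j * 0)) :=
        (tendsto_inv_atTop_nhds_zero_nat (𝕜 := ℂ)).const_mul _ |>.const_add _
      rw [mul_zero, add_zero] at h1
      refine h1.congr' ?_
      filter_upwards [eventually_gt_atTop 0] with N hN
      have : (N : ℂ) ≠ 0 := by exact_mod_cast hN.ne'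
      push_cast
      field_simp
  | @scalar c l h =>
    refine ⟨fun N _ => c N, ⟨fun N i κ => ?_, fun N m h => by omega⟩, fun j => h⟩
    simp [scalarOp]
  | zero w => exact ⟨fun _ _ => 0, ⟨by simp, by simp⟩, fun _ => tendsto_const_nhds⟩
  | add _ _ h1 h2 =>
    obtain ⟨e, he, hl⟩ := h1
    obtain ⟨f, hf, hl'⟩ := h2
    refine ⟨fun N m => e N m + f N m, ⟨fun N i κ => ?_, fun N m h => ?_⟩,
      fun j => (hl j).add (hl' j)⟩
    · simp [he.1, hf.1, add_smul]
    · simp [he.2 N m h, hf.2 N m h]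
  | @mul v w _ _ _ _ _ _ h1 h2 =>
    obtain ⟨e, he, hl⟩ := h1
    obtain ⟨f, hf, hl'⟩ := h2
    refine ⟨_, he.mul hf, fun j => ?_⟩
    simpa [add_assoc] using (hl (j + w)).mul (hl' j)

/-- The exponent `(0, 1, …, N - 1)`. -/
def stair (N : ℕ) : Fin N →₀ ℕ := Finsupp.equivFunOnFinite.symm fun i => (i : ℕ)

/-- The exponent `(0, 1, …, N - 1)`, permuted. -/
def permStair {N : ℕ} (σ : Equiv.Perm (Fin N)) : Fin N →₀ ℕ :=
  Finsupp.equivFunOnFinite.symm fun i => (σ i : ℕ)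

@[simp] theorem stair_apply {N : ℕ} (i : Fin N) : stair N i = i := rfl

@[simp] theorem permStair_apply {N : ℕ} (σ : Equiv.Perm (Fin N)) (i : Fin N) :
    permStair σ i = σ i := rfl

/-- The Vandermonde determinant. -/
def vac (N : ℕ) : MvPolynomial (Fin N) ℂ :=
  (Matrix.vandermonde fun i : Fin N => (MvPolynomial.X i : MvPolynomial (Fin N) ℂ)).det

theorem monomial_permStair {N : ℕ} (σ : Equiv.Perm (Fin N)) :
    MvPolynomial.monomial (permStair σ) (1 : ℂ) = ∏ i, MvPolynomial.X i ^ (σ i : ℕ) := by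
  rw [MvPolynomial.monomial_eq, map_one, one_mul, Finsupp.prod_fintype _ _ (by simp)]
  rfl

theorem vac_eq_sum (N : ℕ) : vac N = ∑ σ : Equiv.Perm (Fin N),
    ((Equiv.Perm.sign σ : ℤ) : ℂ) • MvPolynomial.monomial (permStair σ) 1 := by
  rw [vac, ← Matrix.det_transpose, Matrix.det_apply']
  refine Finset.sum_congr rfl fun σ _ => ?_
  rw [monomial_permStair, Algebra.smul_def]
  simp [Matrix.vandermonde_apply]

theorem antisym_vac (N : ℕ) : Antisym (vac N) := by
  intro i j hij
  have h1 : MvPolynomial.rename (Equiv.swap i j) (vac N) = ((Matrix.vandermonde fun i : Fin N =>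
      (MvPolynomial.X i : MvPolynomial (Fin N) ℂ)).submatrix (Equiv.swap i j) id).det := by
    unfold vac
    rw [AlgHom.map_det]
    congr 1
    ext a b
    simp [Matrix.vandermonde_apply]
  rw [h1, Matrix.det_permute, Equiv.Perm.sign_swap hij]
  simp [vac]

/-- The coefficient of the staircase monomial. -/
def vev (N : ℕ) : MvPolynomial (Fin N) ℂ →ₗ[ℂ] ℂ := MvPolynomial.lcoeff ℂ (stair N)

theorem vev_apply {N : ℕ} (F : MvPolynomial (Fin N) ℂ) :
    vev N F = MvPolynomial.coeff (stair N) F := rfl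

theorem vev_vac (N : ℕ) : vev N (vac N) = 1 := by
  rw [vac_eq_sum, map_sum, Finset.sum_eq_single 1]
  · rw [map_smul, vev_apply, MvPolynomial.coeff_monomial, if_pos (by ext; simp)]
    simp
  · intro σ _ hσ
    rw [map_smul, vev_apply, MvPolynomial.coeff_monomial, if_neg, smul_zero]
    intro h
    refine hσ (Equiv.ext fun i => Fin.ext ?_)
    simpa using DFunLike.congr_fun h i
  · simp

/-- A monomial raised to the staircase at position i agrees with the staircase elsewhere and has
exponent κ i < i there. That exponent already occurs at position κ i, so the coefficient vanishes by
exclusion. -/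
theorem Homog.vev_secondQ_of_pos {w : ℤ} {X : OneBody} {a : ℂ} (hX : Homog w X a) (hw : 0 < w)
    {N : ℕ} {F : MvPolynomial (Fin N) ℂ} (hF : Antisym F) : vev N (secondQ X N F) = 0 := by
  obtain ⟨e, he, -⟩ := hX.exists_entries
  rw [secondQ, LinearMap.sum_apply, map_sum]
  refine Finset.sum_eq_zero fun i _ => ?_
  conv_lhs => rw [F.as_sum]
  rw [map_sum, map_sum]
  refine Finset.sum_eq_zero fun κ _ => ?_
  rw [← mul_one (MvPolynomial.coeff κ F), ← smul_eq_mul, ← MvPolynomial.smul_monomial, map_smul, he.1, map_smul,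
    map_smul, vev_apply, MvPolynomial.coeff_monomial]
  split_ifs with h
  · have h1 : ((κ i : ℤ) + w).toNat = i := by simpa using DFunLike.congr_fun h i
    have h2 : κ i < i := by omega
    have h3 : κ i < N := h2.trans i.2
    have h4 : (⟨κ i, h3⟩ : Fin N) ≠ i := fun h => by
      have := congrArg Fin.val h
      simp at this
      omega
    have h5 : κ ⟨κ i, h3⟩ = κ i := by
      have := DFunLike.congr_fun h ⟨κ i, h3⟩
      simpa [h4] using this
    simp [hF.coeff_eq_zero h4 h5]
  · simp

/-- All levels below N are filled: a lowered exponent either becomes negative, where the entry is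
zero, or collides with another exponent, where exclusion applies. -/
theorem Homog.secondQ_vac_of_neg {w : ℤ} {X : OneBody} {a : ℂ} (hX : Homog w X a) (hw : w < 0)
    (N : ℕ) : secondQ X N (vac N) = 0 := by
  obtain ⟨e, he, -⟩ := hX.exists_entries
  have hanti : Antisym (secondQ X N (vac N)) := (antisym_vac N).secondQ (Symb.homog hX)
  ext κ
  rw [MvPolynomial.coeff_zero]
  by_contra hne
  have hne' := hne
  rw [secondQ, LinearMap.sum_apply, MvPolynomial.coeff_sum] at hne'
  obtain ⟨i, -, hi⟩ := Finset.exists_ne_zero_of_sum_ne_zero hne'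
  rw [vac_eq_sum, map_sum, MvPolynomial.coeff_sum] at hi
  obtain ⟨σ, -, hσ⟩ := Finset.exists_ne_zero_of_sum_ne_zero hi
  rw [map_smul, he.1, MvPolynomial.coeff_smul, MvPolynomial.coeff_smul,
    MvPolynomial.coeff_monomial] at hσ
  split_ifs at hσ with h
  · have h0 : e N (permStair σ i) ≠ 0 := fun h0 => hσ (by rw [h0, zero_smul, smul_zero])
    have h1 : 0 ≤ ((σ i : ℕ) : ℤ) + w := by
      by_contra hlt
      exact h0 (he.2 N _ (by simpa using hlt))
    have h2 : (((σ i : ℕ) : ℤ) + w).toNat < N := by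
      have := (σ i).2
      omega
    set j := σ.symm ⟨_, h2⟩ with hj
    have h3 : ((σ j : ℕ) : ℤ) = σ i + w := by
      simp [hj, h1]
    have hij : j ≠ i := by
      rintro h
      rw [h] at h3
      omega
    refine hne (hanti.coeff_eq_zero hij ?_)
    rw [← h]
    simp only [Finsupp.coe_update, Function.update_self, permStair_apply, Function.update_of_ne hij]
    omega
  · simp at hσ

/-- Weight-zero operators are diagonal on monomials, and every monomial of the Vandermonde
determinant has the same set of exponents 0, …, N-1, hence the same eigenvalue. -/
theorem HasEntries.secondQ_vac {X : OneBody} {e : ℕ → ℤ → ℂ} (he : HasEntries 0 X e) (N : ℕ) :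
    secondQ X N (vac N) = (∑ m ∈ Finset.range N, e N m) • vac N := by
  rw [vac_eq_sum, map_sum, Finset.smul_sum]
  refine Finset.sum_congr rfl fun σ _ => ?_
  rw [map_smul, smul_comm]
  congr 1
  rw [secondQ, LinearMap.sum_apply, Finset.sum_range, Finset.sum_smul,
    ← Equiv.sum_comp σ fun m => e N ((m : ℕ) : ℤ) • MvPolynomial.monomial (permStair σ) (1 : ℂ)]
  refine Finset.sum_congr rfl fun i _ => ?_
  rw [he.1]
  refine congrArg (fun κ => e N (σ i : ℕ) • MvPolynomial.monomial κ (1 : ℂ))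
    (Finsupp.ext fun j => ?_)
  rcases eq_or_ne j i with rfl | hj
  · simp
  · simp [hj]

/-- The trace of a one-body operator over the vacuum. -/
def vacTrace (X : OneBody) (N : ℕ) : ℂ := vev N (secondQ X N (vac N))

@[simp] theorem vacTrace_add (X Y : OneBody) (N : ℕ) :
    vacTrace (X + Y) N = vacTrace X N + vacTrace Y N := by
  simp [vacTrace]

theorem Homog.vacTrace_eq_zero {w : ℤ} {X : OneBody} {a : ℂ} (hX : Homog w X a) (hw : w ≠ 0)
    (N : ℕ) : vacTrace X N = 0 := by
  rcases lt_or_gt_of_ne hw with h | h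
  · simp [vacTrace, hX.secondQ_vac_of_neg h]
  · exact hX.vev_secondQ_of_pos h (antisym_vac N)

theorem HasEntries.vacTrace {X : OneBody} {e : ℕ → ℤ → ℂ} (he : HasEntries 0 X e) (N : ℕ) :
    vacTrace X N = ∑ m ∈ Finset.range N, e N m := by
  rw [SchurCLT.vacTrace, he.secondQ_vac, map_smul, vev_vac, smul_eq_mul, mul_one]

/-- The second quantization with the vacuum expectation subtracted. -/
def normalQ (X : OneBody) (N : ℕ) : Module.End ℂ (MvPolynomial (Fin N) ℂ) :=
  secondQ X N + algebraMap ℂ _ (-vacTrace X N)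

theorem normalQ_apply (X : OneBody) (N : ℕ) (F : MvPolynomial (Fin N) ℂ) :
    normalQ X N F = secondQ X N F + (-vacTrace X N) • F := by
  simp [normalQ]

theorem Antisym.normalQ {X : OneBody} {f : LaurentPolynomial ℂ} (hX : Symb X f) {N : ℕ}
    {F : MvPolynomial (Fin N) ℂ} (hF : Antisym F) : Antisym (normalQ X N F) := by
  rw [normalQ_apply]
  exact (hF.secondQ hX).add (hF.smul _)

theorem normalQ_add (X Y : OneBody) (N : ℕ) :
    normalQ (X + Y) N = normalQ X N + normalQ Y N := by
  simp only [normalQ, secondQ_add, vacTrace_add, neg_add, map_add]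
  abel

/-- In weight zero the vacuum is an eigenvector whose eigenvalue is exactly the subtracted trace. -/
theorem Homog.normalQ_vac {w : ℤ} {X : OneBody} {a : ℂ} (hX : Homog w X a) (hw : w ≤ 0) (N : ℕ) :
    normalQ X N (vac N) = 0 := by
  rw [normalQ_apply]
  rcases hw.lt_or_eq with h | rfl
  · rw [hX.secondQ_vac_of_neg h, hX.vacTrace_eq_zero h.ne]
    simp
  · obtain ⟨e, he, -⟩ := hX.exists_entries
    rw [he.secondQ_vac, he.vacTrace, ← add_smul]
    simp

theorem Homog.vev_normalQ_of_pos {w : ℤ} {X : OneBody} {a : ℂ} (hX : Homog w X a) (hw : 0 < w)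
    {N : ℕ} {F : MvPolynomial (Fin N) ℂ} (hF : Antisym F) : vev N (normalQ X N F) = 0 := by
  rw [normalQ_apply, hX.vacTrace_eq_zero hw.ne']
  simp [hX.vev_secondQ_of_pos hw hF]

/-! ### Bosonization: the limiting Heisenberg commutators, Wick's theorem and its Gaussian form. -/

/-! ### The limiting pairing -/

/-- The form `∑_{n ≥ 1} n f_{-n} g_n` on Laurent polynomials. -/
def pairing (f g : LaurentPolynomial ℂ) : ℂ :=
  f.coeff.sum fun w a => ((-w).toNat : ℂ) * a * g.coeff (-w)

theorem pairing_add_left (f f' g : LaurentPolynomial ℂ) :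
    pairing (f + f') g = pairing f g + pairing f' g := by
  unfold pairing
  rw [AddMonoidAlgebra.coeff_add, Finsupp.sum_add_index'] <;> intros <;> ring

theorem pairing_add_right (f g g' : LaurentPolynomial ℂ) :
    pairing f (g + g') = pairing f g + pairing f g' := by
  unfold pairing
  rw [← Finsupp.sum_add]
  refine Finsupp.sum_congr fun w _ => ?_
  rw [AddMonoidAlgebra.coeff_add, Finsupp.add_apply]
  ring

theorem coeff_C_mul_T (a : ℂ) (w v : ℤ) :
    (LaurentPolynomial.C a * LaurentPolynomial.T w).coeff v = if w = v then a else 0 := by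
  rw [← LaurentPolynomial.single_eq_C_mul_T, AddMonoidAlgebra.coeff_single, Finsupp.single_apply]

theorem pairing_C_mul_T (a : ℂ) (w : ℤ) (g : LaurentPolynomial ℂ) :
    pairing (LaurentPolynomial.C a * LaurentPolynomial.T w) g = ((-w).toNat : ℂ) * a * g.coeff (-w) := by
  unfold pairing
  rw [← LaurentPolynomial.single_eq_C_mul_T, AddMonoidAlgebra.coeff_single,
    Finsupp.sum_single_index]
  ring

/-- The central term of the Heisenberg algebra. For weights -n and n the two traces are sums of the
same products over shifted ranges, so the difference telescopes to the n top levels, each of which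
contributes a·b in the limit. Other weights have zero trace. -/
theorem Homog.tendsto_vacTrace_comm {v : ℤ} {X Y : OneBody} {a : ℂ} {g : LaurentPolynomial ℂ}
    (hX : Homog v X a) (hv : v ≤ 0) (hY : Symb Y g) :
    Tendsto (fun N => vacTrace (X * Y) N - vacTrace (Y * X) N) atTop
      (𝓝 (pairing (LaurentPolynomial.C a * LaurentPolynomial.T v) g)) := by
  induction hY with
  | @homog w Y b hY =>
    rw [pairing_C_mul_T, coeff_C_mul_T]
    split_ifs with h
    · subst h
      obtain ⟨n, rfl⟩ : ∃ n : ℕ, v = -n := ⟨(-v).toNat, by omega⟩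
      obtain ⟨e, he, hl⟩ := hX.exists_entries
      obtain ⟨f, hf, hl'⟩ := hY.exists_entries
      have h1 := he.mul hf
      have h2 := hf.mul he
      rw [show -(n : ℤ) + - -n = 0 by ring] at h1
      rw [show - -(n : ℤ) + -n = 0 by ring] at h2
      have key : ∀ᶠ N : ℕ in atTop, ∑ j ∈ Finset.range n, e N (N + j) * f N (N + (j - n))
          = vacTrace (X * Y) N - vacTrace (Y * X) N := by
        filter_upwards [eventually_ge_atTop n] with N hN
        obtain ⟨M, rfl⟩ := Nat.exists_eq_add_of_le' hN
        -- The lowest n levels do not contribute: X would send them to negative exponents.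
        have h0 : ∑ m ∈ Finset.range n, f (M + n) ((m : ℤ) + -n) * e (M + n) m = 0 :=
          Finset.sum_eq_zero fun m hm => by
            rw [he.2 _ m (by have := Finset.mem_range.1 hm; omega), mul_zero]
        rw [h1.vacTrace, h2.vacTrace, Finset.sum_range_add, ← add_comm n M, Finset.sum_range_add,
          add_comm n M, h0, zero_add, eq_sub_iff_add_eq, add_comm]
        congr 1
        · refine Finset.sum_congr rfl fun m _ => ?_
          push_cast
          rw [mul_comm]
          congr 2 <;> ring
        · refine Finset.sum_congr rfl fun m _ => ?_
          push_cast
          congr 2 <;> ring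
      refine Tendsto.congr' key ?_
      have : ((- -(n : ℤ)).toNat : ℂ) * a * b = ∑ j ∈ Finset.range n, a * b := by
        simp [mul_assoc]
      rw [this]
      exact tendsto_finsetSum _ fun j _ => (hl j).mul (hl' (j - n))
    · have h1 : ∀ N, vacTrace (X * Y) N - vacTrace (Y * X) N = 0 := fun N => by
        rw [(hX.mul hY).vacTrace_eq_zero (by omega), (hY.mul hX).vacTrace_eq_zero (by omega),
          sub_zero]
      simp [h1]
  | add _ _ h1 h2 =>
    rw [pairing_add_right]
    refine (h1.add h2).congr fun N => ?_
    rw [mul_add X, add_mul _ _ X, vacTrace_add, vacTrace_add]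
    ring

/-! ### The Wick theorem -/

/-- The derivation of `ℂ[X_0, X_1, …]` which sends `X_j` to the pairing of `f` with `T ^ (j + 1)`. -/
def pairingDeriv (f : LaurentPolynomial ℂ) :
    Derivation ℂ (MvPolynomial ℕ ℂ) (MvPolynomial ℕ ℂ) :=
  MvPolynomial.mkDerivation ℂ fun j =>
    MvPolynomial.C (pairing f (LaurentPolynomial.T ((j : ℤ) + 1)))

theorem pairingDeriv_X (f : LaurentPolynomial ℂ) (j : ℕ) :
    pairingDeriv f (MvPolynomial.X j) =
      MvPolynomial.C (pairing f (LaurentPolynomial.T ((j : ℤ) + 1))) :=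
  MvPolynomial.mkDerivation_X _ _ _

theorem pairingDeriv_add (f f' : LaurentPolynomial ℂ) :
    pairingDeriv (f + f') = pairingDeriv f + pairingDeriv f' := by
  refine MvPolynomial.derivation_ext fun j => ?_
  simp [pairingDeriv_X, pairing_add_left]

/-- The Wick functional: the limit of vacuum expectations of ordered products of operators with the
given symbols, applied to a polynomial in the power sums. -/
def gwick : List (LaurentPolynomial ℂ) → MvPolynomial ℕ ℂ →ₗ[ℂ] ℂ
  | [] => MvPolynomial.lcoeff ℂ 0
  | f :: L => (∑ a : Fin L.length, pairing f L[a] • gwick (L.eraseIdx a)) +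
      gwick L ∘ₗ (pairingDeriv f : MvPolynomial ℕ ℂ →ₗ[ℂ] MvPolynomial ℕ ℂ)
termination_by L => L.length
decreasing_by
  · have := List.length_eraseIdx_le L a
    simp only [List.length_cons]
    omega
  · simp

theorem gwick_nil (g : MvPolynomial ℕ ℂ) : gwick [] g = MvPolynomial.coeff 0 g := by
  rw [gwick]; rfl

theorem gwick_cons (f : LaurentPolynomial ℂ) (L : List (LaurentPolynomial ℂ))
    (g : MvPolynomial ℕ ℂ) : gwick (f :: L) g =
      (∑ a : Fin L.length, pairing f L[a] * gwick (L.eraseIdx a) g) +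
        gwick L (pairingDeriv f g) := by
  rw [gwick]; simp

theorem gwick_cons_add (f f' : LaurentPolynomial ℂ) (L : List (LaurentPolynomial ℂ))
    (g : MvPolynomial ℕ ℂ) : gwick ((f + f') :: L) g = gwick (f :: L) g + gwick (f' :: L) g := by
  simp only [gwick_cons, pairing_add_left, pairingDeriv_add, add_mul, Finset.sum_add_distrib,
    Derivation.add_apply, map_add]
  ring

/-- Moving Q to the right through a product. Each factor passed leaves a commutator, split into an
operator with small coefficient s, which replaces the factor, and a scalar, which deletes it. -/
theorem mul_list_prod_eq {R ι : Type*} [Semiring R] [Algebra ℂ R] (Q : R) (f : ι → R) (z : ι → ι)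
    (c : ι → ℂ) (s : ℂ) (L : List ι)
    (h : ∀ p ∈ L, Q * f p = f p * Q + (s • f (z p) + algebraMap ℂ R (c p))) :
    Q * (L.map f).prod = (L.map f).prod * Q + ∑ a : Fin L.length,
      (s • ((L.set a (z L[a])).map f).prod + c L[a] • ((L.eraseIdx a).map f).prod) := by
  induction L with
  | nil => simp
  | cons p L ih =>
    have ih' := ih fun q hq => h q (List.mem_cons_of_mem _ hq)
    have hp := h p List.mem_cons_self
    simp only [List.map_cons, List.prod_cons, List.length_cons, Fin.sum_univ_succ]
    rw [← mul_assoc, hp, add_mul, mul_assoc (f p), ih', mul_add (f p), Finset.mul_sum]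
    simp only [Fin.val_zero, List.set_cons_zero, List.eraseIdx_cons_zero, Fin.val_succ,
      List.set_cons_succ, List.eraseIdx_cons_succ, List.map_cons, List.prod_cons, mul_add,
      Algebra.mul_smul_comm, Fin.getElem_fin, List.getElem_cons_zero, List.getElem_cons_succ]
    rw [← mul_assoc, add_mul, Algebra.smul_mul_assoc, ← Algebra.smul_def]
    abel

/-- The commutator N⁻¹ Z is split into its centred part and its trace. The trace of N⁻¹ Z is the
difference of the traces of XY and YX, so its limit is available without any control of the trace of
Z itself. -/
theorem normalQ_comm {X Y Z : OneBody} {f g : LaurentPolynomial ℂ} (hX : Symb X f) (hY : Symb Y g)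
    (h : CommEq X Y Z) (N : ℕ) : normalQ X N * normalQ Y N = normalQ Y N * normalQ X N +
      ((N : ℂ)⁻¹ • normalQ Z N + algebraMap ℂ _ (vacTrace (X * Y) N - vacTrace (Y * X) N)) := by
  have h1 : vacTrace (X * Y) N - vacTrace (Y * X) N = (N : ℂ)⁻¹ * vacTrace Z N := by
    have : vacTrace (X * Y) N = vacTrace (Y * X) N + (N : ℂ)⁻¹ * vacTrace Z N := by
      conv_lhs => rw [show X * Y = _ from h]
      rw [vacTrace_add]
      congr 1
      simp [vacTrace, secondQ_scalarOp_mul]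
    rw [this]; ring
  refine LinearMap.ext fun F => ?_
  have h2 := LinearMap.congr_fun (secondQ_comm hX hY h N) F
  simp only [Module.End.mul_apply, LinearMap.add_apply, LinearMap.smul_apply] at h2
  simp only [Module.End.mul_apply, LinearMap.add_apply, LinearMap.smul_apply, normalQ_apply,
    map_add, map_smul, h2, h1, Module.algebraMap_end_apply]
  module

/-- The vector `G`, with limit `g`, tests the ordered products of operators. -/
def IsTest (G : ∀ N, MvPolynomial (Fin N) ℂ) (g : MvPolynomial ℕ ℂ) : Prop :=
  (∀ N, Antisym (G N)) ∧ ∀ L : List (OneBody × LaurentPolynomial ℂ), (∀ p ∈ L, Symb p.1 p.2) →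
    Tendsto (fun N => vev N ((L.map fun p => normalQ p.1 N).prod (G N))) atTop
      (𝓝 (gwick (L.map Prod.snd) g))

theorem antisym_prod_normalQ {L : List (OneBody × LaurentPolynomial ℂ)}
    (hL : ∀ p ∈ L, Symb p.1 p.2) {N : ℕ} {F : MvPolynomial (Fin N) ℂ} (hF : Antisym F) :
    Antisym ((L.map fun p => normalQ p.1 N).prod F) := by
  induction L with
  | nil => simpa using hF
  | cons p L ih =>
    rw [List.map_cons, List.prod_cons, Module.End.mul_apply]
    exact (ih fun q hq => hL q (List.mem_cons_of_mem _ hq)).normalQ (hL p List.mem_cons_self)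

theorem sum_fin_congr {M : Type*} [AddCommMonoid M] {m n : ℕ} (h : m = n) (f : Fin n → M) :
    ∑ a, f a = ∑ a : Fin m, f (a.cast h) := by
  subst h; rfl

/-- Wick's theorem in the limit, by induction on the number of operators. By linearity the leftmost
one is homogeneous. With positive weight its expectation vanishes; otherwise it is moved to the
right until it annihilates the vacuum, and the scalar commutators met on the way converge to the
pairings. -/
theorem isTest_vac : IsTest vac 1 := by
  refine ⟨antisym_vac, fun L => ?_⟩
  induction hn : L.length using Nat.strong_induction_on generalizing L with
  | _ n ih =>
  intro hL
  rcases L with - | ⟨⟨X, f⟩, L⟩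
  · simp [gwick_nil, vev_vac]
  have hX : Symb X f := hL _ List.mem_cons_self
  have hL' : ∀ p ∈ L, Symb p.1 p.2 := fun p hp => hL p (List.mem_cons_of_mem _ hp)
  clear hL
  simp only [List.map_cons, List.prod_cons, Module.End.mul_apply]
  simp only [List.length_cons] at hn
  induction hX with
  | add _ _ h1 h2 =>
    rw [gwick_cons_add]
    refine (h1.add h2).congr fun N => ?_
    rw [normalQ_add, LinearMap.add_apply, map_add]
  | @homog v X a hX =>
    rcases lt_or_ge 0 v with hv | hv
    · have h0 : ∀ g, pairing (LaurentPolynomial.C a * LaurentPolynomial.T v) g = 0 := fun g => by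
        rw [pairing_C_mul_T, show (-v).toNat = 0 by omega]; simp
      simp only [gwick_cons, h0, zero_mul, Finset.sum_const_zero, zero_add, Derivation.map_one_eq_zero,
        map_zero]
      refine tendsto_const_nhds.congr fun N => ?_
      rw [hX.vev_normalQ_of_pos hv (antisym_prod_normalQ hL' (antisym_vac N))]
    · have hz : ∀ p : OneBody × LaurentPolynomial ℂ, ∃ q : OneBody × LaurentPolynomial ℂ,
          Symb p.1 p.2 → Symb q.1 q.2 ∧ CommEq X p.1 q.1 := fun p => by
        by_cases hp : Symb p.1 p.2
        · obtain ⟨Z, f, hZ, e⟩ := hX.comm_symb hp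
          exact ⟨(Z, f), fun _ => ⟨hZ, e⟩⟩
        · exact ⟨p, fun h => absurd h hp⟩
      choose z hz using hz
      have key : ∀ N, vev N (normalQ X N ((L.map fun p => normalQ p.1 N).prod (vac N)))
          = ∑ b : Fin L.length, ((N : ℂ)⁻¹ *
              vev N (((L.set b (z L[b])).map fun p => normalQ p.1 N).prod (vac N)) +
            (vacTrace (X * L[b].1) N - vacTrace (L[b].1 * X) N) *
              vev N (((L.eraseIdx b).map fun p => normalQ p.1 N).prod (vac N))) := fun N => by
        have := mul_list_prod_eq (normalQ X N)
          (fun p : OneBody × LaurentPolynomial ℂ => normalQ p.1 N) z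
          (fun p => vacTrace (X * p.1) N - vacTrace (p.1 * X) N) ((N : ℂ)⁻¹) L
          fun p hp => normalQ_comm (Symb.homog hX) (hL' p hp) (hz p (hL' p hp)).2 N
        have := congrArg (vev N) (LinearMap.congr_fun this (vac N))
        rw [Module.End.mul_apply] at this
        rw [this]
        simp [hX.normalQ_vac hv, LinearMap.sum_apply]
      simp only [key, gwick_cons, Derivation.map_one_eq_zero, map_zero, add_zero]
      rw [sum_fin_congr (List.length_map (as := L) Prod.snd).symm]
      refine tendsto_finsetSum _ fun b _ => ?_
      have hset : ∀ p ∈ L.set b (z L[b]), Symb p.1 p.2 := fun p hp => by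
        rcases List.mem_or_eq_of_mem_set hp with h | rfl
        · exact hL' p h
        · exact (hz _ (hL' _ (List.getElem_mem _))).1
      -- The replaced factor keeps a list shorter than the original by one, so these expectations
      -- converge by induction and the coefficient N⁻¹ removes them.
      have t1 := ih L.length (by omega) (L.set b (z L[b])) (by simp) hset
      have t2 := ih (L.eraseIdx b).length (by
        have := List.length_eraseIdx_le L b; omega) (L.eraseIdx b) rfl
        fun p hp => hL' p (List.mem_of_mem_eraseIdx hp)
      have t3 := hX.tendsto_vacTrace_comm hv (hL' L[b] (List.getElem_mem _))
      have := ((tendsto_inv_atTop_nhds_zero_nat (𝕜 := ℂ)).mul t1).add (t3.mul t2)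
      rw [zero_mul, zero_add] at this
      simpa [List.eraseIdx_map] using this

theorem pairing_T_of_pos {j : ℤ} (hj : 0 < j) (g : LaurentPolynomial ℂ) :
    pairing (LaurentPolynomial.T j) g = 0 := by
  have := pairing_C_mul_T 1 j g
  rw [map_one, one_mul] at this
  rw [this, show (-j).toNat = 0 by omega]; simp

/-- A positive power of T pairs to zero as a left argument, so at the right end it is only
contracted with the symbols before it. This is how the derivations `pairingDeriv` act on the
variable X_j. -/
theorem gwick_append_T (L : List (LaurentPolynomial ℂ)) (j : ℕ) (g : MvPolynomial ℕ ℂ) :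
    gwick (L ++ [LaurentPolynomial.T ((j : ℤ) + 1)]) g = gwick L (MvPolynomial.X j * g) := by
  induction hn : L.length using Nat.strong_induction_on generalizing L g with
  | _ n ih =>
  rcases L with - | ⟨f, L⟩
  · have : pairingDeriv (LaurentPolynomial.T ((j : ℤ) + 1)) = 0 := by
      refine MvPolynomial.derivation_ext fun i => ?_
      simp [pairingDeriv_X, pairing_T_of_pos (show 0 < (j : ℤ) + 1 by omega)]
    simp [gwick_cons, this, gwick_nil, MvPolynomial.coeff_X_mul']
  · simp only [List.length_cons] at hn
    rw [List.cons_append, gwick_cons, gwick_cons]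
    have hlen : L.length + 1 = (L ++ [LaurentPolynomial.T ((j : ℤ) + 1)]).length := by simp
    have hsum := sum_fin_congr hlen fun a =>
      pairing f (L ++ [LaurentPolynomial.T ((j : ℤ) + 1)])[a] *
        gwick ((L ++ [LaurentPolynomial.T ((j : ℤ) + 1)]).eraseIdx a) g
    refine (congrArg (· + _) hsum).trans ?_
    rw [Fin.sum_univ_castSucc]
    have e1 : ∀ b : Fin L.length, gwick (L.eraseIdx b ++ [LaurentPolynomial.T ((j : ℤ) + 1)]) g =
        gwick (L.eraseIdx b) (MvPolynomial.X j * g) := fun b =>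
      ih _ (by have := List.length_eraseIdx_le L b; omega) _ _ rfl
    simp only [Fin.getElem_fin, Fin.val_cast, Fin.val_castSucc, Fin.val_last,
      List.getElem_append_left, Fin.is_lt, List.eraseIdx_append_of_lt_length, e1]
    rw [ih L.length (by omega) L _ rfl]
    simp only [List.getElem_append_right, le_refl, Derivation.leibniz, pairingDeriv_X, smul_eq_mul,
      map_add, List.eraseIdx_append_of_length_le]
    simp only [Nat.sub_self, List.getElem_cons_zero, List.eraseIdx_cons_zero, List.append_nil,
      mul_comm g, MvPolynomial.C_mul', map_smul, smul_eq_mul]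
    ring

/-- The power sum operator: multiplication by `∑_i X_i ^ (j + 1)`. -/
theorem secondQ_shiftOp_pow (N k : ℕ) (F : MvPolynomial (Fin N) ℂ) :
    secondQ (shiftOp ^ k) N F = MvPolynomial.psum (Fin N) ℂ k * F := by
  have : ∀ i : Fin N, (shiftOp ^ k) N i F = MvPolynomial.X i ^ k * F := fun i => by
    induction k generalizing F with
    | zero => simp
    | succ k ih =>
      rw [pow_succ]
      change (shiftOp ^ k) N i (shiftOp N i F) = _
      rw [ih, pow_succ, mul_assoc]
      rfl
  simp only [secondQ, LinearMap.sum_apply, this, MvPolynomial.psum, Finset.sum_mul]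

theorem Homog.shift_pow (k : ℕ) : Homog k (shiftOp ^ k) 1 := by
  induction k with
  | zero =>
    refine (Homog.scalar (c := fun _ => 1) tendsto_const_nhds).cast (by simp) ?_ rfl
    funext N i
    simp [scalarOp]
  | succ k ih => exact (ih.mul Homog.shift).cast (by push_cast; rfl) (by rw [pow_succ]) (by simp)

theorem Symb.shift_pow (k : ℕ) : Symb (shiftOp ^ k) (LaurentPolynomial.T k) := by
  simpa using Symb.homog (Homog.shift_pow k)

/-- Multiplication by a power sum is the second quantization of a power of `shiftOp`; having
positive weight it has trace zero and needs no centring. It can therefore be appended to the list of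
operators. -/
theorem IsTest.psum_mul {G : ∀ N, MvPolynomial (Fin N) ℂ} {g : MvPolynomial ℕ ℂ} (h : IsTest G g)
    (j : ℕ) :
    IsTest (fun N => MvPolynomial.psum (Fin N) ℂ (j + 1) * G N) (MvPolynomial.X j * g) := by
  refine ⟨fun N => ?_, fun L hL => ?_⟩
  · change Antisym (MvPolynomial.psum (Fin N) ℂ (j + 1) * G N)
    rw [← secondQ_shiftOp_pow]
    exact (h.1 N).secondQ (Symb.shift_pow _)
  · have := h.2 (L ++ [(shiftOp ^ (j + 1), LaurentPolynomial.T ((j : ℤ) + 1))]) (by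
      intro p hp
      rcases List.mem_append.1 hp with hp | hp
      · exact hL p hp
      · rw [List.mem_singleton.1 hp]
        exact_mod_cast Symb.shift_pow (j + 1))
    rw [List.map_append, List.map_singleton, gwick_append_T] at this
    refine this.congr fun N => ?_
    rw [List.map_append, List.prod_append, Module.End.mul_apply, List.map_singleton,
      List.prod_singleton, normalQ_apply, secondQ_shiftOp_pow,
      (Homog.shift_pow (j + 1)).vacTrace_eq_zero (by positivity)]
    simp

theorem IsTest.add {G G' : ∀ N, MvPolynomial (Fin N) ℂ} {g g' : MvPolynomial ℕ ℂ} (h : IsTest G g)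
    (h' : IsTest G' g') : IsTest (fun N => G N + G' N) (g + g') := by
  refine ⟨fun N => (h.1 N).add (h'.1 N), fun L hL => ?_⟩
  simpa only [map_add] using (h.2 L hL).add (h'.2 L hL)

theorem IsTest.smul {G : ∀ N, MvPolynomial (Fin N) ℂ} {g : MvPolynomial ℕ ℂ} (h : IsTest G g)
    {c : ℕ → ℂ} {l : ℂ} (hc : Tendsto c atTop (𝓝 l)) : IsTest (fun N => c N • G N) (l • g) := by
  refine ⟨fun N => (h.1 N).smul _, fun L hL => ?_⟩
  simpa only [map_smul, smul_eq_mul] using hc.mul (h.2 L hL)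

/-- Convergence of a sequence of polynomials, with all coefficients in a finite set of monomials. -/
inductive PolyLim : (ℕ → MvPolynomial ℕ ℂ) → MvPolynomial ℕ ℂ → Prop
  | X (j : ℕ) : PolyLim (fun _ => MvPolynomial.X j) (MvPolynomial.X j)
  | C {c : ℕ → ℂ} {l : ℂ} (h : Tendsto c atTop (𝓝 l)) :
      PolyLim (fun N => MvPolynomial.C (c N)) (MvPolynomial.C l)
  | add {p q : ℕ → MvPolynomial ℕ ℂ} {p' q' : MvPolynomial ℕ ℂ} (hp : PolyLim p p')
      (hq : PolyLim q q') : PolyLim (fun N => p N + q N) (p' + q')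
  | mul {p q : ℕ → MvPolynomial ℕ ℂ} {p' q' : MvPolynomial ℕ ℂ} (hp : PolyLim p p')
      (hq : PolyLim q q') : PolyLim (fun N => p N * q N) (p' * q')

/-- Evaluation at the power sums. -/
def atPsum (N : ℕ) : MvPolynomial ℕ ℂ →ₐ[ℂ] MvPolynomial (Fin N) ℂ :=
  MvPolynomial.aeval fun j => MvPolynomial.psum (Fin N) ℂ (j + 1)

theorem IsTest.poly_mul {p : ℕ → MvPolynomial ℕ ℂ} {p' : MvPolynomial ℕ ℂ} (hp : PolyLim p p')
    {G : ∀ N, MvPolynomial (Fin N) ℂ} {g : MvPolynomial ℕ ℂ} (h : IsTest G g) :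
    IsTest (fun N => atPsum N (p N) * G N) (p' * g) := by
  induction hp generalizing G g with
  | X j => simpa [atPsum] using h.psum_mul j
  | C hc => simpa [atPsum, MvPolynomial.C_mul', MvPolynomial.algebraMap_eq] using h.smul hc
  | add _ _ h1 h2 => simpa [add_mul] using (h1 h).add (h2 h)
  | mul _ _ h1 h2 => simpa [mul_assoc] using h1 (h2 h)

/-- The convergence in `IsTest` is not affected by a vanishing perturbation of the operators. -/
theorem IsTest.tendsto_perturb {G : ∀ N, MvPolynomial (Fin N) ℂ} {g : MvPolynomial ℕ ℂ}
    (h : IsTest G g) {ι : Type*} (P : ι → OneBody × LaurentPolynomial ℂ)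
    (hP : ∀ k, Symb (P k).1 (P k).2) (y : ℕ → ι → ℂ) (K : List ι)
    (hy : ∀ k ∈ K, Tendsto (fun N => y N k - vacTrace (P k).1 N) atTop (𝓝 0))
    (L : List (OneBody × LaurentPolynomial ℂ)) (hL : ∀ p ∈ L, Symb p.1 p.2) :
    Tendsto (fun N => vev N ((L.map fun p => normalQ p.1 N).prod
      ((K.map fun k => secondQ (P k).1 N + algebraMap ℂ _ (-y N k)).prod (G N)))) atTop
      (𝓝 (gwick ((L ++ K.map P).map Prod.snd) g)) := by
  induction K generalizing L with
  | nil => simpa using h.2 L hL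
  | cons k K ih =>
    have t1 := ih (fun q hq => hy q (List.mem_cons_of_mem _ hq)) (L ++ [P k]) (fun q hq => by
      rcases List.mem_append.1 hq with hq | hq
      · exact hL q hq
      · rw [List.mem_singleton.1 hq]; exact hP k)
    have t2 := ih (fun q hq => hy q (List.mem_cons_of_mem _ hq)) L hL
    -- Centring by y differs from centring by the trace by a scalar tending to zero, multiplied by
    -- an expectation that converges.
    have t3 := t1.sub ((hy k List.mem_cons_self).mul t2)
    rw [zero_mul, sub_zero, List.append_assoc, List.singleton_append, ← List.map_cons] at t3
    refine t3.congr fun N => ?_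
    simp only [List.map_append, List.prod_append, List.map_cons, List.map_nil, List.prod_cons,
      List.prod_nil, Module.End.mul_apply, mul_one, normalQ, LinearMap.add_apply, map_add,
      Module.algebraMap_end_apply, map_smul, smul_eq_mul]
    ring

/-! ### Evaluation of the limiting functional -/

/-- The sum of `Φ x M` over all ways to extract an element `x` from a list, with remainder `M`. -/
def extractSum {E R : Type*} [AddCommMonoid R] : List E → (E → List E → R) → R
  | [], _ => 0
  | x :: L, Φ => Φ x L + extractSum L fun y M => Φ y (x :: M)

theorem sum_eraseIdx_eq {E R : Type*} [AddCommMonoid R] (L : List E) (Φ : E → List E → R) :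
    ∑ a : Fin L.length, Φ L[a] (L.eraseIdx a) = extractSum L Φ := by
  induction L generalizing Φ with
  | nil => simp [extractSum]
  | cons x L ih =>
    simp only [List.length_cons, Fin.sum_univ_succ, extractSum, ← ih]
    rfl

theorem extractSum_congr {E R : Type*} [AddCommMonoid R] (L : List E) {Φ Ψ : E → List E → R}
    (h : ∀ y M, M.length + 1 = L.length → Φ y M = Ψ y M) : extractSum L Φ = extractSum L Ψ := by
  induction L generalizing Φ Ψ with
  | nil => rfl
  | cons x L ih =>
    rw [extractSum, extractSum, h x L rfl, ih fun y M hM => h y (x :: M) (by simp [hM])]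

theorem extractSum_add {E R : Type*} [AddCommMonoid R] (L : List E) (Φ Ψ : E → List E → R) :
    extractSum L (fun y M => Φ y M + Ψ y M) = extractSum L Φ + extractSum L Ψ := by
  simp [← sum_eraseIdx_eq, Finset.sum_add_distrib]

theorem extractSum_mul_left {E R : Type*} [Semiring R] (L : List E) (c : R) (Φ : E → List E → R) :
    extractSum L (fun y M => c * Φ y M) = c * extractSum L Φ := by
  simp [← sum_eraseIdx_eq, Finset.mul_sum]

theorem extractSum_sum {E R ι : Type*} [AddCommMonoid R] (L : List E) (s : Finset ι)
    (Φ : ι → E → List E → R) :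
    extractSum L (fun y M => ∑ i ∈ s, Φ i y M) = ∑ i ∈ s, extractSum L (Φ i) := by
  simp only [← sum_eraseIdx_eq]
  exact Finset.sum_comm

theorem extractSum_map {E E' R : Type*} [AddCommMonoid R] (f : E → E') (L : List E)
    (Φ : E' → List E' → R) :
    extractSum (L.map f) Φ = extractSum L fun y M => Φ (f y) (M.map f) := by
  induction L generalizing Φ with
  | nil => rfl
  | cons x L ih => simp [extractSum, ih]

theorem extractSum_swap {E R : Type*} [AddCommMonoid R] (L : List E) (F : E → E → List E → R) :
    extractSum L (fun x M => extractSum M (F x)) =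
      extractSum L fun x M => extractSum M fun y K => F y x K := by
  induction L generalizing F with
  | nil => rfl
  | cons x L ih =>
    simp only [extractSum, extractSum_add]
    rw [ih fun y z K => F y z (x :: K)]
    exact add_left_comm _ _ _

/-- The Wick recursion: the moments of a centered Gaussian family with covariance `S`. -/
def wickRec {E R : Type*} [Semiring R] (S : E → E → R) : List E → R
  | [] => 1
  | x :: L => ∑ a : Fin L.length, S x L[a] * wickRec S (L.eraseIdx a)
termination_by L => L.length
decreasing_by
  have := List.length_eraseIdx_le L a
  simp only [List.length_cons]
  omega

theorem wickRec_nil {E R : Type*} [Semiring R] (S : E → E → R) : wickRec S [] = 1 := by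
  rw [wickRec]

theorem wickRec_cons {E R : Type*} [Semiring R] (S : E → E → R) (x : E) (L : List E) :
    wickRec S (x :: L) = extractSum L fun y M => S x y * wickRec S M := by
  rw [wickRec, ← sum_eraseIdx_eq]

theorem gwick_cons' (f : LaurentPolynomial ℂ) (L : List (LaurentPolynomial ℂ))
    (g : MvPolynomial ℕ ℂ) : gwick (f :: L) g =
      (extractSum L fun y M => pairing f y * gwick M g) + gwick L (pairingDeriv f g) := by
  rw [gwick_cons, ← sum_eraseIdx_eq]

/-- A creation operator in the test polynomial is contracted with every operator of the list,
wherever it stands. The recursion extracts the first symbol before the contracted one;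
`extractSum_swap` interchanges the two extractions. -/
theorem gwick_X_mul (L : List (LaurentPolynomial ℂ)) (j : ℕ) (g : MvPolynomial ℕ ℂ) :
    gwick L (MvPolynomial.X j * g) =
      extractSum L fun y M => pairing y (LaurentPolynomial.T ((j : ℤ) + 1)) * gwick M g := by
  induction hn : L.length using Nat.strong_induction_on generalizing L g with
  | _ n ih =>
  rcases L with - | ⟨f, L⟩
  · simp [gwick_nil, extractSum, MvPolynomial.coeff_X_mul']
  simp only [List.length_cons] at hn
  rw [gwick_cons', extractSum_congr L fun y M hM => by rw [ih M.length (by omega) M g rfl],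
    Derivation.leibniz, pairingDeriv_X, smul_eq_mul, smul_eq_mul, map_add,
    ih L.length (by omega) L _ rfl, mul_comm g, MvPolynomial.C_mul', map_smul, extractSum,
    smul_eq_mul]
  simp only [gwick_cons', mul_add, extractSum_add, ← extractSum_mul_left]
  rw [extractSum_swap L fun x y M =>
    pairing f x * (pairing y (LaurentPolynomial.T ((j : ℤ) + 1)) * gwick M g)]
  simp only [mul_left_comm (pairing f _)]
  ring

/-- The truncated exponential. -/
def truncExp {A : Type*} [Semiring A] [Algebra ℂ A] (d : ℕ) (w : A) : A :=
  ∑ n ∈ Finset.range (d + 1), ((n ! : ℂ)⁻¹) • w ^ n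

theorem map_truncExp {A B : Type*} [Semiring A] [Algebra ℂ A] [Semiring B] [Algebra ℂ B]
    (Φ : A →ₐ[ℂ] B) (d : ℕ) (w : A) : Φ (truncExp d w) = truncExp d (Φ w) := by
  simp [truncExp]

theorem derivation_truncExp {A : Type*} [CommRing A] [Algebra ℂ A] (D : Derivation ℂ A A)
    (d : ℕ) (w : A) : D (truncExp (d + 1) w) = truncExp d w * D w := by
  unfold truncExp
  rw [Finset.sum_range_succ', map_add, map_sum, Finset.sum_mul]
  simp only [pow_zero, Derivation.map_smul, Derivation.map_one_eq_zero, smul_zero, add_zero]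
  refine Finset.sum_congr rfl fun n _ => ?_
  rw [Derivation.leibniz_pow, Nat.add_sub_cancel, smul_eq_mul, ← Nat.cast_smul_eq_nsmul ℂ,
    smul_smul, smul_mul_assoc]
  congr 1
  rw [Nat.factorial_succ]
  have : ((n : ℂ) + 1) ≠ 0 := by exact_mod_cast Nat.succ_ne_zero n
  have : (n ! : ℂ) ≠ 0 := by exact_mod_cast Nat.factorial_ne_zero n
  push_cast
  field_simp

/-- The quadratic form `1/2 ∑ β_{ij} X_i X_j`. -/
def quadForm (m : ℕ) (β : ℕ → ℕ → ℂ) : MvPolynomial ℕ ℂ :=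
  ∑ i ∈ Finset.range m, ∑ j ∈ Finset.range m,
    MvPolynomial.C (β i j / 2) * (MvPolynomial.X i * MvPolynomial.X j)

theorem derivation_quadForm (m : ℕ) {β : ℕ → ℕ → ℂ} (hβ : ∀ i j, β i j = β j i)
    (f : LaurentPolynomial ℂ) : pairingDeriv f (quadForm m β) =
      ∑ i ∈ Finset.range m, ∑ j ∈ Finset.range m,
        (β i j * pairing f (LaurentPolynomial.T ((i : ℤ) + 1))) •
          (MvPolynomial.X j : MvPolynomial ℕ ℂ) := by
  unfold quadForm
  have h1 : ∀ i j : ℕ, pairingDeriv f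
      (MvPolynomial.C (β i j / 2) * (MvPolynomial.X i * MvPolynomial.X j)) =
      (β i j / 2 * pairing f (LaurentPolynomial.T ((i : ℤ) + 1))) • MvPolynomial.X j +
      (β j i / 2 * pairing f (LaurentPolynomial.T ((j : ℤ) + 1))) • MvPolynomial.X i := by
    intro i j
    rw [← MvPolynomial.algebraMap_eq, ← Algebra.smul_def, Derivation.map_smul, Derivation.leibniz,
      pairingDeriv_X, pairingDeriv_X, hβ j i, smul_eq_mul, smul_eq_mul, mul_comm _ (MvPolynomial.C _),
      mul_comm _ (MvPolynomial.C _), MvPolynomial.C_mul', MvPolynomial.C_mul', smul_add, smul_smul,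
      smul_smul, add_comm]
  simp only [map_sum, h1, Finset.sum_add_distrib]
  rw [Finset.sum_comm (f := fun i j => (β j i / 2 * pairing f (LaurentPolynomial.T ((j : ℤ) + 1))) •
    (MvPolynomial.X i : MvPolynomial ℕ ℂ)), ← Finset.sum_add_distrib]
  refine Finset.sum_congr rfl fun i _ => ?_
  rw [← Finset.sum_add_distrib]
  refine Finset.sum_congr rfl fun j _ => ?_
  rw [← add_smul]
  congr 1
  ring

/-- The limiting covariance form. -/
def covForm (m : ℕ) (β : ℕ → ℕ → ℂ) (f g : LaurentPolynomial ℂ) : ℂ :=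
  pairing f g + ∑ i ∈ Finset.range m, ∑ j ∈ Finset.range m,
    β i j * pairing f (LaurentPolynomial.T ((i : ℤ) + 1)) *
      pairing g (LaurentPolynomial.T ((j : ℤ) + 1))

/-- The first symbol either pairs with another symbol or differentiates exp(w), giving exp(w) times
a linear form in the X_j, and each X_j is then contracted with another symbol. Both outcomes remove
a pair from the list, so together they are one Gaussian contraction with covariance `covForm`. -/
theorem gwick_truncExp (m : ℕ) {β : ℕ → ℕ → ℂ} (hβ : ∀ i j, β i j = β j i)
    (L : List (LaurentPolynomial ℂ)) (d : ℕ) (hd : L.length ≤ d) :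
    gwick L (truncExp d (quadForm m β)) = wickRec (covForm m β) L := by
  induction hn : L.length using Nat.strong_induction_on generalizing L d with
  | _ n ih =>
  rcases L with - | ⟨f, L⟩
  · rw [gwick_nil, wickRec_nil, truncExp, Finset.sum_range_succ', MvPolynomial.coeff_add,
      MvPolynomial.coeff_sum, Finset.sum_eq_zero]
    · simp
    · intro k _
      have h0 : MvPolynomial.constantCoeff (quadForm m β) = 0 := by
        simp [quadForm]
      have : MvPolynomial.constantCoeff (quadForm m β ^ (k + 1)) = 0 := by
        rw [map_pow, h0, zero_pow (Nat.succ_ne_zero k)]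
      rw [MvPolynomial.coeff_smul, ← MvPolynomial.constantCoeff_eq, this, smul_zero]
  simp only [List.length_cons] at hn hd
  obtain ⟨d, rfl⟩ : ∃ e, d = e + 1 := ⟨d - 1, by omega⟩
  rw [gwick_cons', wickRec_cons, derivation_truncExp, derivation_quadForm m hβ]
  simp only [Finset.mul_sum, map_sum, mul_smul_comm, map_smul, mul_comm _ (MvPolynomial.X _),
    gwick_X_mul, smul_eq_mul, ← extractSum_mul_left, ← extractSum_sum]
  rw [← extractSum_add]
  refine extractSum_congr L fun y M hM => ?_
  -- Differentiation lowers the truncation degree by one and the contraction removes two symbols, so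
  -- the degree always dominates the length; the two truncations give the same value.
  rw [ih M.length (by omega) M (d + 1) (by omega) rfl, ih M.length (by omega) M d (by omega) rfl,
    covForm, add_mul, Finset.sum_mul]
  congr 1
  refine Finset.sum_congr rfl fun i _ => ?_
  rw [Finset.sum_mul]
  refine Finset.sum_congr rfl fun j _ => ?_
  ring

/-! ### Probability: realization of a covariance by Gaussian variables and Isserlis' recursion. -/

/-! ### Gaussian processes with a given covariance -/

theorem integrable_pow_mul_exp_neg_sq (n : ℕ) :
    Integrable fun x : ℝ => x ^ n * Real.exp (-(1 / 2) * x ^ 2) := by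
  have := integrable_rpow_mul_exp_neg_mul_sq (b := 1 / 2) (by norm_num) (s := n)
    (by have : (0 : ℝ) ≤ n := Nat.cast_nonneg n
        linarith)
  simpa using this

theorem integral_pow_gaussianReal (n : ℕ) : ∫ x, x ^ n ∂gaussianReal 0 1 =
    (√(2 * Real.pi))⁻¹ * ∫ x : ℝ, x ^ n * Real.exp (-(1 / 2) * x ^ 2) := by
  rw [integral_gaussianReal_eq_integral_smul one_ne_zero, ← integral_const_mul]
  refine integral_congr_ae (ae_of_all _ fun x => ?_)
  simp only [gaussianPDFReal, NNReal.coe_one, mul_one, sub_zero, smul_eq_mul]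
  rw [show -x ^ 2 / 2 = -(1 / 2) * x ^ 2 by ring]
  ring

/-- Integration by parts, since -x exp(-x²/2) is the derivative of exp(-x²/2). For n = 0 the value
of the truncated exponent n - 1 is irrelevant because of the factor n. -/
theorem integral_pow_succ_gaussianReal (n : ℕ) :
    ∫ x, x ^ (n + 1) ∂gaussianReal 0 1 = n * ∫ x, x ^ (n - 1) ∂gaussianReal 0 1 := by
  rw [integral_pow_gaussianReal, integral_pow_gaussianReal, mul_left_comm]
  congr 1
  have h := integral_mul_deriv_eq_deriv_mul_of_integrable (A := ℝ) (u := fun x => x ^ n)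
    (v := fun x => Real.exp (-(1 / 2) * x ^ 2)) (u' := fun x => n * x ^ (n - 1))
    (v' := fun x => Real.exp (-(1 / 2) * x ^ 2) * (-x))
    (fun x _ => hasDerivAt_pow n x)
    (fun x _ => by
      refine HasDerivAt.exp ?_
      have := (hasDerivAt_pow 2 x).const_mul (-(1 / 2) : ℝ)
      rwa [show -(1 / 2 : ℝ) * (((2 : ℕ) : ℝ) * x ^ (2 - 1)) = -x by push_cast; ring] at this)
    (by
      refine (integrable_pow_mul_exp_neg_sq (n + 1)).neg.congr (ae_of_all _ fun x => ?_)
      simp only [Pi.mul_apply, Pi.neg_apply]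
      ring)
    (by
      refine ((integrable_pow_mul_exp_neg_sq (n - 1)).const_mul n).congr (ae_of_all _ fun x => ?_)
      simp only [Pi.mul_apply]
      ring)
    (integrable_pow_mul_exp_neg_sq n)
  rw [← neg_inj, ← integral_const_mul, ← integral_neg]
  simp only [← mul_assoc]
  rw [← h]
  refine integral_congr_ae (ae_of_all _ fun x => ?_)
  ring_nf

/-- The law of a family of independent standard normal variables. -/
abbrev stdNormal (ι : Type*) : Measure (ι → ℝ) := Measure.infinitePi fun _ => gaussianReal 0 1

/-- All exponents q are treated at once: multiplication by a variable uses Hölder's inequality with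
two factors in L^(2q). -/
theorem memLp_eval_stdNormal {ι : Type*} (p : MvPolynomial ι ℝ) (q : NNReal) :
    MemLp (fun ω => MvPolynomial.eval ω p) q (stdNormal ι) := by
  induction p using MvPolynomial.induction_on generalizing q with
  | C a => simpa using memLp_const a
  | add p p' h h' =>
    refine MemLp.ae_eq (ae_of_all _ fun ω => ?_) ((h q).add (h' q))
    simp
  | mul_X p i h =>
    have h1 : MemLp (fun ω : ι → ℝ => ω i) (2 * q : NNReal) (stdNormal ι) :=
      (memLp_id_gaussianReal (μ := 0) (v := 1) (2 * q)).comp_measurePreserving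
        (measurePreserving_eval_infinitePi _ i)
    have : ENNReal.HolderTriple ((2 * q : NNReal) : ENNReal) ((2 * q : NNReal) : ENNReal) q := by
      constructor
      rw [← two_mul, ENNReal.coe_mul, ENNReal.mul_inv (by simp) (by simp), ← mul_assoc]
      simp [ENNReal.mul_inv_cancel]
    simpa using h1.mul' (h (2 * q))

theorem integrable_eval_stdNormal {ι : Type*} (p : MvPolynomial ι ℝ) :
    Integrable (fun ω => MvPolynomial.eval ω p) (stdNormal ι) := by
  have := memLp_eval_stdNormal p 1
  rwa [ENNReal.coe_one, memLp_one_iff_integrable] at this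

theorem integral_prod_pow_stdNormal {ι : Type*} (s : Finset ι) (κ : ι → ℕ) :
    ∫ ω, ∏ i ∈ s, ω i ^ κ i ∂stdNormal ι = ∏ i ∈ s, ∫ x, x ^ κ i ∂gaussianReal 0 1 := by
  have h0 : iIndepFun (fun i (ω : ι → ℝ) => ω i) (stdNormal ι) :=
    iIndepFun_infinitePi (X := fun _ x => x) fun _ => measurable_id
  have h1 : iIndepFun (fun (i : s) (ω : ι → ℝ) => ω i) (stdNormal ι) :=
    h0.precomp Subtype.val_injective
  have h2 := iIndepFun.integral_fun_prod_comp (ι := s) (X := fun i (ω : ι → ℝ) => ω i) (hX := h1) (f := fun i x => x ^ κ i) (𝕜 := ℝ)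
    (fun i => (measurable_pi_apply _).aemeasurable) (fun i => by fun_prop)
  rw [← Finset.prod_coe_sort s]
  simp only [← Finset.prod_coe_sort s (fun i => _ ^ κ i)]
  rw [h2]
  refine Finset.prod_congr rfl fun i _ => ?_
  exact integral_map_of_stronglyMeasurable (μ := stdNormal ι) (measurable_pi_apply (i : ι))
    (by fun_prop : StronglyMeasurable fun x : ℝ => x ^ κ i) |>.symm.trans (by
      rw [Measure.infinitePi_map_eval])

theorem integral_monomial_stdNormal {ι : Type*} (s : Finset ι) (κ : ι →₀ ℕ) (hs : κ.support ⊆ s) :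
    ∫ ω, MvPolynomial.eval ω (MvPolynomial.monomial κ (1 : ℝ)) ∂stdNormal ι =
      ∏ i ∈ s, ∫ x, x ^ κ i ∂gaussianReal 0 1 := by
  rw [← integral_prod_pow_stdNormal]
  refine integral_congr_ae (ae_of_all _ fun ω => ?_)
  simp only [MvPolynomial.eval_monomial, one_mul]
  exact Finsupp.prod_of_support_subset _ hs _ (by simp)

/-- Gaussian integration by parts. -/
theorem integral_X_mul_stdNormal {ι : Type*} (j : ι) (p : MvPolynomial ι ℝ) :
    ∫ ω, MvPolynomial.eval ω (MvPolynomial.X j * p) ∂stdNormal ι =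
      ∫ ω, MvPolynomial.eval ω (MvPolynomial.pderiv j p) ∂stdNormal ι := by
  classical
  induction p using MvPolynomial.monomial_add_induction_on with
  | C a =>
    have := integral_pow_succ_gaussianReal 0
    have h1 := integral_monomial_stdNormal {j} (Finsupp.single j 1) Finsupp.support_single_subset
    simp only [Nat.cast_zero, zero_mul, zero_add] at this
    rw [Finset.prod_singleton, Finsupp.single_eq_same, this] at h1
    simp only [MvPolynomial.eval_mul, MvPolynomial.eval_C, integral_mul_const,
      MvPolynomial.pderiv_C, map_zero, integral_zero]
    rw [show (MvPolynomial.X j : MvPolynomial ι ℝ) = MvPolynomial.monomial (Finsupp.single j 1) 1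
      from rfl, h1, zero_mul]
  | monomial_add κ b f _ _ h =>
    rw [mul_add, map_add]
    simp only [map_add]
    rw [integral_add (integrable_eval_stdNormal _) (integrable_eval_stdNormal _),
      integral_add (integrable_eval_stdNormal _) (integrable_eval_stdNormal _), h]
    congr 1
    rw [show MvPolynomial.monomial κ b = b • MvPolynomial.monomial κ (1 : ℝ) by
      rw [MvPolynomial.smul_monomial, smul_eq_mul, mul_one], mul_smul_comm, Derivation.map_smul]
    simp only [MvPolynomial.smul_eval, integral_const_mul]
    congr 1
    rw [MvPolynomial.pderiv_monomial, one_mul, MvPolynomial.X, MvPolynomial.monomial_mul, one_mul,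
      show MvPolynomial.monomial (κ - Finsupp.single j 1) (κ j : ℝ) =
        (κ j : ℝ) • MvPolynomial.monomial (κ - Finsupp.single j 1) (1 : ℝ) by
        rw [MvPolynomial.smul_monomial, smul_eq_mul, mul_one]]
    simp only [MvPolynomial.smul_eval, integral_const_mul]
    set s := insert j κ.support with hs
    have hj : j ∈ s := by simp [hs]
    have e1 : ∀ i ∈ s.erase j, (Finsupp.single j 1 + κ : ι →₀ ℕ) i = κ i := fun i hi => by
      simp [(Finset.ne_of_mem_erase hi)]
    have e2 : ∀ i ∈ s.erase j, (κ - Finsupp.single j 1 : ι →₀ ℕ) i = κ i := fun i hi => by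
      simp [(Finset.ne_of_mem_erase hi)]
    rw [integral_monomial_stdNormal s (Finsupp.single j 1 + κ), integral_monomial_stdNormal s
      (κ - Finsupp.single j 1), ← Finset.mul_prod_erase _ _ hj, ← Finset.mul_prod_erase _ _ hj,
      ← mul_assoc]
    · congr 1
      · simp only [Finsupp.add_apply, Finsupp.single_eq_same, Finsupp.tsub_apply]
        rw [add_comm 1]
        exact integral_pow_succ_gaussianReal _
      · exact Finset.prod_congr rfl fun i hi => by rw [e1 i hi, e2 i hi]
    · intro i hi
      by_contra h'
      simp only [hs, Finset.mem_insert, Finsupp.mem_support_iff, not_or, not_not] at h'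
      simp [h'.2] at hi
    · intro i hi
      by_contra h'
      simp only [hs, Finset.mem_insert, Finsupp.mem_support_iff, not_or, not_not] at h'
      simp [h'.2, Ne.symm h'.1] at hi

/-- The linear form with coefficients `a`. -/
def linForm {ι : Type*} (a : ι →₀ ℝ) : MvPolynomial ι ℝ :=
  a.sum fun i c => c • MvPolynomial.X i

/-- The derivation dual to a linear form. -/
def formDeriv {ι : Type*} (a : ι →₀ ℝ) : Derivation ℝ (MvPolynomial ι ℝ) (MvPolynomial ι ℝ) :=
  a.sum fun i c => c • MvPolynomial.pderiv i

theorem integral_linForm_mul {ι : Type*} (a : ι →₀ ℝ) (p : MvPolynomial ι ℝ) :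
    ∫ ω, MvPolynomial.eval ω (linForm a * p) ∂stdNormal ι =
      ∫ ω, MvPolynomial.eval ω (formDeriv a p) ∂stdNormal ι := by
  have h1 : formDeriv a p = a.sum fun i c => c • MvPolynomial.pderiv i p := by
    simp only [formDeriv, Finsupp.sum]
    rw [← Derivation.coeFnAddMonoidHom_apply, map_sum, Finset.sum_apply]
    rfl
  rw [h1, linForm, Finsupp.sum, Finsupp.sum, Finset.sum_mul]
  simp only [map_sum, smul_mul_assoc, MvPolynomial.smul_eval]
  rw [integral_finsetSum _ fun i _ => (integrable_eval_stdNormal _).const_mul _,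
    integral_finsetSum _ fun i _ => (integrable_eval_stdNormal _).const_mul _]
  simp only [integral_const_mul, integral_X_mul_stdNormal]

theorem formDeriv_linForm {ι : Type*} (a b : ι →₀ ℝ) :
    formDeriv a (linForm b) = MvPolynomial.C (a.sum fun i c => c * b i) := by
  classical
  simp only [formDeriv, linForm, Finsupp.sum]
  rw [← Derivation.coeFnAddMonoidHom_apply, map_sum, Finset.sum_apply, map_sum]
  refine Finset.sum_congr rfl fun i _ => ?_
  change (a i • MvPolynomial.pderiv i) _ = _
  rw [Derivation.smul_apply, map_sum]
  simp only [Derivation.map_smul, MvPolynomial.pderiv_X, Pi.single_apply]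
  rw [Finset.sum_eq_single i]
  · simp [MvPolynomial.smul_eq_C_mul]
  · intro j _ hj
    simp [hj]
  · intro hi
    simp [Finsupp.notMem_support_iff.1 hi]

theorem derivation_list_prod {A E : Type*} [CommRing A] [Algebra ℝ A] (D : Derivation ℝ A A)
    (f : E → A) (L : List E) :
    D (L.map f).prod = extractSum L fun y M => D (f y) * (M.map f).prod := by
  induction L with
  | nil => simp [extractSum]
  | cons x L ih =>
    simp only [List.map_cons, List.prod_cons, extractSum, Derivation.leibniz, ih, smul_eq_mul,
      ← extractSum_mul_left]
    rw [add_comm, mul_comm (List.prod _)]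
    congr 2
    funext y M
    ring

/-- Isserlis' theorem: integration by parts converts the first linear form into a derivation of the
remaining product, and this derivation maps linear forms to their covariances. -/
theorem integral_prod_linForm {ι E : Type*} (a : E → ι →₀ ℝ) (L : List E) :
    ∫ ω, (L.map fun x => MvPolynomial.eval ω (linForm (a x))).prod ∂stdNormal ι =
      wickRec (fun x y => (a x).sum fun i c => c * a y i) L := by
  induction hn : L.length using Nat.strong_induction_on generalizing L with
  | _ n ih =>
  rcases L with - | ⟨x, L⟩
  · simp [wickRec_nil]
  simp only [List.length_cons] at hn
  have h1 : ∀ ω (M : List E), (M.map fun x => MvPolynomial.eval ω (linForm (a x))).prod =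
      MvPolynomial.eval ω (M.map fun x => linForm (a x)).prod := fun ω M => by
    rw [map_list_prod, List.map_map]; rfl
  simp only [h1] at ih ⊢
  rw [List.map_cons, List.prod_cons, integral_linForm_mul, derivation_list_prod, wickRec_cons]
  simp only [formDeriv_linForm, ← sum_eraseIdx_eq, map_sum, map_mul, MvPolynomial.eval_C]
  rw [integral_finsetSum _ fun i _ => (integrable_eval_stdNormal _).const_mul _]
  refine Finset.sum_congr rfl fun b _ => ?_
  rw [integral_const_mul, ih _ (by have := List.length_eraseIdx_le L b; omega) _ rfl]

/-- A positive semidefinite kernel is a Gram matrix. -/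
theorem exists_gram {T : Type} (S : T → T → ℝ) (hS : ∀ i j, S i j = S j i)
    (hpos : ∀ f : T →₀ ℝ, 0 ≤ f.sum fun i a => f.sum fun j b => a * b * S i j) :
    ∃ (E : Type) (_ : NormedAddCommGroup E) (_ : InnerProductSpace ℝ E) (v : T → E),
      ∀ i j, inner ℝ (v i) (v j) = S i j := by
  -- The scalar kernel is viewed as operator-valued on ℝ; in its reproducing kernel Hilbert space
  -- the kernel functions at the points i have Gram matrix S.
  let K : Matrix T T (ℝ →L[ℝ] ℝ) := fun i j => S i j • ContinuousLinearMap.id ℝ ℝ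
  have hK : K.PosSemidef := by
    have htfae : K.PosSemidef ↔ K.IsHermitian ∧ ∀ vv : T →₀ ℝ, 0 ≤ RCLike.re
        (vv.sum fun x w => vv.sum fun x' w' => inner ℝ (K x' x w) w') :=
      (RKHS.posSemidef_tfae (K := K)).out 0 2
    refine htfae.mpr ⟨?_, fun f => ?_⟩
    · ext i j
      rw [Matrix.conjTranspose_apply, ContinuousLinearMap.star_eq_adjoint]
      simp only [K, map_smulₛₗ, hS i j, ContinuousLinearMap.adjoint_id]
      simp
    · refine (hpos f).trans_eq ?_
      simp only [RCLike.re_to_real]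
      refine Finsupp.sum_congr fun i _ => Finsupp.sum_congr fun j _ => ?_
      simp [K, hS i j]
      ring
  have : Fact K.PosSemidef := ⟨hK⟩
  refine ⟨RKHS.OfKernel K, inferInstance, inferInstance,
    fun i => RKHS.kerFun (RKHS.OfKernel K) i (1 : ℝ), fun i j => ?_⟩
  rw [← RKHS.kernel_inner, RKHS.OfKernel.kernel_ofKernel]
  simp [K, hS i j]

/-- Cholesky decomposition of a positive semidefinite kernel indexed by `ℕ+`. -/
theorem exists_cholesky (S : ℕ+ → ℕ+ → ℝ) (hS : ∀ i j, S i j = S j i)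
    (hpos : ∀ f : ℕ+ →₀ ℝ, 0 ≤ f.sum fun i a => f.sum fun j b => a * b * S i j) :
    ∃ a : ℕ+ → ℕ+ →₀ ℝ, ∀ i j, ((a i).sum fun k c => c * a j k) = S i j := by
  obtain ⟨E, _, _, v, hv⟩ := exists_gram S hS hpos
  set e := InnerProductSpace.gramSchmidtNormed ℝ v with he
  have horth : ∀ i j, i ≠ j → inner ℝ (e i) (e j) = 0 := fun i j hij => by
    simp [he, InnerProductSpace.gramSchmidtNormed, inner_smul_left, inner_smul_right,
      InnerProductSpace.gramSchmidt_orthogonal ℝ v hij]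
  -- The vectors v need not be independent, so some e i may be zero; this form covers both the zero
  -- and the unit case.
  have hproj : ∀ i, inner ℝ (e i) (e i) • e i = e i := fun i => by
    by_cases h : e i = 0
    · simp [h]
    · rw [real_inner_self_eq_norm_sq, InnerProductSpace.gramSchmidtNormed_unit_length' h]
      simp
  have hmem : ∀ k, v k ∈ Submodule.span ℝ (e '' Set.Iic k) := fun k => by
    rw [he, InnerProductSpace.span_gramSchmidtNormed, InnerProductSpace.span_gramSchmidt_Iic]
    exact Submodule.subset_span ⟨k, Set.mem_Iic.2 le_rfl, rfl⟩
  have hexp : ∀ k, v k = ∑ i ∈ Finset.Iic k, inner ℝ (e i) (v k) • e i := fun k => by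
    have : ∀ x ∈ Submodule.span ℝ (e '' Set.Iic k),
        x = ∑ i ∈ Finset.Iic k, inner ℝ (e i) x • e i := fun x hx => by
      induction hx using Submodule.span_induction with
      | mem x hx =>
        obtain ⟨j, hj, rfl⟩ := hx
        rw [Finset.sum_eq_single j, hproj]
        · intro i _ hij
          rw [horth i j hij, zero_smul]
        · intro h
          exact absurd (Finset.mem_Iic.2 hj) h
      | zero => simp
      | add x y _ _ hx hy =>
        simp only [inner_add_right, add_smul, Finset.sum_add_distrib, ← hx, ← hy]
      | smul c x _ hx =>
        simp only [inner_smul_right, mul_smul, ← Finset.smul_sum, ← hx]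
    exact this _ (hmem k)
  refine ⟨fun k => Finsupp.onFinset (Finset.Iic k)
    (fun i => if i ∈ Finset.Iic k then inner ℝ (e i) (v k) else 0) (by simp; tauto), fun k l => ?_⟩
  rw [Finsupp.onFinset_sum _ (by simp), ← hv k l]
  conv_rhs => rw [hexp k, sum_inner]
  refine Finset.sum_congr rfl fun i hi => ?_
  rw [if_pos hi, inner_smul_left, Finsupp.onFinset_apply]
  congr 1
  split_ifs with h
  · rfl
  -- The remaining case is an index i beyond l: there v l has no component along e i, in accordance
  -- with the cut-off coefficient.
  · rw [hexp l, inner_sum, Finset.sum_eq_zero]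
    intro j hj
    rw [inner_smul_right, horth i j (fun hij => h (hij ▸ hj)), mul_zero]

theorem eval_linForm {ι : Type*} (a : ι →₀ ℝ) (ω : ι → ℝ) :
    MvPolynomial.eval ω (linForm a) = ∑ i ∈ a.support, a i * ω i := by
  simp [linForm, Finsupp.sum, map_sum, MvPolynomial.smul_eval]

theorem isGaussianProcess_eval_stdNormal (ι : Type*) :
    IsGaussianProcess (fun (i : ι) (ω : ι → ℝ) => ω i) (stdNormal ι) where
  hasGaussianLaw I := by
    have h0 : iIndepFun (fun i (ω : ι → ℝ) => ω i) (stdNormal ι) :=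
      iIndepFun_infinitePi (X := fun _ x => x) fun _ => measurable_id
    have h1 : iIndepFun (fun (i : I) (ω : ι → ℝ) => ω i) (stdNormal ι) :=
      h0.precomp Subtype.val_injective
    refine h1.hasGaussianLaw fun i => ⟨?_⟩
    change IsGaussian (Measure.map (fun ω : ι → ℝ => ω i) (stdNormal ι))
    rw [Measure.infinitePi_map_eval]
    infer_instance

/-- Existence of a centered Gaussian process with given covariance, and its joint moments. -/
theorem exists_gaussian (S : ℕ+ → ℕ+ → ℝ) (hS : ∀ i j, S i j = S j i)
    (hpos : ∀ f : ℕ+ →₀ ℝ, 0 ≤ f.sum fun i a => f.sum fun j b => a * b * S i j) :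
    ∃ (Ω : Type) (_ : MeasurableSpace Ω) (P : Measure Ω) (ξ : ℕ+ → Ω → ℝ),
      IsGaussianProcess ξ P ∧ (∀ k, ∫ ω, ξ k ω ∂P = 0) ∧ (∀ k l, cov[ξ k, ξ l; P] = S k l) ∧
      ∀ L : List ℕ+, ∫ ω, (L.map fun k => ξ k ω).prod ∂P = wickRec S L := by
  obtain ⟨a, ha⟩ := exists_cholesky S hS hpos
  have hwick : ∀ L : List ℕ+, ∫ ω, (L.map fun k => MvPolynomial.eval ω (linForm (a k))).prod
      ∂stdNormal ℕ+ = wickRec S L := fun L => by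
    rw [integral_prod_linForm]
    simp only [ha]
  have hmean : ∀ k, ∫ ω, MvPolynomial.eval ω (linForm (a k)) ∂stdNormal ℕ+ = 0 := fun k => by
    have := hwick [k]
    simpa [wickRec_cons, extractSum] using this
  refine ⟨ℕ+ → ℝ, inferInstance, stdNormal ℕ+, fun k ω => MvPolynomial.eval ω (linForm (a k)),
    ?_, hmean, fun k l => ?_, hwick⟩
  · classical
    refine ⟨fun I => ?_⟩
    set J := I.biUnion fun k => (a k).support with hJ
    -- Finitely many linear forms involve finitely many coordinates J, so their joint law is a
    -- linear image of a finite-dimensional Gaussian law.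
    let K : (J → ℝ) →L[ℝ] (I → ℝ) := ContinuousLinearMap.pi fun k =>
      ∑ i : J, a k i • (ContinuousLinearMap.proj i : (J → ℝ) →L[ℝ] ℝ)
    have hK : (fun ω : ℕ+ → ℝ => I.restrict fun k => MvPolynomial.eval ω (linForm (a k))) =
        K ∘ fun ω : ℕ+ → ℝ => J.restrict ω := by
      funext ω k
      have hsub : (a k).support ⊆ J := Finset.subset_biUnion_of_mem (fun k => (a k).support) k.2
      simp only [Finset.restrict, Function.comp_apply, K, ContinuousLinearMap.pi_apply,
        sum_apply, smul_apply,
        ContinuousLinearMap.proj_apply, smul_eq_mul]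
      rw [eval_linForm, Finset.sum_coe_sort J fun i => a k i * ω i]
      exact Finset.sum_subset hsub fun i _ hi => by
        rw [Finsupp.notMem_support_iff.1 hi, zero_mul]
    rw [hK]
    exact ((isGaussianProcess_eval_stdNormal ℕ+).hasGaussianLaw J).map K
  · have h2 : ∀ k, MemLp (fun ω => MvPolynomial.eval ω (linForm (a k))) 2 (stdNormal ℕ+) :=
      fun k => by simpa using memLp_eval_stdNormal (linForm (a k)) 2
    rw [covariance_eq_sub (h2 k) (h2 l), hmean, zero_mul, sub_zero]
    have := hwick [k, l]
    simpa [wickRec_cons, wickRec_nil, extractSum] using this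

/-! ### Analysis at the point 1^N: orders of vanishing and differentiation of series. -/

/-! ### Smooth functions near the point `(1, …, 1)` and their order of vanishing -/

/-- The coordinate vector used in `partialD`. -/
def unitVec (N i : ℕ) : Fin N → ℂ := fun j => if (j : ℕ) = i then 1 else 0

/-- Complex smoothness at `(1, …, 1)`. -/
abbrev SmoothAtOne {N : ℕ} (f : (Fin N → ℂ) → ℂ) : Prop := ContDiffAt ℂ ((⊤ : ℕ∞) : WithTop ℕ∞) f 1

theorem partialD_eq_fderiv {N : ℕ} {f : (Fin N → ℂ) → ℂ} {x : Fin N → ℂ}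
    (h : DifferentiableAt ℂ f x) (i : ℕ) : partialD i f x = fderiv ℂ f x (unitVec N i) :=
  h.lineDeriv_eq_fderiv

theorem partialD_congr {N : ℕ} {f g : (Fin N → ℂ) → ℂ} {x : Fin N → ℂ} (h : f =ᶠ[𝓝 x] g) (i : ℕ) :
    partialD i f =ᶠ[𝓝 x] partialD i g := by
  filter_upwards [h.eventually_nhds] with y hy
  exact Filter.EventuallyEq.lineDeriv_eq hy

theorem SmoothAtOne.eventually {N : ℕ} {f : (Fin N → ℂ) → ℂ} (h : SmoothAtOne f) :
    ∀ᶠ x in 𝓝 1, DifferentiableAt ℂ f x := by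
  have h1 : ContDiffAt ℂ (1 : ℕ) f 1 := h.of_le (by exact_mod_cast le_top)
  filter_upwards [h1.eventually (by simp)] with x hx
  exact hx.differentiableAt (by simp)

theorem SmoothAtOne.partialD {N : ℕ} {f : (Fin N → ℂ) → ℂ} (h : SmoothAtOne f) (i : ℕ) :
    SmoothAtOne (partialD i f) := by
  have h1 : ContDiffAt ℂ ((⊤ : ℕ∞) : WithTop ℕ∞) (fun x => fderiv ℂ f x (unitVec N i)) 1 :=
    (h.fderiv_right (m := ((⊤ : ℕ∞) : WithTop ℕ∞)) (by simp)).clm_apply contDiffAt_const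
  refine h1.congr_of_eventuallyEq ?_
  filter_upwards [h.eventually] with x hx
  exact partialD_eq_fderiv hx i

theorem partialD_add {N : ℕ} {f g : (Fin N → ℂ) → ℂ} (hf : SmoothAtOne f) (hg : SmoothAtOne g)
    (i : ℕ) : partialD i (f + g) =ᶠ[𝓝 1] partialD i f + partialD i g := by
  filter_upwards [hf.eventually, hg.eventually] with x hx hy
  rw [Pi.add_apply, partialD_eq_fderiv (hx.add hy), partialD_eq_fderiv hx, partialD_eq_fderiv hy,
    fderiv_add hx hy]
  rfl

theorem partialD_mul {N : ℕ} {f g : (Fin N → ℂ) → ℂ} (hf : SmoothAtOne f) (hg : SmoothAtOne g)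
    (i : ℕ) : partialD i (f * g) =ᶠ[𝓝 1] partialD i f * g + f * partialD i g := by
  filter_upwards [hf.eventually, hg.eventually] with x hx hy
  rw [Pi.add_apply, Pi.mul_apply, Pi.mul_apply, partialD_eq_fderiv (hx.mul hy),
    partialD_eq_fderiv hx, partialD_eq_fderiv hy, fderiv_mul hx hy]
  simp
  ring

theorem partialD_const {N : ℕ} (c : ℂ) (i : ℕ) :
    partialD (N := N) i (fun _ => c) = fun _ => 0 := by
  funext x
  simp [partialD, lineDeriv]

theorem partialD_const_smul {N : ℕ} (c : ℂ) (f : (Fin N → ℂ) → ℂ) (i : ℕ) :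
    partialD i (c • f) = c • partialD i f := by
  funext x
  simp only [partialD, lineDeriv, Pi.smul_apply, smul_eq_mul]
  exact deriv_const_mul_field c

theorem partialD_exp {N : ℕ} {f : (Fin N → ℂ) → ℂ} (hf : SmoothAtOne f) (i : ℕ) :
    partialD i (fun x => Complex.exp (f x)) =ᶠ[𝓝 1] (fun x => Complex.exp (f x)) * partialD i f := by
  filter_upwards [hf.eventually] with x hx
  rw [Pi.mul_apply, partialD_eq_fderiv hx.cexp, partialD_eq_fderiv hx,
    hx.hasFDerivAt.cexp.fderiv]
  simp

/-- Functions vanishing to order `m` at `(1, …, 1)`. -/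
def VanishOrder {N : ℕ} : ℕ → ((Fin N → ℂ) → ℂ) → Prop
  | 0, f => SmoothAtOne f
  | m + 1, f => SmoothAtOne f ∧ f 1 = 0 ∧ ∀ i : Fin N, VanishOrder m (partialD i f)

namespace VanishOrder

variable {N : ℕ} {f g : (Fin N → ℂ) → ℂ} {m n : ℕ}

theorem smooth (h : VanishOrder m f) : SmoothAtOne f := by
  cases m with
  | zero => exact h
  | succ m => exact h.1

theorem congr (h : VanishOrder m f) (hfg : f =ᶠ[𝓝 1] g) : VanishOrder m g := by
  induction m generalizing f g with
  | zero => exact ContDiffAt.congr_of_eventuallyEq h hfg.symm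
  | succ m ih =>
    exact ⟨ContDiffAt.congr_of_eventuallyEq h.1 hfg.symm, hfg.self_of_nhds ▸ h.2.1,
      fun i => ih (h.2.2 i) (partialD_congr hfg i)⟩

theorem of_succ (h : VanishOrder (m + 1) f) : VanishOrder m f := by
  induction m generalizing f with
  | zero => exact h.1
  | succ m ih => exact ⟨h.1, h.2.1, fun i => ih (h.2.2 i)⟩

theorem mono (h : VanishOrder n f) (hmn : m ≤ n) : VanishOrder m f := by
  induction hmn with
  | refl => exact h
  | step _ ih => exact ih h.of_succ

theorem zero (m : ℕ) : VanishOrder (N := N) m 0 := by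
  induction m with
  | zero => exact contDiffAt_const
  | succ m ih => exact ⟨contDiffAt_const, rfl, fun i => by
      rw [show (0 : (Fin N → ℂ) → ℂ) = fun _ => 0 from rfl, partialD_const]; exact ih⟩

theorem add (hf : VanishOrder m f) (hg : VanishOrder m g) : VanishOrder m (f + g) := by
  induction m generalizing f g with
  | zero => exact ContDiffAt.add hf hg
  | succ m ih =>
    exact ⟨ContDiffAt.add hf.1 hg.1, by simp [hf.2.1, hg.2.1], fun i =>
      (ih (hf.2.2 i) (hg.2.2 i)).congr (partialD_add hf.1 hg.1 i).symm⟩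

theorem const_smul (c : ℂ) (hf : VanishOrder m f) : VanishOrder m (c • f) := by
  induction m generalizing f with
  | zero => exact ContDiffAt.const_smul c hf
  | succ m ih =>
    exact ⟨ContDiffAt.const_smul c hf.1, by simp [hf.2.1], fun i => by
      rw [partialD_const_smul]; exact ih (hf.2.2 i)⟩

theorem neg (hf : VanishOrder m f) : VanishOrder m (-f) := by
  simpa using hf.const_smul (-1)

theorem sub (hf : VanishOrder m f) (hg : VanishOrder m g) : VanishOrder m (f - g) := by
  rw [sub_eq_add_neg]; exact hf.add hg.neg

theorem sum {ι : Type*} (s : Finset ι) {f : ι → (Fin N → ℂ) → ℂ}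
    (h : ∀ i ∈ s, VanishOrder m (f i)) : VanishOrder m (∑ i ∈ s, f i) := by
  classical
  induction s using Finset.induction_on with
  | empty => simpa using zero m
  | insert a s ha ih =>
    rw [Finset.sum_insert ha]
    exact (h a (Finset.mem_insert_self a s)).add
      (ih fun i hi => h i (Finset.mem_insert_of_mem hi))

theorem partialD (h : VanishOrder (m + 1) f) (i : Fin N) :
    VanishOrder m (SchurCLT.partialD i f) := h.2.2 i

theorem partialD' (h : VanishOrder m f) (i : Fin N) :
    VanishOrder (m - 1) (SchurCLT.partialD i f) := by
  cases m with
  | zero => exact SmoothAtOne.partialD h i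
  | succ m => exact h.2.2 i

theorem mul (hf : VanishOrder m f) (hg : VanishOrder n g) : VanishOrder (m + n) (f * g) := by
  induction hk : m + n generalizing m n f g with
  | zero =>
    exact ContDiffAt.mul hf.smooth hg.smooth
  | succ k ih =>
    refine ⟨ContDiffAt.mul hf.smooth hg.smooth, ?_, fun i => ?_⟩
    · rcases m with - | m
      · rcases n with - | n
        · omega
        · simp [hg.2.1]
      · simp [hf.2.1]
    · refine VanishOrder.congr ?_ (partialD_mul hf.smooth hg.smooth i).symm
      refine add ?_ ?_
      -- If m = 0, differentiating the first factor costs no order, and one order of the second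
      -- factor is simply given up.
      · rcases m with - | m
        · exact ((ih (hf.partialD' i) (hg.mono (Nat.sub_le n 1)) (by omega)))
        · exact ih (hf.2.2 i) hg (by omega)
      · rcases n with - | n
        · exact ((ih (hf.mono (Nat.sub_le m 1)) (hg.partialD' i) (by omega)))
        · exact ih hf (hg.2.2 i) (by omega)

theorem exp_sub_one (hf : VanishOrder (m + 1) f) :
    VanishOrder (m + 1) ((fun x => Complex.exp (f x)) - fun _ => 1) := by
  have hs : SmoothAtOne fun x => Complex.exp (f x) := hf.1.cexp
  refine ⟨hs.sub contDiffAt_const, by simp [hf.2.1], fun i => ?_⟩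
  have h0 : VanishOrder 0 fun x => Complex.exp (f x) := hs
  have := h0.mul (hf.2.2 i)
  rw [zero_add] at this
  refine this.congr ?_
  refine (partialD_exp hf.1 i).symm.trans ?_
  have e : (fun x => Complex.exp (f x)) = ((fun x => Complex.exp (f x)) - fun _ => 1) + fun _ => 1 :=
    by simp
  conv_lhs => rw [e]
  refine (partialD_add (hs.sub contDiffAt_const) contDiffAt_const i).trans ?_
  rw [partialD_const]
  exact EventuallyEq.of_eq (by funext x; simp only [Pi.add_apply, add_zero]; rfl)

end VanishOrder

theorem SmoothAtOne.pow {N : ℕ} {f : (Fin N → ℂ) → ℂ} (hf : SmoothAtOne f) (n : ℕ) :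
    SmoothAtOne (f ^ n) := ContDiffAt.pow hf n

theorem SmoothAtOne.smul {N : ℕ} {f : (Fin N → ℂ) → ℂ} (hf : SmoothAtOne f) (c : ℂ) :
    SmoothAtOne (c • f) := ContDiffAt.const_smul c hf

theorem partialD_pow {N : ℕ} {f : (Fin N → ℂ) → ℂ} (hf : SmoothAtOne f) (i n : ℕ) :
    partialD i (f ^ (n + 1)) =ᶠ[𝓝 1] ((n : ℂ) + 1) • (f ^ n * partialD i f) := by
  induction n with
  | zero => simp
  | succ n ih =>
    rw [pow_succ]
    refine (partialD_mul (hf.pow _) hf i).trans ?_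
    filter_upwards [ih] with x hx
    simp only [Pi.add_apply, Pi.mul_apply, hx, Pi.smul_apply, smul_eq_mul, Pi.pow_apply]
    push_cast
    ring

theorem smooth_truncExp {N : ℕ} {f : (Fin N → ℂ) → ℂ} (hf : SmoothAtOne f) (d : ℕ) :
    SmoothAtOne (truncExp d f) := by
  have : VanishOrder 0 (truncExp d f) := by
    unfold truncExp
    exact VanishOrder.sum _ fun n _ =>
      VanishOrder.const_smul _ (show VanishOrder 0 (f ^ n) from hf.pow n)
  exact this

theorem truncExp_succ {A : Type*} [Semiring A] [Algebra ℂ A] (d : ℕ) (w : A) :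
    truncExp (d + 1) w = truncExp d w + (((d + 1)! : ℂ)⁻¹) • w ^ (d + 1) :=
  Finset.sum_range_succ _ _

theorem partialD_truncExp {N : ℕ} {f : (Fin N → ℂ) → ℂ} (hf : SmoothAtOne f) (i d : ℕ) :
    partialD i (truncExp (d + 1) f) =ᶠ[𝓝 1] truncExp d f * partialD i f := by
  induction d with
  | zero =>
    rw [truncExp_succ]
    have h0 : truncExp 0 f = fun _ => 1 := by funext x; simp [truncExp]
    refine (partialD_add (smooth_truncExp hf 0) ((hf.pow 1).smul _) i).trans ?_
    rw [h0, partialD_const]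
    exact EventuallyEq.of_eq (by funext x; simp)
  | succ d ih =>
    rw [truncExp_succ]
    refine (partialD_add (smooth_truncExp hf _) ((hf.pow _).smul _) i).trans ?_
    have h1 := partialD_pow hf i (d + 1)
    rw [partialD_const_smul]
    filter_upwards [ih, h1] with x hx h2
    simp only [Pi.add_apply, Pi.mul_apply, hx, Pi.smul_apply, smul_eq_mul, h2, Pi.pow_apply]
    have h3 : (((d + 1 + 1)! : ℕ) : ℂ) = ((d : ℂ) + 1 + 1) * ((d + 1)! : ℕ) := by
      rw [Nat.factorial_succ (d + 1)]; push_cast; ring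
    have h4 : ((d : ℂ) + 1 + 1) ≠ 0 := by exact_mod_cast Nat.succ_ne_zero (d + 1)
    have h5 : (((d + 1)! : ℕ) : ℂ) ≠ 0 := by exact_mod_cast Nat.factorial_ne_zero (d + 1)
    rw [h3, show truncExp (d + 1) f x = truncExp d f x + (((d + 1)! : ℂ)⁻¹) • f x ^ (d + 1) from
      congrFun (truncExp_succ d f) x, smul_eq_mul]
    push_cast
    field_simp

/-- The i-th partial derivative of the remainder of degree d + 1 is the remainder of degree d times
∂_i f, so each degree gains one order. -/
theorem VanishOrder.exp_sub_truncExp {N : ℕ} {f : (Fin N → ℂ) → ℂ} (hf : VanishOrder 1 f) (d : ℕ) :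
    VanishOrder (d + 1) ((fun x => Complex.exp (f x)) - truncExp d f) := by
  have hs : SmoothAtOne fun x => Complex.exp (f x) := hf.1.cexp
  induction d with
  | zero =>
    have h0 : truncExp 0 f = fun _ => 1 := by funext x; simp [truncExp]
    rw [h0]
    exact hf.exp_sub_one
  | succ d ih =>
    have ht := smooth_truncExp hf.1 (d + 1)
    refine ⟨hs.sub ht, ?_, fun i => ?_⟩
    · simp only [Pi.sub_apply, hf.2.1, Complex.exp_zero, truncExp, Finset.sum_apply, Pi.smul_apply,
        Pi.pow_apply]
      rw [Finset.sum_range_succ']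
      simp
    · refine (ih.mul (n := 0) (hf.1.partialD i)).congr ?_
      have e : (fun x => Complex.exp (f x)) - truncExp (d + 1) f =
        (fun x => Complex.exp (f x)) + (-1 : ℂ) • truncExp (d + 1) f := by simp [sub_eq_add_neg]
      rw [e]
      refine EventuallyEq.symm ((partialD_add hs (SmoothAtOne.smul ht _) i).trans ?_)
      rw [partialD_const_smul]
      filter_upwards [partialD_exp hf.1 i, partialD_truncExp hf.1 i d] with x h1 h2
      simp only [Pi.add_apply, Pi.smul_apply, h1, h2, Pi.mul_apply, Pi.sub_apply, smul_eq_mul]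
      ring

/-! ### Polynomial functions centered at `(1, …, 1)` -/

/-- The polynomial function `x ↦ p(x - 1)`. -/
def polyFun {N : ℕ} (p : MvPolynomial (Fin N) ℂ) : (Fin N → ℂ) → ℂ :=
  fun x => MvPolynomial.eval (x - 1) p

theorem polyFun_add {N : ℕ} (p q : MvPolynomial (Fin N) ℂ) :
    polyFun (p + q) = polyFun p + polyFun q := by funext x; simp [polyFun]

theorem polyFun_mul {N : ℕ} (p q : MvPolynomial (Fin N) ℂ) :
    polyFun (p * q) = polyFun p * polyFun q := by funext x; simp [polyFun]

theorem polyFun_smul {N : ℕ} (c : ℂ) (p : MvPolynomial (Fin N) ℂ) :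
    polyFun (c • p) = c • polyFun p := by funext x; simp [polyFun, MvPolynomial.smul_eval]

/-- `polyFun` as an algebra homomorphism. -/
def polyFunHom (N : ℕ) : MvPolynomial (Fin N) ℂ →ₐ[ℂ] ((Fin N → ℂ) → ℂ) where
  toFun := polyFun
  map_one' := by funext x; simp [polyFun]
  map_mul' := polyFun_mul
  map_zero' := by funext x; simp [polyFun]
  map_add' := polyFun_add
  commutes' c := by funext x; simp [polyFun, MvPolynomial.algebraMap_eq]

theorem polyFunHom_apply {N : ℕ} (p : MvPolynomial (Fin N) ℂ) : polyFunHom N p = polyFun p := rfl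

theorem hasFDerivAt_coord {N : ℕ} (i : Fin N) (x : Fin N → ℂ) :
    HasFDerivAt (fun x : Fin N → ℂ => x i) (ContinuousLinearMap.proj (R := ℂ) i : (Fin N → ℂ) →L[ℂ] ℂ) x :=
  hasFDerivAt_apply i x

theorem polyFun_X {N : ℕ} (i : Fin N) :
    polyFun (MvPolynomial.X i) = fun x : Fin N → ℂ => x i - 1 := by
  funext x; simp [polyFun]

theorem contDiff_polyFun {N : ℕ} (p : MvPolynomial (Fin N) ℂ) (n : WithTop ℕ∞) :
    ContDiff ℂ n (polyFun p) := by
  induction p using MvPolynomial.induction_on with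
  | C a =>
    have : polyFun (MvPolynomial.C a) = fun _ : Fin N → ℂ => a := by funext x; simp [polyFun]
    rw [this]; exact contDiff_const
  | add p q hp hq => rw [polyFun_add]; exact hp.add hq
  | mul_X p i hp =>
    rw [polyFun_mul, polyFun_X]
    exact hp.mul ((contDiff_apply ℂ ℂ i).sub contDiff_const)

theorem smooth_polyFun {N : ℕ} (p : MvPolynomial (Fin N) ℂ) : SmoothAtOne (polyFun p) :=
  (contDiff_polyFun p _).contDiffAt

theorem fderiv_polyFun {N : ℕ} (p : MvPolynomial (Fin N) ℂ) (i : Fin N) (x : Fin N → ℂ) :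
    fderiv ℂ (polyFun p) x (unitVec N i) = polyFun (MvPolynomial.pderiv i p) x := by
  have hd : ∀ q : MvPolynomial (Fin N) ℂ, DifferentiableAt ℂ (polyFun q) x := fun q =>
    (contDiff_polyFun q 1).differentiable (by simp) x
  induction p using MvPolynomial.induction_on with
  | C a =>
    have : polyFun (MvPolynomial.C a) = fun _ : Fin N → ℂ => a := by funext x; simp [polyFun]
    rw [this, MvPolynomial.pderiv_C, fderiv_fun_const]
    simp [polyFun]
  | add p q hp hq =>
    rw [polyFun_add, fderiv_add (hd p) (hd q), map_add, polyFun_add, Pi.add_apply, ← hp, ← hq]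
    rfl
  | mul_X p j hp =>
    rw [polyFun_mul, fderiv_mul (hd p) (hd _), Derivation.leibniz, polyFun_add, Pi.add_apply]
    simp only [smul_eq_mul, polyFun_mul, Pi.mul_apply, ← hp, add_apply, smul_apply]
    congr 2
    rw [polyFun_X, ((hasFDerivAt_coord j x).sub_const 1).fderiv, MvPolynomial.pderiv_X]
    by_cases h : j = i
    · subst h; simp [unitVec, polyFun]
    · have h' : (j : ℕ) ≠ i := fun e => h (Fin.ext e)
      simp [unitVec, polyFun, h, h']

theorem partialD_polyFun {N : ℕ} (p : MvPolynomial (Fin N) ℂ) (i : Fin N) :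
    partialD i (polyFun p) = polyFun (MvPolynomial.pderiv i p) := by
  funext x
  rw [partialD_eq_fderiv ((contDiff_polyFun p 1).differentiable (by simp) x), fderiv_polyFun]

theorem vanishOrder_polyFun_X {N : ℕ} (i : Fin N) : VanishOrder 1 (polyFun (MvPolynomial.X i)) :=
  ⟨smooth_polyFun _, by simp [polyFun], fun j => by
    rw [partialD_polyFun]; exact smooth_polyFun _⟩

theorem vanishOrder_polyFun_monomial {N : ℕ} (s : Fin N →₀ ℕ) (a : ℂ) :
    VanishOrder s.degree (polyFun (MvPolynomial.monomial s a)) := by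
  induction s using Finsupp.induction_linear generalizing a with
  | zero => exact smooth_polyFun _
  | add s t hs ht =>
    rw [← mul_one a, ← MvPolynomial.monomial_mul, polyFun_mul, map_add]
    exact (hs a).mul (ht 1)
  | single i n =>
    rw [Finsupp.degree_single]
    induction n generalizing a with
    | zero => exact smooth_polyFun _
    | succ n ih =>
      rw [Finsupp.single_add, ← mul_one a, ← MvPolynomial.monomial_mul, polyFun_mul]
      exact (ih a).mul (vanishOrder_polyFun_X i)

theorem vanishOrder_polyFun {N : ℕ} {p : MvPolynomial (Fin N) ℂ} {m : ℕ}
    (h : ∀ s, MvPolynomial.coeff s p ≠ 0 → m ≤ s.degree) : VanishOrder m (polyFun p) := by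
  rw [← polyFunHom_apply, p.as_sum, map_sum]
  exact VanishOrder.sum _ fun s hs => (vanishOrder_polyFun_monomial s _).mono
    (h s (MvPolynomial.mem_support_iff.1 hs))

/-! ### Termwise differentiation of uniformly convergent series of holomorphic functions -/

/-- Cauchy's estimate for the derivative of a bounded function on a ball. -/
theorem norm_fderiv_le_of_ball {E : Type*} [NormedAddCommGroup E] [NormedSpace ℂ E] {h : E → ℂ}
    {c x : E} {R C : ℝ} (hd : DifferentiableOn ℂ h (Metric.ball c R))
    (hC : ∀ y ∈ Metric.ball c R, ‖h y‖ ≤ C) (hx : x ∈ Metric.ball c (R / 2)) :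
    ‖fderiv ℂ h x‖ ≤ C / (R / 2) := by
  have hR : 0 < R / 2 := Metric.pos_of_mem_ball hx
  have hxR : x ∈ Metric.ball c R := Metric.ball_subset_ball (by linarith) hx
  have hC0 : 0 ≤ C := (norm_nonneg _).trans (hC x hxR)
  refine ContinuousLinearMap.opNorm_le_bound _ (by positivity) fun v => ?_
  rcases eq_or_ne v 0 with rfl | hv
  · simp
  have hv' : 0 < ‖v‖ := norm_pos_iff.2 hv
  -- The one-variable estimate is applied on the complex line through x in direction v; a disc of
  -- radius R/(2‖v‖) stays inside the ball because x is in its inner half.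
  have hmem : ∀ z ∈ Metric.closedBall (0 : ℂ) (R / 2 / ‖v‖), x + z • v ∈ Metric.ball c R := by
    intro z hz
    rw [mem_closedBall_zero_iff, le_div_iff₀ hv'] at hz
    rw [mem_ball_iff_norm] at hx ⊢
    calc ‖x + z • v - c‖ = ‖(x - c) + z • v‖ := by congr 1; abel
      _ ≤ ‖x - c‖ + ‖z • v‖ := norm_add_le _ _
      _ < R / 2 + R / 2 := by rw [norm_smul]; linarith
      _ = R := by ring
  have hline : ∀ z : ℂ, HasDerivAt (fun z : ℂ => x + z • v) v z := fun z => by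
    simpa using ((hasDerivAt_id z).smul_const v).const_add x
  have hdiff : ∀ z ∈ Metric.closedBall (0 : ℂ) (R / 2 / ‖v‖),
      HasDerivAt (fun z : ℂ => h (x + z • v)) (fderiv ℂ h (x + z • v) v) z := fun z hz =>
    ((hd.differentiableAt (Metric.isOpen_ball.mem_nhds (hmem z hz))).hasFDerivAt).comp_hasDerivAt z
      (hline z)
  have hr : 0 < R / 2 / ‖v‖ := by positivity
  have key := Complex.norm_deriv_le_of_forall_mem_sphere_norm_le (f := fun z : ℂ => h (x + z • v))
    (c := 0) (R := R / 2 / ‖v‖) (C := C) hr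
    (DifferentiableOn.diffContOnCl fun z hz => by
      rw [closure_ball _ hr.ne'] at hz
      exact (hdiff z hz).differentiableAt.differentiableWithinAt)
    (fun z hz => hC _ (hmem z (Metric.sphere_subset_closedBall hz)))
  rw [(hdiff 0 (Metric.mem_closedBall_self hr.le)).deriv] at key
  simp only [zero_smul, add_zero] at key
  refine key.trans_eq ?_
  field_simp

/-- Uniform convergence of a series of smooth functions on the polydisc of radius `R` around
`(1, …, 1)`. -/
structure UnifSum {ι : Type*} {N : ℕ} (R : ℝ) (g : ι → (Fin N → ℂ) → ℂ) (G : (Fin N → ℂ) → ℂ) :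
    Prop where
  pos : 0 < R
  smooth : ∀ a, ContDiffOn ℂ ((⊤ : ℕ∞) : WithTop ℕ∞) (g a) (Metric.ball 1 R)
  tendsto : TendstoUniformlyOn (fun (s : Finset ι) x => ∑ a ∈ s, g a x) G atTop (Metric.ball 1 R)

namespace UnifSum

variable {ι : Type*} {N : ℕ} {R : ℝ} {g : ι → (Fin N → ℂ) → ℂ} {G : (Fin N → ℂ) → ℂ}

theorem hasSum (h : UnifSum R g G) {x : Fin N → ℂ} (hx : x ∈ Metric.ball 1 R) :
    HasSum (fun a => g a x) (G x) := by
  have := h.tendsto.tendsto_at hx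
  simpa [HasSum] using this

theorem differentiableAt (h : UnifSum R g G) (a : ι) {x : Fin N → ℂ} (hx : x ∈ Metric.ball 1 R) :
    DifferentiableAt ℂ (g a) x :=
  ((h.smooth a).differentiableOn (by simp)).differentiableAt (Metric.isOpen_ball.mem_nhds hx)

/-- Cauchy's estimate for differences of partial sums makes the derivatives uniformly Cauchy on the
half ball, and uniform convergence of derivatives allows differentiation of the limit. -/
theorem exists_fderiv (h : UnifSum R g G) : ∃ g' : (Fin N → ℂ) → (Fin N → ℂ) →L[ℂ] ℂ,
    (∀ x ∈ Metric.ball 1 (R / 2), HasFDerivAt G (g' x) x) ∧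
    TendstoUniformlyOn (fun (s : Finset ι) x => ∑ a ∈ s, fderiv ℂ (g a) x) g' atTop
      (Metric.ball 1 (R / 2)) := by
  classical
  have hR := h.pos
  have hsub : Metric.ball (1 : Fin N → ℂ) (R / 2) ⊆ Metric.ball 1 R :=
    Metric.ball_subset_ball (by linarith)
  have hfd : ∀ (s : Finset ι) x, x ∈ Metric.ball (1 : Fin N → ℂ) R →
      HasFDerivAt (fun x => ∑ a ∈ s, g a x) (∑ a ∈ s, fderiv ℂ (g a) x) x := fun s x hx =>
    HasFDerivAt.fun_sum fun a _ => (h.differentiableAt a hx).hasFDerivAt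
  have hcau : UniformCauchySeqOn (fun (s : Finset ι) x => ∑ a ∈ s, fderiv ℂ (g a) x) atTop
      (Metric.ball 1 (R / 2)) := by
    rw [Metric.uniformCauchySeqOn_iff]
    intro ε hε
    obtain ⟨s₀, hs₀⟩ := Metric.uniformCauchySeqOn_iff.1 h.tendsto.uniformCauchySeqOn (ε * (R / 4))
      (by positivity)
    refine ⟨s₀, fun s hs t ht x hx => ?_⟩
    have h1 : ∀ y ∈ Metric.ball (1 : Fin N → ℂ) R, HasFDerivAt
        (fun x => ∑ a ∈ s, g a x - ∑ a ∈ t, g a x)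
        (∑ a ∈ s, fderiv ℂ (g a) y - ∑ a ∈ t, fderiv ℂ (g a) y) y := fun y hy =>
      (hfd s y hy).sub (hfd t y hy)
    have h2 := norm_fderiv_le_of_ball (C := ε * (R / 4))
      (fun y hy => (h1 y hy).differentiableAt.differentiableWithinAt)
      (fun y hy => by
        rw [← dist_eq_norm]
        exact (hs₀ s hs t ht y hy).le) hx
    rw [(h1 x (hsub hx)).fderiv] at h2
    rw [dist_eq_norm]
    refine h2.trans_lt ?_
    rw [div_lt_iff₀ (by linarith)]
    nlinarith
  have hlim : ∀ x, ∃ l : (Fin N → ℂ) →L[ℂ] ℂ, x ∈ Metric.ball (1 : Fin N → ℂ) (R / 2) →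
      Tendsto (fun s : Finset ι => ∑ a ∈ s, fderiv ℂ (g a) x) atTop (𝓝 l) := fun x => by
    by_cases hx : x ∈ Metric.ball (1 : Fin N → ℂ) (R / 2)
    · obtain ⟨l, hl⟩ := cauchy_map_iff_exists_tendsto.1 (hcau.cauchy_map hx)
      exact ⟨l, fun _ => hl⟩
    · exact ⟨0, fun h => absurd h hx⟩
  choose g' hg' using hlim
  have hunif := hcau.tendstoUniformlyOn_of_tendsto fun x hx => hg' x hx
  exact ⟨g', fun x hx => hasFDerivAt_of_tendstoUniformlyOn Metric.isOpen_ball hunif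
    (fun s y hy => hfd s y (hsub hy)) (fun y hy => h.tendsto.tendsto_at (hsub hy)) hx, hunif⟩

theorem partialD (h : UnifSum R g G) (i : ℕ) :
    UnifSum (R / 2) (fun a => partialD i (g a)) (partialD i G) := by
  obtain ⟨g', hG, hunif⟩ := h.exists_fderiv
  have hR := h.pos
  have hsub : Metric.ball (1 : Fin N → ℂ) (R / 2) ⊆ Metric.ball 1 R :=
    Metric.ball_subset_ball (by linarith)
  refine ⟨by linarith, fun a => ?_, ?_⟩
  · have h1 := ((h.smooth a).fderiv_of_isOpen (m := ((⊤ : ℕ∞) : WithTop ℕ∞)) Metric.isOpen_ball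
      (by simp)).clm_apply (contDiffOn_const (c := unitVec N i))
    exact (h1.mono hsub).congr fun x hx => partialD_eq_fderiv (h.differentiableAt a (hsub hx)) i
  · have h1 := (ContinuousLinearMap.apply ℂ ℂ (unitVec N i)).uniformContinuous.comp_tendstoUniformlyOn
      hunif
    refine (h1.congr (Eventually.of_forall fun s x hx => ?_)).congr_right fun x hx => ?_
    · simp only [Function.comp_apply, map_sum, ContinuousLinearMap.apply_apply]
      exact Finset.sum_congr rfl fun a _ => (partialD_eq_fderiv (h.differentiableAt a (hsub hx)) i).symm
    · simp only [Function.comp_apply, ContinuousLinearMap.apply_apply]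
      rw [partialD_eq_fderiv (hG x hx).differentiableAt, (hG x hx).fderiv]

theorem mono (h : UnifSum R g G) {r : ℝ} (hr : 0 < r) (hrR : r ≤ R) : UnifSum r g G :=
  ⟨hr, fun a => (h.smooth a).mono (Metric.ball_subset_ball hrR),
    h.tendsto.mono (Metric.ball_subset_ball hrR)⟩

theorem mul_left (h : UnifSum R g G) {f : (Fin N → ℂ) → ℂ} {C : ℝ}
    (hf : ContDiffOn ℂ ((⊤ : ℕ∞) : WithTop ℕ∞) f (Metric.ball 1 R))
    (hC : ∀ x ∈ Metric.ball 1 R, ‖f x‖ ≤ C) : UnifSum R (fun a => f * g a) (f * G) := by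
  refine ⟨h.pos, fun a => hf.mul (h.smooth a), ?_⟩
  have hC0 : 0 ≤ C := (norm_nonneg _).trans (hC 1 (Metric.mem_ball_self h.pos))
  rw [Metric.tendstoUniformlyOn_iff]
  intro ε hε
  filter_upwards [Metric.tendstoUniformlyOn_iff.1 h.tendsto (ε / (C + 1)) (by positivity)] with s hs
  intro x hx
  have h1 := hs x hx
  simp only [Pi.mul_apply, ← Finset.mul_sum, dist_eq_norm, ← mul_sub, norm_mul] at h1 ⊢
  rw [lt_div_iff₀ (by positivity)] at h1
  have h2 := hC x hx
  nlinarith [norm_nonneg (G x - ∑ a ∈ s, g a x)]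

theorem add {g₁ : ι → (Fin N → ℂ) → ℂ} {G₁ : (Fin N → ℂ) → ℂ} (h : UnifSum R g G)
    (h₁ : UnifSum R g₁ G₁) : UnifSum R (fun a => g a + g₁ a) (G + G₁) :=
  ⟨h.pos, fun a => (h.smooth a).add (h₁.smooth a), (h.tendsto.add h₁.tendsto).congr
    (Eventually.of_forall fun s x _ => by simp [Finset.sum_add_distrib])⟩

theorem zero (hR : 0 < R) : UnifSum R (fun _ : ι => (0 : (Fin N → ℂ) → ℂ)) 0 :=
  ⟨hR, fun _ => contDiffOn_const, by
    simp only [Pi.zero_apply, Finset.sum_const_zero]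
    exact (tendsto_const_nhds (x := (0 : ℂ))).tendstoUniformlyOn_const _⟩

theorem sum {κ : Type*} (s : Finset κ) {g : κ → ι → (Fin N → ℂ) → ℂ} {G : κ → (Fin N → ℂ) → ℂ}
    (hR : 0 < R) (h : ∀ k ∈ s, UnifSum R (g k) (G k)) :
    UnifSum R (fun a => ∑ k ∈ s, g k a) (∑ k ∈ s, G k) := by
  classical
  induction s using Finset.induction_on with
  | empty => simpa using zero hR
  | insert k s hk ih =>
    simp only [Finset.sum_insert hk]
    exact (h k (Finset.mem_insert_self k s)).add
      (ih fun i hi => h i (Finset.mem_insert_of_mem hi))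

/-- Bootstrapping: the partial derivatives of the sum are sums of the same kind on half the radius,
and the total derivative is assembled from them. -/
theorem contDiffAt (h : UnifSum R g G) (n : ℕ) : ContDiffAt ℂ n G 1 := by
  induction n generalizing R g G with
  | zero =>
    obtain ⟨g', hG, -⟩ := h.exists_fderiv
    exact contDiffAt_zero.2 ⟨Metric.ball 1 (R / 2), Metric.ball_mem_nhds _ (half_pos h.pos),
      fun x hx => (hG x hx).continuousAt.continuousWithinAt⟩
  | succ n ih =>
    obtain ⟨g', hG, -⟩ := h.exists_fderiv
    push_cast
    refine contDiffAt_succ_iff_hasFDerivAt.2 ⟨g', ⟨Metric.ball 1 (R / 2),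
      Metric.ball_mem_nhds _ (half_pos h.pos), hG⟩, ?_⟩
    have h1 : ContDiffAt ℂ n (fun x => ∑ i : Fin N, SchurCLT.partialD (i : ℕ) G x •
        (ContinuousLinearMap.proj (R := ℂ) i : (Fin N → ℂ) →L[ℂ] ℂ)) 1 :=
      ContDiffAt.sum fun i _ => (ih (h.partialD i)).smul contDiffAt_const
    refine h1.congr_of_eventuallyEq ?_
    filter_upwards [Metric.ball_mem_nhds (1 : Fin N → ℂ) (half_pos h.pos)] with x hx
    refine ContinuousLinearMap.ext fun v => ?_
    have hv : v = ∑ i : Fin N, v i • unitVec N i := by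
      funext j
      simp [unitVec, Fin.val_inj]
    conv_lhs => rw [hv, map_sum]
    simp only [map_smul, smul_eq_mul, sum_apply, smul_apply,
      ContinuousLinearMap.proj_apply]
    refine Finset.sum_congr rfl fun i _ => ?_
    rw [partialD_eq_fderiv (hG x hx).differentiableAt, (hG x hx).fderiv, mul_comm]

theorem smoothAtOne (h : UnifSum R g G) : SmoothAtOne G :=
  contDiffAt_infty.2 fun n => h.contDiffAt n

end UnifSum

/-! ### Euler operators -/

/-- The operator `x_i ∂_i`. -/
def thetaD {N : ℕ} (i : Fin N) (f : (Fin N → ℂ) → ℂ) : (Fin N → ℂ) → ℂ :=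
  (fun x => x i) * partialD i f

theorem smooth_coord {N : ℕ} (i : Fin N) : SmoothAtOne fun x : Fin N → ℂ => x i :=
  (contDiff_apply ℂ ℂ i).contDiffAt

theorem VanishOrder.thetaD {N : ℕ} {f : (Fin N → ℂ) → ℂ} {m : ℕ} (h : VanishOrder (m + 1) f)
    (i : Fin N) : VanishOrder m (thetaD i f) := by
  have := VanishOrder.mul (m := 0) (smooth_coord i) (h.partialD i)
  rwa [zero_add] at this

theorem SmoothAtOne.thetaD {N : ℕ} {f : (Fin N → ℂ) → ℂ} (h : SmoothAtOne f)
    (i : Fin N) : SmoothAtOne (thetaD i f) := (smooth_coord i).mul (h.partialD i)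

theorem thetaD_congr {N : ℕ} {f g : (Fin N → ℂ) → ℂ} {x : Fin N → ℂ} (h : f =ᶠ[𝓝 x] g)
    (i : Fin N) : thetaD i f =ᶠ[𝓝 x] thetaD i g := by
  filter_upwards [partialD_congr h i] with y hy
  simp [thetaD, hy]

theorem thetaD_add {N : ℕ} {f g : (Fin N → ℂ) → ℂ} (hf : SmoothAtOne f) (hg : SmoothAtOne g)
    (i : Fin N) : thetaD i (f + g) =ᶠ[𝓝 1] thetaD i f + thetaD i g := by
  filter_upwards [partialD_add hf hg i] with y hy
  simp only [thetaD, Pi.mul_apply, hy, Pi.add_apply]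
  ring

theorem thetaD_const_smul {N : ℕ} (c : ℂ) (f : (Fin N → ℂ) → ℂ) (i : Fin N) :
    thetaD i (c • f) = c • thetaD i f := by
  simp [thetaD, partialD_const_smul]

theorem UnifSum.thetaD {ι : Type*} {N : ℕ} {R : ℝ} {g : ι → (Fin N → ℂ) → ℂ}
    {G : (Fin N → ℂ) → ℂ} (h : UnifSum R g G) (i : Fin N) :
    UnifSum (R / 2) (fun a => thetaD i (g a)) (thetaD i G) := by
  refine (h.partialD i).mul_left (C := 1 + R / 2) (contDiff_apply ℂ ℂ i).contDiffOn fun x hx => ?_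
  rw [mem_ball_iff_norm] at hx
  calc ‖x i‖ = ‖1 + (x - 1) i‖ := by simp
    _ ≤ ‖(1 : ℂ)‖ + ‖(x - 1) i‖ := norm_add_le _ _
    _ ≤ 1 + R / 2 := by
      rw [norm_one]
      exact add_le_add le_rfl ((norm_le_pi_norm _ i).trans hx.le)

/-- The operator `∑ (x_i ∂_i) ^ k`. -/
def eulerOp {N : ℕ} (k : ℕ) (f : (Fin N → ℂ) → ℂ) : (Fin N → ℂ) → ℂ := ∑ i, (thetaD i)^[k] f

/-- The operator `N ^ (-k) ∑ (x_i ∂_i) ^ k - y`. -/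
def centeredEuler {N : ℕ} (k : ℕ) (y : ℂ) (f : (Fin N → ℂ) → ℂ) : (Fin N → ℂ) → ℂ :=
  ((N : ℂ) ^ k)⁻¹ • eulerOp k f + (-y) • f

/-- A composition of operators `centeredEuler`. -/
def eulerProd {N : ℕ} (y : ℕ → ℂ) (ks : List ℕ) (f : (Fin N → ℂ) → ℂ) : (Fin N → ℂ) → ℂ :=
  ks.foldr (fun k h => centeredEuler k (y k) h) f

/-! ### Diagonalization of the Euler operators and extraction of the lowest-order coefficient. -/

/-! ### Alternants as eigenfunctions of Euler operators -/

/-- Points all of whose coordinates are nonzero. -/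
def nonzeroSet (N : ℕ) : Set (Fin N → ℂ) := {x | ∀ i, x i ≠ 0}

theorem isOpen_nonzeroSet (N : ℕ) : IsOpen (nonzeroSet N) := by
  simp only [nonzeroSet, Set.ofPred_forall]
  exact isOpen_iInter_of_finite fun i => isOpen_ne_fun (continuous_apply i) continuous_const

theorem one_mem_nonzeroSet (N : ℕ) : (1 : Fin N → ℂ) ∈ nonzeroSet N := fun _ => one_ne_zero

theorem ball_subset_nonzeroSet {N : ℕ} {R : ℝ} (hR : R ≤ 1) :
    Metric.ball (1 : Fin N → ℂ) R ⊆ nonzeroSet N := by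
  intro x hx i hi
  rw [mem_ball_iff_norm] at hx
  have h1 := (norm_le_pi_norm (x - 1) i).trans_lt hx
  simp only [Pi.sub_apply, hi, Pi.one_apply, zero_sub, norm_neg, norm_one] at h1
  linarith

/-- Laurent monomials. -/
def laurentMonomial {N : ℕ} (e : Fin N → ℤ) (x : Fin N → ℂ) : ℂ := ∏ i, x i ^ e i

/-- Finite linear combinations of Laurent monomials. -/
def laurentComb {N : ℕ} {κ : Type*} [Fintype κ] (c : κ → ℂ) (e : κ → Fin N → ℤ)
    (x : Fin N → ℂ) : ℂ := ∑ a, c a * laurentMonomial (e a) x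

theorem hasDerivAt_laurentMonomial_line {N : ℕ} (e : Fin N → ℤ) (i : Fin N) {x : Fin N → ℂ}
    (hx : x ∈ nonzeroSet N) :
    HasDerivAt (fun t : ℂ => laurentMonomial e (x + t • unitVec N i))
      (e i * (x i)⁻¹ * laurentMonomial e x) 0 := by
  have h1 : (fun t : ℂ => laurentMonomial e (x + t • unitVec N i)) = fun t : ℂ =>
      (x i + t) ^ e i * ∏ j ∈ Finset.univ.erase i, x j ^ e j := by
    funext t
    rw [laurentMonomial, ← Finset.mul_prod_erase _ _ (Finset.mem_univ i)]
    congr 1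
    · simp [unitVec]
    · refine Finset.prod_congr rfl fun j hj => ?_
      have : (j : ℕ) ≠ i := fun h => Finset.ne_of_mem_erase hj (Fin.ext h)
      simp [unitVec, this]
  rw [h1]
  have h2 : HasDerivAt (fun t : ℂ => (x i + t) ^ e i) (e i * (x i) ^ (e i - 1)) 0 := by
    have h3 := hasDerivAt_zpow (e i) (x i) (Or.inl (hx i))
    have h4 : HasDerivAt (fun t : ℂ => x i + t) 1 0 := (hasDerivAt_id 0).const_add (x i)
    have h5 := HasDerivAt.comp (h := fun t : ℂ => x i + t) (h₂ := fun z => z ^ e i) 0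
      (by simpa using h3) h4
    simp only [mul_one] at h5
    exact h5
  refine (h2.mul_const (∏ j ∈ Finset.univ.erase i, x j ^ e j)).congr_deriv ?_
  rw [show laurentMonomial e x = ∏ j, x j ^ e j from rfl, ← Finset.mul_prod_erase _ _ (Finset.mem_univ i), zpow_sub_one₀ (hx i)]
  ring

theorem thetaD_laurentComb {N : ℕ} {κ : Type*} [Fintype κ] (c : κ → ℂ) (e : κ → Fin N → ℤ)
    (i : Fin N) : Set.EqOn (thetaD i (laurentComb c e))
      (laurentComb (fun a => c a * (e a i : ℂ)) e) (nonzeroSet N) := by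
  intro x hx
  have h1 : HasDerivAt (fun t : ℂ => laurentComb c e (x + t • unitVec N i))
      (∑ a, c a * (e a i * (x i)⁻¹ * laurentMonomial (e a) x)) 0 :=
    HasDerivAt.fun_sum fun a _ => (hasDerivAt_laurentMonomial_line (e a) i hx).const_mul (c a)
  simp only [thetaD, Pi.mul_apply]
  change x i * deriv (fun t : ℂ => laurentComb c e (x + t • unitVec N i)) 0 = _
  rw [h1.deriv, Finset.mul_sum, laurentComb]
  refine Finset.sum_congr rfl fun a _ => ?_
  have := hx i
  field_simp

theorem thetaD_eqOn {N : ℕ} {f g : (Fin N → ℂ) → ℂ} {U : Set (Fin N → ℂ)} (hU : IsOpen U)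
    (h : Set.EqOn f g U) (i : Fin N) : Set.EqOn (thetaD i f) (thetaD i g) U := fun _ hx =>
  (thetaD_congr (h.eventuallyEq_of_mem (hU.mem_nhds hx)) i).self_of_nhds

theorem thetaD_iterate_eqOn {N : ℕ} {f g : (Fin N → ℂ) → ℂ} {U : Set (Fin N → ℂ)} (hU : IsOpen U)
    (h : Set.EqOn f g U) (i : Fin N) (k : ℕ) :
    Set.EqOn ((thetaD i)^[k] f) ((thetaD i)^[k] g) U := by
  induction k with
  | zero => exact h
  | succ k ih =>
    rw [Function.iterate_succ_apply', Function.iterate_succ_apply']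
    exact thetaD_eqOn hU ih i

theorem thetaD_iterate_laurentComb {N : ℕ} {κ : Type*} [Fintype κ] (c : κ → ℂ)
    (e : κ → Fin N → ℤ) (i : Fin N) (k : ℕ) : Set.EqOn ((thetaD i)^[k] (laurentComb c e))
      (laurentComb (fun a => c a * (e a i : ℂ) ^ k) e) (nonzeroSet N) := by
  induction k with
  | zero => simp [Set.eqOn_refl]
  | succ k ih =>
    rw [Function.iterate_succ_apply']
    refine ((thetaD_eqOn (isOpen_nonzeroSet N) ih i).trans (thetaD_laurentComb _ e i)).trans ?_
    simp [pow_succ, mul_assoc, Set.eqOn_refl]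

/-- The alternant `det (x_i ^ m_j)`. -/
def alternant {N : ℕ} (m : Fin N → ℤ) (x : Fin N → ℂ) : ℂ :=
  (Matrix.of fun i j : Fin N => x i ^ m j).det

theorem alternant_eq {N : ℕ} (m : Fin N → ℤ) : alternant m =
    laurentComb (fun σ : Equiv.Perm (Fin N) => ((Equiv.Perm.sign σ : ℤ) : ℂ))
      (fun σ i => m (σ i)) := by
  funext x
  rw [alternant, ← Matrix.det_transpose, Matrix.det_apply']
  rfl

theorem eulerOp_laurentComb {N : ℕ} {κ : Type*} [Fintype κ] (c : κ → ℂ)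
    (e : κ → Fin N → ℤ) (k : ℕ) : Set.EqOn (eulerOp k (laurentComb c e))
      (laurentComb (fun a => c a * ∑ i, (e a i : ℂ) ^ k) e) (nonzeroSet N) := by
  intro x hx
  rw [eulerOp, Finset.sum_apply]
  rw [Finset.sum_congr rfl fun i _ => thetaD_iterate_laurentComb c e i k hx]
  simp only [laurentComb]
  rw [Finset.sum_comm]
  simp only [Finset.mul_sum, Finset.sum_mul]

theorem eulerOp_eqOn {N : ℕ} {f g : (Fin N → ℂ) → ℂ} {U : Set (Fin N → ℂ)} (hU : IsOpen U)
    (h : Set.EqOn f g U) (k : ℕ) : Set.EqOn (eulerOp k f) (eulerOp k g) U := fun x hx => by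
  rw [eulerOp, eulerOp, Finset.sum_apply, Finset.sum_apply]
  exact Finset.sum_congr rfl fun i _ => thetaD_iterate_eqOn hU h i k hx

theorem laurentComb_smul {N : ℕ} {κ : Type*} [Fintype κ] (b : ℂ) (c : κ → ℂ)
    (e : κ → Fin N → ℤ) : b • laurentComb c e = laurentComb (fun a => c a * b) e := by
  funext x
  simp only [laurentComb, Pi.smul_apply, smul_eq_mul, Finset.mul_sum]
  exact Finset.sum_congr rfl fun a _ => by ring

/-- The monomials of an alternant differ by permutations of the exponents, and the eigenvalue ∑
m_i^k is symmetric in them. -/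
theorem centeredEuler_alternant {N : ℕ} {f : (Fin N → ℂ) → ℂ} {b : ℂ} {m : Fin N → ℤ}
    (h : Set.EqOn f (b • alternant m) (nonzeroSet N)) (k : ℕ) (y : ℂ) :
    Set.EqOn (centeredEuler k y f) ((((∑ i, (m i : ℂ) ^ k) / (N : ℂ) ^ k - y) * b) • alternant m)
      (nonzeroSet N) := by
  have h1 : Set.EqOn (eulerOp k f) ((b * ∑ i, (m i : ℂ) ^ k) • alternant m) (nonzeroSet N) := by
    refine (eulerOp_eqOn (isOpen_nonzeroSet N) h k).trans ?_
    rw [alternant_eq, laurentComb_smul, laurentComb_smul]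
    refine (eulerOp_laurentComb _ _ k).trans ?_
    intro x _
    simp only [laurentComb]
    refine Finset.sum_congr rfl fun σ _ => ?_
    rw [Equiv.sum_comp σ fun i => (m i : ℂ) ^ k]
    ring
  intro x hx
  simp only [centeredEuler, Pi.add_apply, Pi.smul_apply, h1 hx, h hx, smul_eq_mul]
  ring

theorem eulerProd_alternant {N : ℕ} {f : (Fin N → ℂ) → ℂ} {b : ℂ} {m : Fin N → ℤ}
    (h : Set.EqOn f (b • alternant m) (nonzeroSet N)) (y : ℕ → ℂ) (ks : List ℕ) :
    Set.EqOn (eulerProd y ks f)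
      (((ks.map fun k => (∑ i, (m i : ℂ) ^ k) / (N : ℂ) ^ k - y k).prod * b) • alternant m)
      (nonzeroSet N) := by
  induction ks with
  | nil => simpa [eulerProd] using h
  | cons k ks ih =>
    refine (centeredEuler_alternant ih k (y k)).trans ?_
    simp [mul_assoc, Set.eqOn_refl]

/-! ### The leading coefficient of antisymmetric functions -/

/-- The composition of the operators `(x_i ∂_i) ^ i` for `i` in a list. -/
def thetaList {N : ℕ} (L : List (Fin N)) (f : (Fin N → ℂ) → ℂ) : (Fin N → ℂ) → ℂ :=
  L.foldr (fun i h => (thetaD i)^[i] h) f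

/-- The value at `(1, …, 1)` of `∏ (x_i ∂_i) ^ i` applied to a function. -/
def leadCoeff {N : ℕ} (f : (Fin N → ℂ) → ℂ) : ℂ := thetaList (List.finRange N) f 1

theorem thetaD_iterate_congr {N : ℕ} {f g : (Fin N → ℂ) → ℂ} {x : Fin N → ℂ} (h : f =ᶠ[𝓝 x] g)
    (i : Fin N) (k : ℕ) : (thetaD i)^[k] f =ᶠ[𝓝 x] (thetaD i)^[k] g := by
  induction k with
  | zero => exact h
  | succ k ih =>
    rw [Function.iterate_succ_apply', Function.iterate_succ_apply']
    exact thetaD_congr ih i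

theorem SmoothAtOne.thetaD_iterate {N : ℕ} {f : (Fin N → ℂ) → ℂ} (h : SmoothAtOne f)
    (i : Fin N) (k : ℕ) : SmoothAtOne ((SchurCLT.thetaD i)^[k] f) := by
  induction k with
  | zero => exact h
  | succ k ih =>
    rw [Function.iterate_succ_apply']
    exact ih.thetaD i

theorem thetaD_iterate_add {N : ℕ} {f g : (Fin N → ℂ) → ℂ} (hf : SmoothAtOne f)
    (hg : SmoothAtOne g) (i : Fin N) (k : ℕ) :
    (thetaD i)^[k] (f + g) =ᶠ[𝓝 1] (thetaD i)^[k] f + (thetaD i)^[k] g := by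
  induction k with
  | zero => exact EventuallyEq.rfl
  | succ k ih =>
    simp only [Function.iterate_succ_apply']
    exact (thetaD_congr ih i).trans (thetaD_add (hf.thetaD_iterate i k) (hg.thetaD_iterate i k) i)

theorem thetaD_iterate_const_smul {N : ℕ} (c : ℂ) (f : (Fin N → ℂ) → ℂ) (i : Fin N) (k : ℕ) :
    (thetaD i)^[k] (c • f) = c • (thetaD i)^[k] f := by
  induction k with
  | zero => rfl
  | succ k ih => simp only [Function.iterate_succ_apply', ih, thetaD_const_smul]

theorem VanishOrder.thetaD_iterate {N : ℕ} {f : (Fin N → ℂ) → ℂ} {m k : ℕ}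
    (h : VanishOrder (m + k) f) (i : Fin N) : VanishOrder m ((SchurCLT.thetaD i)^[k] f) := by
  induction k generalizing m with
  | zero => exact h
  | succ k ih =>
    rw [Function.iterate_succ_apply']
    exact (ih (m := m + 1) (by rwa [add_right_comm, add_assoc])).thetaD i

theorem thetaList_congr {N : ℕ} {f g : (Fin N → ℂ) → ℂ} {x : Fin N → ℂ} (h : f =ᶠ[𝓝 x] g)
    (L : List (Fin N)) : thetaList L f =ᶠ[𝓝 x] thetaList L g := by
  induction L with
  | nil => exact h
  | cons i L ih => exact thetaD_iterate_congr ih i i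

theorem SmoothAtOne.thetaList {N : ℕ} {f : (Fin N → ℂ) → ℂ} (h : SmoothAtOne f)
    (L : List (Fin N)) : SmoothAtOne (thetaList L f) := by
  induction L with
  | nil => exact h
  | cons i L ih => exact ih.thetaD_iterate i i

theorem thetaList_add {N : ℕ} {f g : (Fin N → ℂ) → ℂ} (hf : SmoothAtOne f)
    (hg : SmoothAtOne g) (L : List (Fin N)) :
    thetaList L (f + g) =ᶠ[𝓝 1] thetaList L f + thetaList L g := by
  induction L with
  | nil => exact EventuallyEq.rfl
  | cons i L ih =>
    exact EventuallyEq.trans (thetaD_iterate_congr ih i i)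
      (thetaD_iterate_add (hf.thetaList L) (hg.thetaList L) i i)

theorem thetaList_const_smul {N : ℕ} (c : ℂ) (f : (Fin N → ℂ) → ℂ) (L : List (Fin N)) :
    thetaList L (c • f) = c • thetaList L f := by
  induction L with
  | nil => rfl
  | cons i L ih =>
    change (thetaD i)^[i] (thetaList L (c • f)) = c • (thetaD i)^[i] (thetaList L f)
    rw [ih, thetaD_iterate_const_smul]

theorem VanishOrder.thetaList {N : ℕ} {f : (Fin N → ℂ) → ℂ} {m : ℕ} {L : List (Fin N)}
    (h : VanishOrder (m + (L.map fun i : Fin N => (i : ℕ)).sum) f) :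
    VanishOrder m (SchurCLT.thetaList L f) := by
  induction L generalizing m with
  | nil => exact h
  | cons i L ih =>
    refine VanishOrder.thetaD_iterate (ih (m := m + i) ?_) i
    simpa [add_assoc] using h

theorem degree_stair (N : ℕ) : (stair N).degree = ((List.finRange N).map fun i : Fin N => (i : ℕ)).sum := by
  rw [Finsupp.degree_eq_sum, ← List.ofFn_eq_map, List.sum_ofFn]
  rfl

theorem leadCoeff_congr {N : ℕ} {f g : (Fin N → ℂ) → ℂ} (h : f =ᶠ[𝓝 1] g) :
    leadCoeff f = leadCoeff g := (thetaList_congr h _).self_of_nhds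

theorem leadCoeff_add {N : ℕ} {f g : (Fin N → ℂ) → ℂ} (hf : SmoothAtOne f)
    (hg : SmoothAtOne g) : leadCoeff (f + g) = leadCoeff f + leadCoeff g :=
  (thetaList_add hf hg _).self_of_nhds

theorem leadCoeff_const_smul {N : ℕ} (c : ℂ) (f : (Fin N → ℂ) → ℂ) :
    leadCoeff (c • f) = c * leadCoeff f := by
  rw [leadCoeff, thetaList_const_smul]; rfl

theorem VanishOrder.leadCoeff_eq_zero {N : ℕ} {f : (Fin N → ℂ) → ℂ}
    (h : VanishOrder ((stair N).degree + 1) f) : leadCoeff f = 0 := by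
  rw [degree_stair, add_comm] at h
  exact h.thetaList.2.1

/-- The leading coefficient of a product with a function vanishing to the critical order. -/
theorem VanishOrder.leadCoeff_mul {N : ℕ} {f h : (Fin N → ℂ) → ℂ}
    (hf : VanishOrder (stair N).degree f) (hh : SmoothAtOne h) :
    leadCoeff (f * h) = h 1 * leadCoeff f := by
  have h1 : VanishOrder 1 (h - fun _ => h 1) :=
    ⟨hh.sub contDiffAt_const, by simp, fun i => SmoothAtOne.partialD (hh.sub contDiffAt_const) i⟩
  have e : f * h = h 1 • f + f * (h - fun _ => h 1) := by
    funext x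
    simp only [Pi.mul_apply, Pi.add_apply, Pi.smul_apply, smul_eq_mul, Pi.sub_apply]
    ring
  rw [e, leadCoeff_add (hf.smooth.smul _) (hf.mul h1).smooth, (hf.mul h1).leadCoeff_eq_zero,
    leadCoeff_const_smul, add_zero]

/-- On a Laurent monomial the operators (x_i ∂_i)^i multiply by powers of the exponents, so at 1^N
the alternant becomes a Vandermonde determinant in its exponents. It is nonzero when these are
distinct, as in Weyl's dimension formula. -/
theorem leadCoeff_alternant {N : ℕ} (m : Fin N → ℤ) :
    leadCoeff (alternant m) = (Matrix.vandermonde fun i => (m i : ℂ)).det := by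
  have h1 : ∀ L : List (Fin N), Set.EqOn (thetaList L (alternant m))
      (laurentComb (fun σ : Equiv.Perm (Fin N) => ((Equiv.Perm.sign σ : ℤ) : ℂ) *
        (L.map fun i => (m (σ i) : ℂ) ^ (i : ℕ)).prod) (fun σ i => m (σ i))) (nonzeroSet N) := by
    intro L
    induction L with
    | nil =>
      rw [alternant_eq]
      simp [thetaList, Set.eqOn_refl]
    | cons i L ih =>
      refine ((thetaD_iterate_eqOn (isOpen_nonzeroSet N) ih i i).trans
        (thetaD_iterate_laurentComb _ _ i i)).trans ?_
      simp [mul_assoc, mul_comm, Set.eqOn_refl]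
  rw [leadCoeff, h1 _ (one_mem_nonzeroSet N), laurentComb, Matrix.det_apply']
  refine Finset.sum_congr rfl fun σ _ => ?_
  rw [← List.ofFn_eq_map, List.prod_ofFn]
  simp [laurentMonomial, Matrix.vandermonde_apply]

theorem leadCoeff_alternant_ne_zero {N : ℕ} {m : Fin N → ℤ} (hm : Function.Injective m) :
    leadCoeff (alternant m) ≠ 0 := by
  rw [leadCoeff_alternant, Matrix.det_vandermonde_ne_zero_iff]
  exact Int.cast_injective.comp hm

/-- The Vandermonde determinant is invariant under translation, so it is the same in the coordinates
x and x - 1. -/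
theorem polyFun_vac (N : ℕ) : polyFun (vac N) = alternant fun j : Fin N => ((j : ℕ) : ℤ) := by
  funext x
  have h1 : polyFun (vac N) x = (Matrix.vandermonde fun i : Fin N => x i - 1).det := by
    rw [polyFun, vac, RingHom.map_det]
    congr 1
    ext i j
    simp [Matrix.vandermonde_apply]
  rw [h1, Matrix.det_vandermonde_sub, alternant]
  congr 1

theorem leadCoeff_vac_ne_zero (N : ℕ) : leadCoeff (polyFun (vac N)) ≠ 0 := by
  rw [polyFun_vac]
  exact leadCoeff_alternant_ne_zero fun i j h => Fin.ext (by exact_mod_cast h)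

/-! ### Antisymmetric polynomials -/

/-- An injective exponent vector has at least the degree of `(0, 1, …, N - 1)`, with equality only
for its permutations. -/
theorem exists_perm_of_degree_le {N : ℕ} {s : Fin N →₀ ℕ} (hs : Function.Injective s)
    (hd : s.degree ≤ (stair N).degree) : ∃ σ : Equiv.Perm (Fin N), s = permStair σ := by
  set τ := Tuple.sort s
  have hmono : StrictMono (s ∘ τ) :=
    (Tuple.monotone_sort s).strictMono_of_injective (hs.comp τ.injective)
  -- A strictly increasing sequence of natural numbers dominates its index; equality of the sums
  -- then forces equality termwise.
  have hle : ∀ i : Fin N, (i : ℕ) ≤ s (τ i) := by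
    intro ⟨i, hi⟩
    induction i with
    | zero => simp
    | succ i ih =>
      have h1 := ih (by omega)
      have h2 : (s ∘ τ) ⟨i, by omega⟩ < (s ∘ τ) ⟨i + 1, hi⟩ := hmono (by simp [Fin.lt_def])
      simp only [Function.comp_apply] at h1 h2 ⊢
      omega
  have hsum : ∑ i, s (τ i) = ∑ i : Fin N, (i : ℕ) := by
    refine le_antisymm ?_ (Finset.sum_le_sum fun i _ => hle i)
    rw [Equiv.sum_comp τ fun i => s i, ← Finsupp.degree_eq_sum]
    rw [Finsupp.degree_eq_sum (stair N)] at hd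
    exact hd
  have heq : ∀ i, s (τ i) = i := fun i =>
    ((Finset.sum_eq_sum_iff_of_le fun i _ => hle i).1 hsum.symm i (Finset.mem_univ i)).symm
  refine ⟨τ.symm, ?_⟩
  ext i
  rw [permStair_apply, ← heq, Equiv.apply_symm_apply]

theorem Antisym.rename_perm {N : ℕ} {F : MvPolynomial (Fin N) ℂ} (hF : Antisym F)
    (σ : Equiv.Perm (Fin N)) : MvPolynomial.rename σ F = F ∨ MvPolynomial.rename σ F = -F := by
  induction σ using Equiv.Perm.swap_induction_on with
  | one => left; simp
  | swap_mul σ x y hxy ih =>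
    have e : MvPolynomial.rename (Equiv.swap x y * σ) F =
        MvPolynomial.rename (Equiv.swap x y) (MvPolynomial.rename σ F) := by
      rw [MvPolynomial.rename_rename]; rfl
    rw [e]
    rcases ih with h | h
    · right; rw [h, hF x y hxy]
    · left; rw [h, map_neg, hF x y hxy, neg_neg]

/-- Exponents that occur are injective, hence of degree at least that of the staircase, with
equality only for its permutations. These coefficients equal the staircase coefficient up to sign,
so they vanish with it. -/
theorem Antisym.vanishOrder {N : ℕ} {F : MvPolynomial (Fin N) ℂ} (hF : Antisym F)
    (h0 : vev N F = 0) : VanishOrder ((stair N).degree + 1) (polyFun F) := by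
  refine vanishOrder_polyFun fun s hs => ?_
  by_contra hlt
  have hinj : Function.Injective s := by
    intro i j hij
    by_contra hne
    exact hs (hF.coeff_eq_zero hne hij)
  obtain ⟨σ, rfl⟩ := exists_perm_of_degree_le hinj (by omega)
  refine hs ?_
  have h1 : (stair N).mapDomain σ.symm = permStair σ := by
    ext i
    have := Finsupp.mapDomain_apply σ.symm.injective (stair N) (σ i)
    rw [Equiv.symm_apply_apply] at this
    rw [this]
    rfl
  have h2 := MvPolynomial.coeff_rename_mapDomain σ.symm σ.symm.injective F (stair N)
  rw [h1] at h2
  rw [vev_apply] at h0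
  rcases hF.rename_perm σ.symm with h | h
  · rw [h, h0] at h2; exact h2
  · rw [h, h0, MvPolynomial.coeff_neg, neg_eq_zero] at h2; exact h2

theorem vanishOrder_vac (N : ℕ) : VanishOrder (stair N).degree (polyFun (vac N)) := by
  refine vanishOrder_polyFun fun s hs => ?_
  rw [vac_eq_sum] at hs
  by_contra hlt
  refine hs ?_
  rw [MvPolynomial.coeff_sum]
  refine Finset.sum_eq_zero fun σ _ => ?_
  rw [MvPolynomial.coeff_smul, MvPolynomial.coeff_monomial, if_neg, smul_zero]
  rintro rfl
  refine hlt (le_of_eq ?_)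
  rw [Finsupp.degree_eq_sum, Finsupp.degree_eq_sum]
  exact (Equiv.sum_comp σ fun i : Fin N => (i : ℕ)).symm

theorem Antisym.exists_vanishOrder {N : ℕ} {F : MvPolynomial (Fin N) ℂ} (hF : Antisym F) :
    VanishOrder ((stair N).degree + 1) (polyFun (F + (-vev N F) • vac N)) :=
  (hF.add ((antisym_vac N).smul _)).vanishOrder (by
    rw [map_add, map_smul, vev_vac]; simp)

/-- The leading coefficient of an antisymmetric polynomial times a smooth function. -/
theorem Antisym.leadCoeff_mul {N : ℕ} {F : MvPolynomial (Fin N) ℂ} (hF : Antisym F)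
    {h : (Fin N → ℂ) → ℂ} (hh : SmoothAtOne h) :
    leadCoeff (polyFun F * h) = h 1 * (vev N F * leadCoeff (polyFun (vac N))) := by
  have h1 := hF.exists_vanishOrder
  have e : polyFun F = polyFun (F + (-vev N F) • vac N) + vev N F • polyFun (vac N) := by
    rw [← polyFun_smul, ← polyFun_add]
    congr 1
    rw [neg_smul]
    abel
  have h2 : VanishOrder (stair N).degree (polyFun F) := by
    rw [e]
    exact (h1.mono (Nat.le_succ _)).add ((vanishOrder_vac N).const_smul _)
  rw [h2.leadCoeff_mul hh]
  congr 1
  rw [e, leadCoeff_add h1.smooth ((vanishOrder_vac N).smooth.smul _), h1.leadCoeff_eq_zero,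
    leadCoeff_const_smul, zero_add]

/-! ### From joint moments of power sums to vacuum expectations. -/

/-! ### Conjugation of Euler operators by the exponential of a linear statistic -/

/-- The operator `(1 + T) (D + ∑ j α_j T ^ (j - 1))`, where `α N j` stands for `α_{j + 1}`. -/
def cltOp (m : ℕ) (α : ℕ → ℕ → ℂ) : OneBody :=
  (1 + shiftOp) * (derivOp + ∑ j ∈ Finset.range m,
    scalarOp (fun N => ((j : ℂ) + 1) * α N j) * shiftOp ^ j)

/-- The linear statistic `N ∑ α_j p_j`. -/
def linPart (m : ℕ) (α : ℕ → ℕ → ℂ) (N : ℕ) : MvPolynomial ℕ ℂ :=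
  ∑ j ∈ Finset.range m, MvPolynomial.C (N * α N j) * MvPolynomial.X j

theorem shiftOp_pow_apply (N k : ℕ) (i : Fin N) (p : MvPolynomial (Fin N) ℂ) :
    (shiftOp ^ k) N i p = MvPolynomial.X i ^ k * p := by
  induction k generalizing p with
  | zero => simp
  | succ k ih =>
    rw [pow_succ]
    change (shiftOp ^ k) N i (shiftOp N i p) = _
    rw [ih, pow_succ, mul_assoc]
    rfl

theorem pderiv_psum {N : ℕ} (i : Fin N) (j : ℕ) :
    MvPolynomial.pderiv i (MvPolynomial.psum (Fin N) ℂ (j + 1)) =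
      ((j : ℂ) + 1) • MvPolynomial.X i ^ j := by
  simp only [MvPolynomial.psum, map_sum, Derivation.leibniz_pow, MvPolynomial.pderiv_X]
  rw [Finset.sum_eq_single i]
  · simp [MvPolynomial.smul_eq_C_mul]
  · intro k _ hk
    simp [hk]
  · simp

/-- With u = N ∑ α_j p_j and X = x - 1, the right side is e^(-u) (x_i ∂_i) e^u applied to p. The
factor N compensates N⁻¹ in `derivOp`, so the k-th powers carry the factor N^k by which p_k is
normalized. -/
theorem smul_cltOp_apply {N : ℕ} (hN : N ≠ 0) (m : ℕ) (α : ℕ → ℕ → ℂ) (i : Fin N)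
    (p : MvPolynomial (Fin N) ℂ) : (N : ℂ) • cltOp m α N i p = (1 + MvPolynomial.X i) *
      (MvPolynomial.pderiv i p + MvPolynomial.pderiv i (atPsum N (linPart m α N)) * p) := by
  have hN' : (N : ℂ) ≠ 0 := Nat.cast_ne_zero.2 hN
  have h1 : ∀ q, ((1 : OneBody) + shiftOp) N i q = (1 + MvPolynomial.X i) * q := fun q => by
    change q + MvPolynomial.X i * q = _
    ring
  have h2 : (derivOp + ∑ j ∈ Finset.range m,
      scalarOp (fun N => ((j : ℂ) + 1) * α N j) * shiftOp ^ j) N i p =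
      (N : ℂ)⁻¹ • MvPolynomial.pderiv i p + ∑ j ∈ Finset.range m,
        (((j : ℂ) + 1) * α N j) • (MvPolynomial.X i ^ j * p) := by
    rw [Pi.add_apply, Pi.add_apply, Finset.sum_apply, Finset.sum_apply, LinearMap.add_apply,
      LinearMap.sum_apply]
    congr 1
    refine Finset.sum_congr rfl fun j _ => ?_
    change (scalarOp (fun N => ((j : ℂ) + 1) * α N j) N i) ((shiftOp ^ j) N i p) = _
    rw [shiftOp_pow_apply, scalarOp, Module.algebraMap_end_apply]
  change (N : ℂ) • ((1 : OneBody) + shiftOp) N i ((derivOp + ∑ j ∈ Finset.range m,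
      scalarOp (fun N => ((j : ℂ) + 1) * α N j) * shiftOp ^ j) N i p) = _
  rw [h1, h2, ← mul_smul_comm, smul_add, smul_smul, mul_inv_cancel₀ hN', one_smul]
  congr 2
  simp only [linPart, map_sum, map_mul, atPsum, MvPolynomial.aeval_X, MvPolynomial.algHom_C,
    MvPolynomial.algebraMap_eq, Derivation.leibniz, MvPolynomial.pderiv_C, pderiv_psum, smul_zero,
    add_zero, Finset.sum_mul, Finset.smul_sum]
  refine Finset.sum_congr rfl fun j _ => ?_
  simp only [smul_eq_mul, MvPolynomial.smul_eq_C_mul, map_mul]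
  ring

/-- The exponential of a polynomial function. -/
def expFun {N : ℕ} (u : MvPolynomial (Fin N) ℂ) : (Fin N → ℂ) → ℂ :=
  fun x => Complex.exp (polyFun u x)

theorem smooth_expFun {N : ℕ} (u : MvPolynomial (Fin N) ℂ) : SmoothAtOne (expFun u) :=
  (smooth_polyFun u).cexp

theorem centeredEuler_congr {N : ℕ} {f g : (Fin N → ℂ) → ℂ} (h : f =ᶠ[𝓝 1] g) (k : ℕ) (y : ℂ) :
    centeredEuler k y f =ᶠ[𝓝 1] centeredEuler k y g := by
  have h2 : ∀ᶠ x in 𝓝 1, ∀ i, (thetaD i)^[k] f x = (thetaD i)^[k] g x :=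
    eventually_all.2 fun i => thetaD_iterate_congr h i k
  filter_upwards [h2, h] with x hx hx'
  simp only [centeredEuler, eulerOp, Pi.add_apply, Pi.smul_apply, Finset.sum_apply, hx, hx']

section Conjugation

variable {N : ℕ} (hN : N ≠ 0) (m : ℕ) (α : ℕ → ℕ → ℂ)
include hN

theorem thetaD_expFun_mul (i : Fin N) (p : MvPolynomial (Fin N) ℂ) :
    thetaD i (expFun (atPsum N (linPart m α N)) * polyFun p) =ᶠ[𝓝 1]
      expFun (atPsum N (linPart m α N)) * polyFun ((N : ℂ) • cltOp m α N i p) := by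
  set u := atPsum N (linPart m α N)
  filter_upwards [partialD_mul (smooth_expFun u) (smooth_polyFun p) i,
    partialD_exp (smooth_polyFun u) i] with x h1 h2
  have h3 : partialD i (expFun u) x = expFun u x * partialD i (polyFun u) x := h2
  rw [smul_cltOp_apply hN, thetaD, Pi.mul_apply, h1]
  simp only [Pi.add_apply, Pi.mul_apply, h3, partialD_polyFun, polyFun_mul, polyFun_add, polyFun_X]
  rw [show polyFun (1 : MvPolynomial (Fin N) ℂ) x = 1 by simp [polyFun]]
  ring

theorem thetaD_iterate_expFun_mul (i : Fin N) (k : ℕ) (p : MvPolynomial (Fin N) ℂ) :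
    (thetaD i)^[k] (expFun (atPsum N (linPart m α N)) * polyFun p) =ᶠ[𝓝 1]
      expFun (atPsum N (linPart m α N)) * polyFun ((N : ℂ) ^ k • (cltOp m α ^ k) N i p) := by
  induction k with
  | zero => simp
  | succ k ih =>
    rw [Function.iterate_succ_apply']
    refine (thetaD_congr ih i).trans ((thetaD_expFun_mul hN m α i _).trans (EventuallyEq.of_eq ?_))
    congr 2
    rw [map_smul, smul_smul, ← pow_succ', pow_succ' (cltOp m α)]
    rfl

theorem eulerOp_expFun_mul (k : ℕ) (p : MvPolynomial (Fin N) ℂ) :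
    eulerOp k (expFun (atPsum N (linPart m α N)) * polyFun p) =ᶠ[𝓝 1]
      expFun (atPsum N (linPart m α N)) *
        polyFun ((N : ℂ) ^ k • secondQ (cltOp m α ^ k) N p) := by
  have h : ∀ᶠ x in 𝓝 1, ∀ i, (thetaD i)^[k] (expFun (atPsum N (linPart m α N)) * polyFun p) x =
      (expFun (atPsum N (linPart m α N)) *
        polyFun ((N : ℂ) ^ k • (cltOp m α ^ k) N i p)) x :=
    eventually_all.2 fun i => thetaD_iterate_expFun_mul hN m α i k p
  filter_upwards [h] with x hx
  rw [eulerOp, Finset.sum_apply, Finset.sum_congr rfl fun i _ => hx i]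
  simp only [Pi.mul_apply, secondQ, LinearMap.sum_apply, Finset.smul_sum, ← polyFunHom_apply,
    map_sum, Finset.sum_apply, Finset.mul_sum]

theorem centeredEuler_expFun_mul (k : ℕ) (y : ℂ) (p : MvPolynomial (Fin N) ℂ) :
    centeredEuler k y (expFun (atPsum N (linPart m α N)) * polyFun p) =ᶠ[𝓝 1]
      expFun (atPsum N (linPart m α N)) *
        polyFun ((secondQ (cltOp m α ^ k) N + algebraMap ℂ _ (-y)) p) := by
  have hN' : (N : ℂ) ^ k ≠ 0 := pow_ne_zero _ (Nat.cast_ne_zero.2 hN)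
  filter_upwards [eulerOp_expFun_mul hN m α k p] with x hx
  simp only [centeredEuler, Pi.add_apply, Pi.smul_apply, hx, Pi.mul_apply, polyFun_smul,
    LinearMap.add_apply, polyFun_add, Module.algebraMap_end_apply, smul_eq_mul]
  field_simp

theorem eulerProd_expFun_mul (y : ℕ → ℂ) (ks : List ℕ) (p : MvPolynomial (Fin N) ℂ) :
    eulerProd y ks (expFun (atPsum N (linPart m α N)) * polyFun p) =ᶠ[𝓝 1]
      expFun (atPsum N (linPart m α N)) *
        polyFun ((ks.map fun k => secondQ (cltOp m α ^ k) N + algebraMap ℂ _ (-y k)).prod p) := by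
  induction ks with
  | nil => simp [eulerProd]
  | cons k ks ih =>
    rw [List.map_cons, List.prod_cons]
    exact (centeredEuler_congr ih k (y k)).trans (centeredEuler_expFun_mul hN m α k (y k) _)

end Conjugation

/-- The product has differential order at most the sum of the k's. For this reason a Taylor
polynomial of that degree determines the moments exactly. -/
theorem VanishOrder.eulerProd {N : ℕ} {M : ℕ} (y : ℕ → ℂ) (ks : List ℕ) {f : (Fin N → ℂ) → ℂ}
    (h : VanishOrder (M + ks.sum) f) : VanishOrder M (eulerProd y ks f) := by
  induction ks generalizing M with
  | nil => exact h
  | cons k ks ih =>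
    have h1 : VanishOrder (M + k) (SchurCLT.eulerProd y ks f) :=
      ih (by simpa [add_assoc] using h)
    exact VanishOrder.add (VanishOrder.const_smul _ (VanishOrder.sum _ fun i _ =>
      h1.thetaD_iterate i)) (VanishOrder.const_smul _ (h1.mono (Nat.le_add_right _ _)))

theorem eulerProd_add {N : ℕ} (y : ℕ → ℂ) (ks : List ℕ) {f g : (Fin N → ℂ) → ℂ}
    (hf : SmoothAtOne f) (hg : SmoothAtOne g) :
    eulerProd y ks (f + g) =ᶠ[𝓝 1] eulerProd y ks f + eulerProd y ks g := by
  have hs : ∀ {f : (Fin N → ℂ) → ℂ} (_ : SmoothAtOne f) (ks : List ℕ),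
      SmoothAtOne (eulerProd y ks f) := fun {f} hf ks => by
    induction ks with
    | nil => exact hf
    | cons k ks ih =>
      exact VanishOrder.add (m := 0) (VanishOrder.const_smul _ (VanishOrder.sum _ fun i _ =>
        ih.thetaD_iterate i k)) (VanishOrder.const_smul _ ih)
  induction ks with
  | nil => exact EventuallyEq.rfl
  | cons k ks ih =>
    have h2 : ∀ᶠ x in 𝓝 1, ∀ i, (thetaD i)^[k] (eulerProd y ks (f + g)) x =
        (thetaD i)^[k] (eulerProd y ks f) x + (thetaD i)^[k] (eulerProd y ks g) x :=
      eventually_all.2 fun i => (thetaD_iterate_congr ih i k).trans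
        (thetaD_iterate_add (hs hf ks) (hs hg ks) i k)
    filter_upwards [h2, ih] with x hx hx'
    change centeredEuler k (y k) (eulerProd y ks (f + g)) x =
      centeredEuler k (y k) (eulerProd y ks f) x + centeredEuler k (y k) (eulerProd y ks g) x
    simp only [centeredEuler, eulerOp, Pi.add_apply, Pi.smul_apply, Finset.sum_apply, hx, hx',
      Finset.sum_add_distrib, smul_add]
    ring

theorem eulerProd_congr {N : ℕ} (y : ℕ → ℂ) (ks : List ℕ) {f g : (Fin N → ℂ) → ℂ}
    (h : f =ᶠ[𝓝 1] g) : eulerProd y ks f =ᶠ[𝓝 1] eulerProd y ks g := by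
  induction ks with
  | nil => exact h
  | cons k ks ih => exact centeredEuler_congr ih k (y k)

theorem UnifSum.const_smul {ι : Type*} {N : ℕ} {R : ℝ} {g : ι → (Fin N → ℂ) → ℂ}
    {G : (Fin N → ℂ) → ℂ} (h : UnifSum R g G) (c : ℂ) : UnifSum R (fun a => c • g a) (c • G) :=
  h.mul_left (f := fun _ => c) contDiffOn_const fun _ _ => le_rfl

theorem UnifSum.thetaD_iterate {ι : Type*} {N : ℕ} {R : ℝ} {g : ι → (Fin N → ℂ) → ℂ}
    {G : (Fin N → ℂ) → ℂ} (h : UnifSum R g G) (i : Fin N) (k : ℕ) :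
    UnifSum (R / 2 ^ k) (fun a => (SchurCLT.thetaD i)^[k] (g a)) ((SchurCLT.thetaD i)^[k] G) := by
  induction k with
  | zero => simpa using h
  | succ k ih =>
    simp only [Function.iterate_succ_apply']
    rw [pow_succ, ← div_div]
    exact ih.thetaD i

theorem UnifSum.eulerProd {ι : Type*} {N : ℕ} {R : ℝ} {g : ι → (Fin N → ℂ) → ℂ}
    {G : (Fin N → ℂ) → ℂ} (h : UnifSum R g G) (y : ℕ → ℂ) (ks : List ℕ) :
    UnifSum (R / 2 ^ ks.sum) (fun a => eulerProd y ks (g a)) (eulerProd y ks G) := by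
  induction ks with
  | nil =>
    rw [List.sum_nil, pow_zero, div_one]
    exact h
  | cons k ks ih =>
    have hp := (ih.thetaD_iterate · k)
    have hpos : 0 < R / 2 ^ ks.sum / 2 ^ k := div_pos ih.pos (by positivity)
    rw [List.sum_cons, pow_add, mul_comm, ← div_div]
    refine UnifSum.add (UnifSum.const_smul (UnifSum.sum _ hpos fun i _ => hp i) _)
      (UnifSum.const_smul (ih.mono hpos (div_le_self ih.pos.le (one_le_pow₀ (by norm_num)))) _)

theorem UnifSum.thetaList {ι : Type*} {N : ℕ} {R : ℝ} {g : ι → (Fin N → ℂ) → ℂ}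
    {G : (Fin N → ℂ) → ℂ} (h : UnifSum R g G) (L : List (Fin N)) :
    ∃ r, UnifSum r (fun a => thetaList L (g a)) (thetaList L G) := by
  induction L with
  | nil => exact ⟨R, h⟩
  | cons i L ih =>
    obtain ⟨r, hr⟩ := ih
    exact ⟨_, hr.thetaD_iterate i i⟩

theorem UnifSum.hasSum_leadCoeff {ι : Type*} {N : ℕ} {R : ℝ} {g : ι → (Fin N → ℂ) → ℂ}
    {G : (Fin N → ℂ) → ℂ} (h : UnifSum R g G) :
    HasSum (fun a => leadCoeff (g a)) (leadCoeff G) := by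
  obtain ⟨r, hr⟩ := h.thetaList (List.finRange N)
  exact hr.hasSum (Metric.mem_ball_self hr.pos)

/-! ### Schur generating functions -/

/-- The exponents `l_i + N - i`. -/
def shiftedParts {N : ℕ} (l : Signature N) (j : Fin N) : ℤ := l.1 j + N - 1 - (j : ℕ)

theorem shiftedParts_injective {N : ℕ} (l : Signature N) : Function.Injective (shiftedParts l) := by
  have h : StrictAnti (shiftedParts l) := fun i j hij => by
    have h1 := l.2 hij.le
    have h2 : (i : ℕ) < j := hij
    unfold shiftedParts
    omega
  exact h.injective

theorem vandermonde_eq_vac {N : ℕ} : ∃ s : ℂ, s ≠ 0 ∧ ∀ x : Fin N → ℂ,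
    polyFun (vac N) x = s * ∏ p : Fin N × Fin N with p.1 < p.2, (x p.1 - x p.2) := by
  refine ⟨∏ p : Fin N × Fin N with p.1 < p.2, (-1), by simp, fun x => ?_⟩
  rw [← Finset.prod_mul_distrib, polyFun, vac, RingHom.map_det]
  have h1 : (MvPolynomial.eval (x - 1)).mapMatrix (Matrix.vandermonde fun i : Fin N =>
      (MvPolynomial.X i : MvPolynomial (Fin N) ℂ)) = Matrix.vandermonde fun i => x i - 1 := by
    ext i j
    simp [Matrix.vandermonde_apply]
  rw [h1, Matrix.det_vandermonde_sub, Matrix.det_vandermonde, Finset.prod_filter,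
    Fintype.prod_prod_type]
  refine Finset.prod_congr rfl fun i _ => ?_
  rw [← Finset.prod_filter, Finset.filter_lt_eq_Ioi]
  exact Finset.prod_congr rfl fun j _ => by ring

theorem vac_mul_schur {N : ℕ} : ∃ s : ℂ, s ≠ 0 ∧ ∀ l : Signature N,
    Set.EqOn (polyFun (vac N) * schur l) (s • alternant (shiftedParts l)) (nonzeroSet N) := by
  obtain ⟨s, hs, h⟩ := vandermonde_eq_vac (N := N)
  refine ⟨s, hs, fun l x hx => ?_⟩
  have h1 := schur_mul_vandermonde l x hx
  rw [Pi.mul_apply, h x, Pi.smul_apply, smul_eq_mul, mul_assoc, mul_comm (Finset.prod _ _), h1]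
  rfl

theorem contDiffOn_schur {N : ℕ} (l : Signature N) (n : WithTop ℕ∞) :
    ContDiffOn ℂ n (schur l) (nonzeroSet N) := by
  unfold schur
  refine ContDiffOn.mul ?_ ?_
  · have h1 : ContDiffOn ℂ n (fun x : Fin N → ℂ => ((∏ i, x i) ^ l.shift)⁻¹) (nonzeroSet N) := by
      refine ContDiffOn.inv ?_ fun x hx => pow_ne_zero _ (Finset.prod_ne_zero_iff.2 fun i _ => hx i)
      exact (contDiff_prod fun i _ => contDiff_apply ℂ ℂ i).contDiffOn.pow _
    simpa using h1
  · have h2 : (fun x : Fin N → ℂ => MvPolynomial.eval x (schurPoly l)) =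
        polyFun (schurPoly l) ∘ fun x => x + 1 := by
      funext x
      simp [polyFun]
    rw [h2]
    exact ((contDiff_polyFun _ n).comp (contDiff_id.add contDiff_const)).contDiffOn

theorem leadCoeff_schur {N : ℕ} (l : Signature N) :
    leadCoeff (polyFun (vac N) * schur l) = schur l 1 * leadCoeff (polyFun (vac N)) :=
  (vanishOrder_vac N).leadCoeff_mul ((contDiffOn_schur l _).contDiffAt
    ((isOpen_nonzeroSet N).mem_nhds (one_mem_nonzeroSet N)))

/-- If the value were zero, the leading coefficient of Vandermonde times Schur function would
vanish; up to sign this product is an alternant with distinct exponents, whose leading coefficient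
is nonzero. -/
theorem schur_one_ne_zero {N : ℕ} (l : Signature N) : schur l 1 ≠ 0 := by
  intro h0
  obtain ⟨s, hs, h⟩ := vac_mul_schur (N := N)
  have h1 := leadCoeff_schur l
  rw [leadCoeff_congr ((h l).eventuallyEq_of_mem
    ((isOpen_nonzeroSet N).mem_nhds (one_mem_nonzeroSet N))), h0, zero_mul,
    leadCoeff_const_smul] at h1
  exact mul_ne_zero hs (leadCoeff_alternant_ne_zero (shiftedParts_injective l)) h1

theorem sum_shiftedParts_pow {N : ℕ} (k : ℕ) (l : Signature N) :
    ∑ i, (shiftedParts l i : ℂ) ^ k = (powerSum k l : ℂ) := by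
  simp [shiftedParts, powerSum]

theorem ConvergesNearOne.exists_unifSum {N : ℕ} {ρ : Measure (Signature N)}
    (h : ConvergesNearOne ρ) : ∃ R ≤ 1, UnifSum R (schurTerm ρ) (schurGF ρ) := by
  obtain ⟨U, hU, h1, hsum⟩ := h
  obtain ⟨r, hr, hrU⟩ := Metric.isOpen_iff.1 hU 1 h1
  refine ⟨min r 1, min_le_right _ _, lt_min hr one_pos, fun l => ?_, ?_⟩
  · exact contDiffOn_const.mul (((contDiffOn_schur l _).div_const _).mono
      (ball_subset_nonzeroSet (min_le_right _ _)))
  · have h2 := hasSumUniformlyOn_iff_tendstoUniformlyOn.1 hsum.hasSumUniformlyOn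
    exact h2.mono ((Metric.ball_subset_ball (min_le_left _ _)).trans hrU)

theorem tsum_measureReal_singleton {N : ℕ} (ρ : Measure (Signature N)) [IsProbabilityMeasure ρ] :
    HasSum (fun l => ρ.real {l}) 1 := by
  have h1 : ∑' l, ρ {l} = 1 := by
    rw [← measure_univ (μ := ρ), ← Measure.tsum_indicator_apply_singleton ρ Set.univ MeasurableSet.univ]
    simp
  have h2 : ∑' l, ρ {l} ≠ ⊤ := by rw [h1]; simp
  have h3 := ENNReal.hasSum_toReal h2
  rw [← ENNReal.tsum_toReal_eq fun l => measure_ne_top ρ {l}, h1] at h3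
  exact h3

theorem schurGF_one {N : ℕ} (ρ : Measure (Signature N)) [IsProbabilityMeasure ρ] :
    schurGF ρ 1 = 1 := by
  have h : HasSum (fun l => schurTerm ρ l 1) 1 := by
    have h1 := Complex.ofRealCLM.hasSum (tsum_measureReal_singleton ρ)
    simp only [schurTerm, div_self (schur_one_ne_zero _), mul_one]
    simpa using h1
  exact h.tsum_eq

theorem smooth_schurGF {N : ℕ} {ρ : Measure (Signature N)} (h : ConvergesNearOne ρ) :
    SmoothAtOne (schurGF ρ) := by
  obtain ⟨R, -, hR⟩ := h.exists_unifSum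
  exact hR.smoothAtOne

theorem smooth_logSchurGF {N : ℕ} {ρ : Measure (Signature N)} [IsProbabilityMeasure ρ]
    (h : ConvergesNearOne ρ) : SmoothAtOne (logSchurGF ρ) := by
  have h1 := smooth_schurGF h
  exact (Complex.contDiffAt_log (by rw [schurGF_one]; simp)).comp 1 h1

theorem exp_logSchurGF {N : ℕ} {ρ : Measure (Signature N)} [IsProbabilityMeasure ρ]
    (h : ConvergesNearOne ρ) : (fun x => Complex.exp (logSchurGF ρ x)) =ᶠ[𝓝 1] schurGF ρ := by
  have h1 := (smooth_schurGF h).continuousAt.eventually_ne (y := 0) (by rw [schurGF_one]; simp)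
  filter_upwards [h1] with x hx
  exact Complex.exp_log hx

/-- Expectations of products of power sums as derivatives of the generating function. -/
theorem hasSum_eulerProd {N : ℕ} {ρ : Measure (Signature N)} (h : ConvergesNearOne ρ)
    (y : ℕ → ℂ) (ks : List ℕ) :
    HasSum (fun l => (ρ.real {l} : ℂ) *
      (ks.map fun k => (powerSum k l : ℂ) / (N : ℂ) ^ k - y k).prod * leadCoeff (polyFun (vac N)))
      (leadCoeff (eulerProd y ks (polyFun (vac N) * schurGF ρ))) := by
  obtain ⟨R, hR1, hR⟩ := h.exists_unifSum
  obtain ⟨C, hC⟩ := (isCompact_closedBall (1 : Fin N → ℂ) R).exists_bound_of_continuousOn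
    (contDiff_polyFun (vac N) 0).continuous.continuousOn
  have h1 := ((hR.mul_left (contDiff_polyFun (vac N) _).contDiffOn fun x hx =>
    hC x (Metric.ball_subset_closedBall hx)).eulerProd y ks).hasSum_leadCoeff
  refine h1.congr_fun fun l => ?_
  obtain ⟨s, hs, hv⟩ := vac_mul_schur (N := N)
  have hnhds := (isOpen_nonzeroSet N).mem_nhds (one_mem_nonzeroSet N)
  have h2 : Set.EqOn (polyFun (vac N) * schurTerm ρ l)
      (((ρ.real {l} : ℂ) / schur l 1 * s) • alternant (shiftedParts l)) (nonzeroSet N) := by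
    intro x hx
    have h3 := hv l hx
    simp only [Pi.mul_apply, Pi.smul_apply, smul_eq_mul, schurTerm] at h3 ⊢
    rw [mul_assoc, ← h3]
    ring
  -- This cancels both the sign s and the normalization by the value of the Schur function at 1^N.
  have h4 : s * leadCoeff (alternant (shiftedParts l)) =
      schur l 1 * leadCoeff (polyFun (vac N)) := by
    rw [← leadCoeff_schur, leadCoeff_congr ((hv l).eventuallyEq_of_mem hnhds),
      leadCoeff_const_smul]
  have hring : ∀ a b c e g : ℂ, a * (b / c * e) * g = a * (b / c) * (e * g) := by intros; ring
  rw [leadCoeff_congr ((eulerProd_alternant h2 y ks).eventuallyEq_of_mem hnhds),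
    leadCoeff_const_smul, hring, h4]
  simp only [sum_shiftedParts_pow]
  have := schur_one_ne_zero l
  field_simp

theorem rename_atPsum {N : ℕ} (p : MvPolynomial ℕ ℂ) (σ : Equiv.Perm (Fin N)) :
    MvPolynomial.rename σ (atPsum N p) = atPsum N p := by
  induction p using MvPolynomial.induction_on with
  | C a => simp [atPsum]
  | add p q hp hq => rw [map_add, map_add, hp, hq]
  | mul_X p i hp =>
    rw [map_mul, map_mul, hp]
    congr 1
    simp [atPsum, MvPolynomial.psum_isSymmetric _ _ _ σ]

theorem antisym_atPsum_mul_vac (N : ℕ) (p : MvPolynomial ℕ ℂ) : Antisym (atPsum N p * vac N) :=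
  fun i j hij => by rw [map_mul, rename_atPsum, antisym_vac N i j hij, mul_neg]

theorem Antisym.prod_secondQ {N : ℕ} {X : ℕ → OneBody} {f : ℕ → LaurentPolynomial ℂ}
    (hX : ∀ k, Symb (X k) (f k)) (y : ℕ → ℂ) (ks : List ℕ) {F : MvPolynomial (Fin N) ℂ}
    (hF : Antisym F) :
    Antisym ((ks.map fun k => SchurCLT.secondQ (X k) N + algebraMap ℂ _ (-y k)).prod F) := by
  induction ks with
  | nil => simpa using hF
  | cons k ks ih =>
    rw [List.map_cons, List.prod_cons]
    exact (ih.secondQ (hX k)).add (ih.smul (-y k))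

/-- The main identity: expectations of products of power sums as vacuum expectations. -/
theorem hasSum_powerSum {N : ℕ} (hN : N ≠ 0) {ρ : Measure (Signature N)} [IsProbabilityMeasure ρ]
    (h : ConvergesNearOne ρ) (m : ℕ) (α : ℕ → ℕ → ℂ) {f : LaurentPolynomial ℂ}
    (hA : Symb (cltOp m α) f) (w : MvPolynomial ℕ ℂ)
    (hw : VanishOrder 1 (polyFun (atPsum N w))) (d : ℕ)
    (hS : VanishOrder (d + 1) (logSchurGF ρ - polyFun (atPsum N (linPart m α N)) -
      polyFun (atPsum N w))) (y : ℕ → ℂ) (ks : List ℕ) (hks : ks.sum ≤ d) :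
    HasSum (fun l => (ρ.real {l} : ℂ) *
      (ks.map fun k => (powerSum k l : ℂ) / (N : ℂ) ^ k - y k).prod)
      (vev N ((ks.map fun k => secondQ (cltOp m α ^ k) N + algebraMap ℂ _ (-y k)).prod
        (atPsum N (truncExp d w) * vac N))) := by
  set u := atPsum N (linPart m α N) with hu
  have ht := leadCoeff_vac_ne_zero N
  have hexp : VanishOrder (d + 1) ((fun x => Complex.exp ((logSchurGF ρ - polyFun u -
      polyFun (atPsum N w)) x)) * (fun x => Complex.exp (polyFun (atPsum N w) x)) -
      polyFun (atPsum N (truncExp d w))) := by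
    have e1 := hS.exp_sub_one
    have e2 := hw.exp_sub_truncExp d
    have e3 := (e1.mul (n := 0) (hw.1.cexp)).add e2
    refine e3.congr (EventuallyEq.of_eq ?_)
    rw [map_truncExp, ← polyFunHom_apply (truncExp d _), map_truncExp, polyFunHom_apply]
    funext x
    simp only [Pi.add_apply, Pi.mul_apply, Pi.sub_apply]
    ring
  -- S = e^u · e^(log S - u - w) · e^w, where the middle factor is 1 and e^w is its truncation, both
  -- up to order d + 1.
  have hF : polyFun (vac N) * schurGF ρ =ᶠ[𝓝 1] expFun u * polyFun (atPsum N (truncExp d w) * vac N) +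
      polyFun (vac N) * (expFun u * ((fun x => Complex.exp ((logSchurGF ρ - polyFun u -
      polyFun (atPsum N w)) x)) * (fun x => Complex.exp (polyFun (atPsum N w) x)) -
      polyFun (atPsum N (truncExp d w)))) := by
    filter_upwards [exp_logSchurGF h] with x hx
    simp only [Pi.mul_apply, Pi.add_apply, Pi.sub_apply, polyFun_mul, expFun] at hx ⊢
    rw [← hx, show logSchurGF ρ x = polyFun u x + (logSchurGF ρ x - polyFun u x -
      polyFun (atPsum N w) x) + polyFun (atPsum N w) x by ring, Complex.exp_add, Complex.exp_add]
    ring_nf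
  have herr := (vanishOrder_vac N).mul (VanishOrder.mul (m := 0) (smooth_expFun u) hexp)
  -- The error vanishes to the order of the Vandermonde determinant plus d + 1, and d ≥ `ks.sum`;
  -- after the operators it still exceeds the order that `leadCoeff` detects.
  have herr' := VanishOrder.eulerProd y ks (herr.mono (m := (stair N).degree + 1 + ks.sum) (by omega))
  have hmain : leadCoeff (eulerProd y ks (polyFun (vac N) * schurGF ρ)) =
      vev N ((ks.map fun k => secondQ (cltOp m α ^ k) N + algebraMap ℂ _ (-y k)).prod
        (atPsum N (truncExp d w) * vac N)) * leadCoeff (polyFun (vac N)) := by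
    have hsm : ∀ q, SmoothAtOne (expFun u * polyFun q) := fun q =>
      (smooth_expFun u).mul (smooth_polyFun q)
    have e1 := eulerProd_expFun_mul hN m α y ks (atPsum N (truncExp d w) * vac N)
    rw [← hu] at e1
    rw [leadCoeff_congr ((eulerProd_congr y ks hF).trans (eulerProd_add y ks (hsm _) herr.smooth)),
      leadCoeff_congr (e1.add EventuallyEq.rfl), leadCoeff_add (hsm _) herr'.smooth, herr'.leadCoeff_eq_zero, add_zero,
      mul_comm, Antisym.leadCoeff_mul (Antisym.prod_secondQ (fun k => hA.pow k) y ks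
        (antisym_atPsum_mul_vac N _)) (smooth_expFun u)]
    -- Power sums in x - 1 vanish at 1^N, so the conjugating exponential does not affect the leading
    -- coefficient.
    have hu1 : expFun u 1 = 1 := by
      have : polyFun u 1 = 0 := by
        simp [hu, polyFun, linPart, atPsum, MvPolynomial.psum]
      simp [expFun, this]
    rw [hu1, one_mul]
  have key := hasSum_eulerProd h y ks
  rw [hmain] at key
  have := key.mul_right (leadCoeff (polyFun (vac N)))⁻¹
  simpa [mul_assoc, ht] using this

/-! ### Symmetric Taylor expansions rewritten as polynomials in power sums. -/

/-! ### Monomial symmetric sums and power sums -/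

/-- The sum of `∏ X_{i_a} ^ {k_a}` over distinct indices `i_a` outside a given set. -/
def injSum {N : ℕ} : List ℕ → Finset (Fin N) → MvPolynomial (Fin N) ℂ
  | [], _ => 1
  | k :: ks, E => ∑ i ∈ Eᶜ, MvPolynomial.X i ^ k * injSum ks (insert i E)

/-- The sum over all lists of length `r` with entries in `{1, …, d}`. -/
def sumLists {A : Type*} [AddCommMonoid A] (d : ℕ) : ℕ → (List ℕ → A) → A
  | 0, Φ => Φ []
  | r + 1, Φ => ∑ k ∈ Finset.Icc 1 d, sumLists d r fun ks => Φ (k :: ks)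

theorem sumLists_congr {A : Type*} [AddCommMonoid A] {d r : ℕ} {Φ Ψ : List ℕ → A}
    (h : ∀ ks, ks.length = r → (∀ k ∈ ks, 1 ≤ k) → Φ ks = Ψ ks) :
    sumLists d r Φ = sumLists d r Ψ := by
  induction r generalizing Φ Ψ with
  | zero => exact h [] rfl (by simp)
  | succ r ih =>
    refine Finset.sum_congr rfl fun k hk => ih fun ks hks hks' => h _ (by simp [hks]) ?_
    intro l hl
    rcases List.mem_cons.1 hl with rfl | hl
    · exact (Finset.mem_Icc.1 hk).1
    · exact hks' l hl

theorem map_sumLists {A B F : Type*} [AddCommMonoid A] [AddCommMonoid B] [FunLike F A B]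
    [AddMonoidHomClass F A B] (φ' : F) (d r : ℕ) (Φ : List ℕ → A) :
    φ' (sumLists d r Φ) = sumLists d r fun ks => φ' (Φ ks) := by
  induction r generalizing Φ with
  | zero => rfl
  | succ r ih => simp only [sumLists, map_sum, ih]

theorem sumLists_sum {A ι : Type*} [AddCommMonoid A] (d r : ℕ) (s : Finset ι)
    (Φ : ι → List ℕ → A) :
    sumLists d r (fun ks => ∑ i ∈ s, Φ i ks) = ∑ i ∈ s, sumLists d r (Φ i) := by
  induction r generalizing Φ with
  | zero => rfl
  | succ r ih =>
    simp only [sumLists, ih]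
    exact Finset.sum_comm

theorem sumLists_mul_left {A : Type*} [Semiring A] (d r : ℕ) (c : A) (Φ : List ℕ → A) :
    sumLists d r (fun ks => c * Φ ks) = c * sumLists d r Φ := by
  induction r generalizing Φ with
  | zero => rfl
  | succ r ih => simp only [sumLists, ih, Finset.mul_sum]

/-- The multiset of nonzero values of an exponent vector. -/
def expVals {N : ℕ} (s : Fin N →₀ ℕ) : Multiset ℕ := s.support.val.map s

theorem expVals_sub_single {N : ℕ} {s : Fin N →₀ ℕ} {i : Fin N} {k : ℕ} (hk : s i = k)
    (h1 : 1 ≤ k) : k ::ₘ expVals (s - Finsupp.single i k) = expVals s := by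
  classical
  have hi : i ∈ s.support := Finsupp.mem_support_iff.2 (by omega)
  have hsupp : (s - Finsupp.single i k).support = s.support.erase i := by
    ext j
    rcases eq_or_ne j i with rfl | hj
    · simp [hk]
    · simp [hj]
  unfold expVals
  rw [hsupp, ← Finset.insert_erase hi, Finset.erase_insert_eq_erase, Finset.erase_idem,
    Finset.insert_val_of_notMem (Finset.notMem_erase _ _), Multiset.map_cons, hk]
  congr 1
  refine Multiset.map_congr rfl fun j hj => ?_
  have : j ≠ i := Finset.ne_of_mem_erase hj
  simp [this.symm]

/-- A monomial with r variables is obtained once for each ordering of its support, hence the factor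
r!; `a` sees only the multiset of exponents. -/
theorem coeff_sumLists_injSum {N : ℕ} (d r : ℕ) (a : Multiset ℕ → ℂ) (E : Finset (Fin N))
    (s : Fin N →₀ ℕ) (hs : ∀ i, s i ≤ d) : MvPolynomial.coeff s
      (sumLists d r fun ks => MvPolynomial.C (a ks) * injSum ks E) =
      if s.support.card = r ∧ Disjoint s.support E then (r ! : ℂ) * a (expVals s) else 0 := by
  classical
  induction r generalizing a E s with
  | zero =>
    simp only [sumLists, injSum, mul_one, MvPolynomial.coeff_C, Finset.card_eq_zero,
      Finsupp.support_eq_empty]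
    by_cases h : s = 0
    · subst h
      simp [expVals]
    · rw [if_neg (fun e => h e.symm), if_neg (fun e => h e.1)]
  | succ r ih =>
    have hterm : ∀ k ∈ Finset.Icc 1 d, ∀ i ∈ Eᶜ, MvPolynomial.coeff s (MvPolynomial.X i ^ k *
        sumLists d r fun ks => MvPolynomial.C (a (k ::ₘ (ks : Multiset ℕ))) *
          injSum ks (insert i E)) =
        if s i = k then (if s.support.card = r + 1 ∧ Disjoint s.support E then
          (r ! : ℂ) * a (expVals s) else 0) else 0 := by
      intro k hk i hi
      have hk1 := (Finset.mem_Icc.1 hk).1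
      rw [MvPolynomial.X_pow_eq_monomial, MvPolynomial.coeff_monomial_mul', one_mul,
        ih (fun K => a (k ::ₘ K)) (insert i E) (s - Finsupp.single i k)
          (fun j => (Nat.sub_le _ _).trans (hs j))]
      by_cases hle : Finsupp.single i k ≤ s
      swap
      · rw [if_neg hle, if_neg]
        intro e
        exact hle (Finsupp.single_le_iff.2 e.ge)
      rw [if_pos hle]
      have hki : k ≤ s i := Finsupp.single_le_iff.1 hle
      by_cases hsk : s i = k
      · have hi' : i ∈ s.support := Finsupp.mem_support_iff.2 (by omega)
        have hsupp : (s - Finsupp.single i k).support = s.support.erase i := by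
          ext j
          rcases eq_or_ne j i with rfl | hj
          · simp [hsk]
          · simp [hj]
        rw [if_pos hsk, expVals_sub_single hsk hk1, hsupp, Finset.card_erase_of_mem hi']
        congr 1
        have hpos := Finset.card_pos.2 ⟨i, hi'⟩
        rw [Finset.mem_compl] at hi
        refine propext (and_congr (by omega) ?_)
        rw [Finset.disjoint_insert_right]
        constructor
        · rintro ⟨-, h⟩
          rw [← Finset.insert_erase hi', Finset.disjoint_insert_left]
          exact ⟨hi, h⟩
        · intro h
          exact ⟨Finset.notMem_erase _ _, h.mono_left (Finset.erase_subset _ _)⟩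
      · rw [if_neg hsk, if_neg]
        rintro ⟨-, h⟩
        rw [Finset.disjoint_insert_right] at h
        refine h.1 (Finsupp.mem_support_iff.2 ?_)
        simp only [Finsupp.tsub_apply, Finsupp.single_eq_same]
        omega
    have hexp : (sumLists d (r + 1) fun ks => MvPolynomial.C (a ks) * injSum ks E) =
        ∑ k ∈ Finset.Icc 1 d, ∑ i ∈ Eᶜ, MvPolynomial.X i ^ k * sumLists d r fun ks =>
          MvPolynomial.C (a (k ::ₘ (ks : Multiset ℕ))) * injSum ks (insert i E) := by
      simp only [sumLists, injSum, Finset.mul_sum, sumLists_sum, ← sumLists_mul_left]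
      refine Finset.sum_congr rfl fun k _ => Finset.sum_congr rfl fun i _ => ?_
      refine sumLists_congr fun ks _ _ => ?_
      rw [← Multiset.cons_coe]
      ring
    rw [hexp, MvPolynomial.coeff_sum]
    simp only [MvPolynomial.coeff_sum]
    rw [Finset.sum_congr rfl fun k hk => Finset.sum_congr rfl fun i hi => hterm k hk i hi,
      Finset.sum_comm]
    simp only [Finset.sum_ite_eq]
    split_ifs with hc
    -- Each of the r + 1 elements of the support may be the first index, which turns r! into (r +
    -- 1)!.
    · have h1 : ∀ i ∈ Eᶜ, (if s i ∈ Finset.Icc 1 d then (r ! : ℂ) * a (expVals s) else 0) =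
          if i ∈ s.support then (r ! : ℂ) * a (expVals s) else 0 := fun i _ => by
        congr 1
        rw [Finset.mem_Icc, Finsupp.mem_support_iff]
        have := hs i
        exact propext (by omega)
      rw [Finset.sum_congr rfl h1, ← Finset.sum_filter, Finset.sum_const,
        Finset.filter_mem_eq_inter, Finset.inter_eq_right.2
          (fun i hi => Finset.mem_compl.2 fun hE => Finset.disjoint_left.1 hc.2 hi hE), hc.1,
        Nat.factorial_succ]
      push_cast
      simp only [nsmul_eq_mul]
      push_cast
      ring
    · simp

/-- The sum of the values of `Ψ` at the lists obtained by adding `k` to one entry. -/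
def bumpSum {A : Type*} [AddCommMonoid A] (k : ℕ) : List ℕ → (List ℕ → A) → A
  | [], _ => 0
  | l :: ls, Ψ => Ψ ((k + l) :: ls) + bumpSum k ls fun m => Ψ (l :: m)

theorem bumpSum_sum {A ι : Type*} [AddCommMonoid A] (k : ℕ) (ls : List ℕ) (s : Finset ι)
    (Ψ : ι → List ℕ → A) :
    bumpSum k ls (fun m => ∑ i ∈ s, Ψ i m) = ∑ i ∈ s, bumpSum k ls (Ψ i) := by
  induction ls generalizing Ψ with
  | nil => simp [bumpSum]
  | cons l ls ih => simp only [bumpSum, ih, Finset.sum_add_distrib]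

theorem bumpSum_mul_left {A : Type*} [Semiring A] (k : ℕ) (ls : List ℕ) (c : A) (Ψ : List ℕ → A) :
    bumpSum k ls (fun m => c * Ψ m) = c * bumpSum k ls Ψ := by
  induction ls generalizing Ψ with
  | nil => simp [bumpSum]
  | cons l ls ih => simp only [bumpSum, ih, mul_add]

theorem injSum_cons_cons {N : ℕ} (k l : ℕ) (ls : List ℕ) (E : Finset (Fin N)) :
    injSum (k :: l :: ls) E = injSum (l :: k :: ls) E := by
  simp only [injSum, Finset.mul_sum]
  rw [Finset.sum_sigma', Finset.sum_sigma']
  refine Finset.sum_bij' (fun p _ => ⟨p.2, p.1⟩) (fun p _ => ⟨p.2, p.1⟩) ?_ ?_ ?_ ?_ ?_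
  · intro p hp; simp at hp ⊢; tauto
  · intro p hp; simp at hp ⊢; tauto
  · intro p hp; rfl
  · intro p hp; rfl
  · intro p hp
    rw [Finset.insert_comm]
    ring

/-- The index of the new factor is either different from all indices present or equal to exactly one
of them, in which case the exponents add. This recursion expresses monomial sums through power sums.
-/
theorem sum_pow_mul_injSum {N : ℕ} (k : ℕ) (ls : List ℕ) (E : Finset (Fin N)) :
    (∑ i ∈ Eᶜ, MvPolynomial.X i ^ k) * injSum ls E =
      injSum (k :: ls) E + bumpSum k ls fun m => injSum m E := by
  induction ls generalizing E with
  | nil => simp [injSum, bumpSum]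
  | cons l ls ih =>
    rw [injSum_cons_cons]
    simp only [bumpSum, injSum, bumpSum_sum, bumpSum_mul_left, Finset.mul_sum]
    rw [← Finset.sum_add_distrib, ← Finset.sum_add_distrib]
    refine Finset.sum_congr rfl fun j hj => ?_
    have h1 : ∑ i ∈ Eᶜ, (MvPolynomial.X i : MvPolynomial (Fin N) ℂ) ^ k =
        MvPolynomial.X j ^ k + ∑ i ∈ (insert j E)ᶜ, MvPolynomial.X i ^ k := by
      rw [Finset.compl_insert, Finset.add_sum_erase Eᶜ (fun i => MvPolynomial.X i ^ k) hj]
    have h2 := ih (insert j E)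
    rw [injSum] at h2
    have h3 : injSum (k :: ls) (insert j E) = ∑ i ∈ (insert j E)ᶜ,
      MvPolynomial.X i ^ k * injSum ls (insert i (insert j E)) := rfl
    rw [h1, pow_add, ← Finset.mul_sum]
    linear_combination (MvPolynomial.X j ^ l) * h2

/-- Monomial symmetric sums are polynomials in power sums. -/
theorem exists_injSum_eq_atPsum (ks : List ℕ) (hks : ∀ k ∈ ks, 1 ≤ k) :
    ∃ q : MvPolynomial ℕ ℂ, ∀ N, injSum (N := N) ks ∅ = atPsum N q := by
  induction hn : ks.length generalizing ks with
  | zero =>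
    rw [List.length_eq_zero_iff] at hn
    subst hn
    exact ⟨1, fun N => by simp [injSum]⟩
  | succ n ih =>
    rcases ks with - | ⟨k, ls⟩
    · simp at hn
    have hk : 1 ≤ k := hks k (by simp)
    have hls : ∀ l ∈ ls, 1 ≤ l := fun l hl => hks l (by simp [hl])
    -- The prefix collects the entries already passed by the recursion of `bumpSum`; every bumped
    -- list still has length n, so the outer induction applies.
    have hbump : ∀ (ls pre : List ℕ), (∀ l ∈ ls, 1 ≤ l) → (∀ l ∈ pre, 1 ≤ l) →
        pre.length + ls.length = n → ∃ q : MvPolynomial ℕ ℂ, ∀ N,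
        (bumpSum k ls fun m => injSum (N := N) (pre ++ m) ∅) = atPsum N q := by
      intro ls
      induction ls with
      | nil => exact fun pre _ _ _ => ⟨0, fun N => by simp [bumpSum]⟩
      | cons l ls ih' =>
        intro pre hls hpre hlen
        obtain ⟨q, hq⟩ := ih (pre ++ (k + l) :: ls) (by
          intro x hx
          rcases List.mem_append.1 hx with hx | hx
          · exact hpre x hx
          · rcases List.mem_cons.1 hx with rfl | hx
            · omega
            · exact hls x (by simp [hx])) (by simpa using hlen)
        obtain ⟨q', hq'⟩ := ih' (pre ++ [l]) (fun x hx => hls x (by simp [hx])) (by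
          intro x hx
          rcases List.mem_append.1 hx with hx | hx
          · exact hpre x hx
          · exact hls x (by simp at hx; simp [hx])) (by simp at hlen ⊢; omega)
        refine ⟨q + q', fun N => ?_⟩
        rw [map_add, ← hq, ← hq', bumpSum]
        simp
    obtain ⟨q, hq⟩ := ih ls hls (by simpa using hn)
    obtain ⟨q', hq'⟩ := hbump ls [] hls (by simp) (by simpa using hn)
    refine ⟨MvPolynomial.X (k - 1) * q - q', fun N => ?_⟩
    have h1 := sum_pow_mul_injSum (N := N) k ls ∅
    rw [map_sub, map_mul, ← hq, ← hq']
    simp only [List.nil_append]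
    rw [eq_sub_iff_add_eq, ← h1, atPsum, MvPolynomial.aeval_X, Nat.sub_add_cancel hk]
    simp [MvPolynomial.psum]

theorem injSum_singleton {N : ℕ} (k : ℕ) :
    injSum (N := N) [k] ∅ = MvPolynomial.psum (Fin N) ℂ k := by
  simp [injSum, MvPolynomial.psum]

theorem injSum_pair {N : ℕ} (k l : ℕ) : injSum (N := N) [k, l] ∅ =
    MvPolynomial.psum (Fin N) ℂ k * MvPolynomial.psum (Fin N) ℂ l -
      MvPolynomial.psum (Fin N) ℂ (k + l) := by
  have h := sum_pow_mul_injSum (N := N) k [l] ∅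
  simp only [bumpSum, add_zero, injSum_singleton] at h
  rw [eq_sub_iff_add_eq, ← h]
  simp [MvPolynomial.psum]

theorem constantCoeff_injSum {N : ℕ} (k : ℕ) (ks : List ℕ) (hk : 1 ≤ k) (E : Finset (Fin N)) :
    MvPolynomial.constantCoeff (injSum (k :: ks) E) = 0 := by
  simp [injSum, show k ≠ 0 by omega]

/-! ### Taylor coefficients of symmetric functions -/

/-- The list of indices with `k` copies of `a`, `k'` copies of `a + 1`, and so on. -/
def idxFrom : ℕ → List ℕ → List ℕ
  | _, [] => []
  | a, k :: ks => List.replicate k a ++ idxFrom (a + 1) ks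

theorem count_idxFrom (a b : ℕ) (ks : List ℕ) :
    (idxFrom a ks).count b = if a ≤ b then ks.getD (b - a) 0 else 0 := by
  induction ks generalizing a with
  | nil => simp [idxFrom]
  | cons k ks ih =>
    rw [idxFrom, List.count_append, ih, List.count_replicate]
    rcases lt_trichotomy a b with h | rfl | h
    · rw [if_neg (by simpa using h.ne), if_pos (by omega), if_pos h.le,
        show b - a = (b - (a + 1)) + 1 by omega]
      simp
    · simp
    · rw [if_neg (by simpa using h.ne'), if_neg (by omega), if_neg (by omega)]

/-- The Taylor coefficient of a symmetric function with the given multiset of exponents. -/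
def symCoeff {N : ℕ} (f : (Fin N → ℂ) → ℂ) (K : Multiset ℕ) : ℂ :=
  iterPartialD (idxFrom 0 (K.sort (· ≤ ·))) f 1 / ((K.map Nat.factorial).prod : ℕ)

theorem partialD_comp_perm {N : ℕ} (f : (Fin N → ℂ) → ℂ) (σ : Equiv.Perm (Fin N)) (i : Fin N)
    (x : Fin N → ℂ) : partialD i f (x ∘ σ) = partialD (σ i) (fun y => f (y ∘ σ)) x := by
  unfold partialD lineDeriv
  congr 1
  funext t
  congr 1
  funext j
  simp [Fin.val_inj]

theorem iterPartialD_comp_perm {N : ℕ} {f : (Fin N → ℂ) → ℂ}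
    (hf : ∀ (σ : Equiv.Perm (Fin N)) x, f (x ∘ σ) = f x) (σ : Equiv.Perm (Fin N))
    (I : List (Fin N)) (x : Fin N → ℂ) :
    iterPartialD (I.map fun i : Fin N => (i : ℕ)) f (x ∘ σ) =
      iterPartialD ((I.map σ).map fun i : Fin N => (i : ℕ)) f x := by
  induction I generalizing x with
  | nil => exact hf σ x
  | cons i I ih =>
    simp only [List.map_cons, iterPartialD]
    rw [partialD_comp_perm]
    congr 2
    funext y
    exact ih y

theorem SmoothAtOne.iterPartialD {N : ℕ} {f : (Fin N → ℂ) → ℂ} (h : SmoothAtOne f) (I : List ℕ) :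
    SmoothAtOne (iterPartialD I f) := by
  induction I with
  | nil => exact h
  | cons i I ih => exact ih.partialD i

theorem partialD_comm {N : ℕ} {f : (Fin N → ℂ) → ℂ} (h : SmoothAtOne f) (i j : ℕ) :
    partialD i (partialD j f) =ᶠ[𝓝 1] partialD j (partialD i f) := by
  have h2 : ContDiffAt ℂ 2 f 1 := contDiffAt_infty.1 h 2
  have h3 : ∀ i j : ℕ, ∀ᶠ x in 𝓝 (1 : Fin N → ℂ), partialD i (partialD j f) x =
      fderiv ℂ (fderiv ℂ f) x (unitVec N i) (unitVec N j) := fun i j => by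
    have e1 : partialD j f =ᶠ[𝓝 1] fun x => fderiv ℂ f x (unitVec N j) := by
      filter_upwards [h.eventually] with x hx using partialD_eq_fderiv hx j
    filter_upwards [partialD_congr e1 i, h2.eventually (by simp)] with x hx hx2
    have hd : DifferentiableAt ℂ (fderiv ℂ f) x :=
      (hx2.fderiv_right (m := 1) (by norm_num)).differentiableAt (by simp)
    have hd' : HasFDerivAt (fun x => fderiv ℂ f x (unitVec N j))
        ((ContinuousLinearMap.apply ℂ ℂ (unitVec N j)).comp (fderiv ℂ (fderiv ℂ f) x)) x :=
      (ContinuousLinearMap.apply ℂ ℂ (unitVec N j)).hasFDerivAt.comp x hd.hasFDerivAt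
    rw [hx, partialD_eq_fderiv hd'.differentiableAt, hd'.fderiv]
    rfl
  filter_upwards [h3 i j, h3 j i, h2.eventually (by simp)] with x h1 h1' hx
  rw [h1, h1']
  exact (hx.isSymmSndFDerivAt (by simp)).eq _ _

theorem iterPartialD_perm {N : ℕ} {f : (Fin N → ℂ) → ℂ} (h : SmoothAtOne f) {I J : List ℕ}
    (hIJ : I.Perm J) : iterPartialD I f =ᶠ[𝓝 1] iterPartialD J f := by
  induction hIJ with
  | nil => exact EventuallyEq.rfl
  | cons i _ ih => exact partialD_congr ih i
  | swap i j I => exact partialD_comm (h.iterPartialD I) j i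
  | trans _ _ ih1 ih2 => exact ih1.trans ih2

/-- Equal multisets of values mean fibres of equal size, and the permutation matches the fibres. -/
theorem exists_perm_of_map_eq {N : ℕ} {s t : Fin N → ℕ}
    (h : (Finset.univ : Finset (Fin N)).val.map s = (Finset.univ : Finset (Fin N)).val.map t) :
    ∃ σ : Equiv.Perm (Fin N), ∀ i, t (σ i) = s i := by
  classical
  have hcard : ∀ v, Fintype.card {i // s i = v} = Fintype.card {i // t i = v} := fun v => by
    have h1 := congrArg (Multiset.count v) h
    rw [Multiset.count_map, Multiset.count_map] at h1
    rw [Fintype.card_subtype, Fintype.card_subtype]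
    simpa [Finset.card_def, eq_comm] using h1
  refine ⟨(Equiv.sigmaFiberEquiv s).symm.trans ((Equiv.sigmaCongrRight fun v =>
    Fintype.equivOfCardEq (hcard v)).trans (Equiv.sigmaFiberEquiv t)), fun i => ?_⟩
  exact (Fintype.equivOfCardEq (hcard (s i)) ⟨i, rfl⟩).2

/-- The exponent vector of a list of indices. -/
def expOf {N : ℕ} (I : List (Fin N)) : Fin N →₀ ℕ := Multiset.toFinsupp (I : Multiset (Fin N))

theorem expOf_apply {N : ℕ} (I : List (Fin N)) (i : Fin N) : expOf I i = I.count i := by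
  simp [expOf]

theorem map_univ_eq {N : ℕ} (s : Fin N →₀ ℕ) : (Finset.univ : Finset (Fin N)).val.map s =
    expVals s + Multiset.replicate (N - (expVals s).card) 0 := by
  classical
  have h1 : (Finset.univ : Finset (Fin N)).val = s.support.val + (s.supportᶜ).val := by
    rw [← Finset.disjUnion_val _ _ disjoint_compl_right]
    congr 1
    simp
  rw [h1, Multiset.map_add, expVals]
  congr 1
  rw [Multiset.card_map, Multiset.eq_replicate]
  refine ⟨?_, fun b hb => ?_⟩
  · rw [Multiset.card_map]
    change (s.supportᶜ).card = N - s.support.card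
    rw [Finset.card_compl, Fintype.card_fin]
  · obtain ⟨i, hi, rfl⟩ := Multiset.mem_map.1 hb
    simpa using hi

theorem map_univ_getD {N : ℕ} (ks : List ℕ) (h : ks.length ≤ N) :
    (Finset.univ : Finset (Fin N)).val.map (fun i : Fin N => ks.getD i 0) =
      (ks : Multiset ℕ) + Multiset.replicate (N - ks.length) 0 := by
  have h1 : List.ofFn (fun i : Fin N => ks.getD i 0) = ks ++ List.replicate (N - ks.length) 0 := by
    refine List.ext_getElem (by simp; omega) fun n h1 h2 => ?_
    simp only [List.getElem_ofFn, List.getElem_append, List.getElem_replicate]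
    split_ifs with h3
    · simp [h3]
    · exact List.getD_eq_default _ _ (not_lt.1 h3)
  rw [Fin.univ_val_map, h1, ← Multiset.coe_add, Multiset.coe_replicate]

/-- Symmetry allows the indices to be permuted at the fixed point 1^N, and partial derivatives
commute; so only the multiset of multiplicities of the indices matters. -/
theorem iterPartialD_eq_symCoeff {N : ℕ} {f : (Fin N → ℂ) → ℂ} (hs : SmoothAtOne f)
    (hf : ∀ (σ : Equiv.Perm (Fin N)) x, f (x ∘ σ) = f x) (I : List (Fin N)) :
    iterPartialD (I.map fun i : Fin N => (i : ℕ)) f 1 =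
      (((expVals (expOf I)).map Nat.factorial).prod : ℕ) * symCoeff f (expVals (expOf I)) := by
  classical
  set K := expVals (expOf I)
  set ks := K.sort (· ≤ ·) with hks
  have hlen : ks.length ≤ N := by
    rw [hks, Multiset.length_sort]
    change (Multiset.map _ _).card ≤ N
    rw [Multiset.card_map]
    exact (Finset.card_le_univ _).trans_eq (Fintype.card_fin N)
  have hne : (((K.map Nat.factorial).prod : ℕ) : ℂ) ≠ 0 := by
    rw [Nat.cast_ne_zero]
    refine Multiset.prod_ne_zero fun h => ?_
    obtain ⟨k, -, hk⟩ := Multiset.mem_map.1 h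
    exact Nat.factorial_ne_zero k hk
  rw [symCoeff, mul_div_cancel₀ _ hne]
  obtain ⟨σ, hσ⟩ := exists_perm_of_map_eq (s := expOf I) (t := fun i : Fin N => ks.getD i 0) (by
    rw [map_univ_eq, map_univ_getD ks hlen, hks, Multiset.sort_eq, Multiset.length_sort])
  have hone : (1 : Fin N → ℂ) ∘ σ = 1 := rfl
  have h1 := iterPartialD_comp_perm hf σ I 1
  rw [hone] at h1
  rw [h1]
  refine (iterPartialD_perm hs ?_).self_of_nhds
  rw [List.perm_iff_count]
  intro a
  rw [count_idxFrom, if_pos (Nat.zero_le _), Nat.sub_zero]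
  by_cases ha : a < N
  · have e1 : a = (fun i : Fin N => (i : ℕ)) (σ (σ.symm ⟨a, ha⟩)) := by simp
    conv_lhs => rw [e1]
    rw [List.count_map_of_injective _ _ Fin.val_injective,
      List.count_map_of_injective _ _ σ.injective, ← expOf_apply, ← hσ, Equiv.apply_symm_apply]
  · rw [List.getD_eq_default _ _ (hlen.trans (not_lt.1 ha)), List.count_eq_zero]
    simp only [List.mem_map, not_exists, not_and]
    rintro i - rfl
    exact ha i.2

/-- Coefficients weighted by the factorials of their exponents are merely shifted by
differentiation, which lets the induction run without division. -/
theorem iterPartialD_polyFun {N : ℕ} (p : MvPolynomial (Fin N) ℂ) (I : List (Fin N)) :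
    ∃ q, iterPartialD (I.map fun i : Fin N => (i : ℕ)) (polyFun p) = polyFun q ∧
      ∀ t : Fin N →₀ ℕ, (∏ i, (t i)! : ℕ) * MvPolynomial.coeff t q =
        (∏ i, ((t + expOf I) i)! : ℕ) * MvPolynomial.coeff (t + expOf I) p := by
  classical
  induction I with
  | nil => exact ⟨p, rfl, fun t => by simp [expOf]⟩
  | cons i I ih =>
    obtain ⟨q, hq, h⟩ := ih
    refine ⟨MvPolynomial.pderiv i q, ?_, fun t => ?_⟩
    · rw [List.map_cons, iterPartialD, hq, partialD_polyFun]
    · have h1 := h (t + Finsupp.single i 1)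
      have e1 : t + Finsupp.single i 1 + expOf I = t + expOf (i :: I) := by
        have : expOf (i :: I) = Finsupp.single i 1 + expOf I := by
          ext j
          rw [Finsupp.add_apply, expOf_apply, expOf_apply, List.count_cons, Finsupp.single_apply,
            add_comm]
          simp
        rw [this, add_assoc]
      rw [e1] at h1
      rw [← h1, MvPolynomial.coeff_pderiv]
      have h2 : (∏ j, ((t + Finsupp.single i 1 : Fin N →₀ ℕ) j)! : ℕ) = (t i + 1) * ∏ j, (t j)! := by
        rw [← Finset.mul_prod_erase _ _ (Finset.mem_univ i),
          ← Finset.mul_prod_erase Finset.univ (fun j => (t j)!) (Finset.mem_univ i), ← mul_assoc]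
        congr 1
        · simp [Nat.factorial_succ]
        · refine Finset.prod_congr rfl fun j hj => ?_
          have : j ≠ i := Finset.ne_of_mem_erase hj
          simp [this.symm]
      rw [h2]
      push_cast
      ring

theorem iterPartialD_polyFun_one {N : ℕ} (p : MvPolynomial (Fin N) ℂ) (I : List (Fin N)) :
    iterPartialD (I.map fun i : Fin N => (i : ℕ)) (polyFun p) 1 =
      (((expVals (expOf I)).map Nat.factorial).prod : ℕ) * MvPolynomial.coeff (expOf I) p := by
  obtain ⟨q, hq, h⟩ := iterPartialD_polyFun p I
  have h0 := h 0
  rw [hq]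
  have h1 : polyFun q 1 = MvPolynomial.coeff 0 q := by
    simp [polyFun, ← MvPolynomial.constantCoeff_eq, MvPolynomial.eval_zero]
  have h2 : ((expVals (expOf I)).map Nat.factorial).prod = ∏ i, (expOf I i)! := by
    rw [expVals, Multiset.map_map]
    change ∏ i ∈ (expOf I).support, (expOf I i)! = _
    refine Finset.prod_subset (Finset.subset_univ _) fun i _ hi => ?_
    rw [Finsupp.notMem_support_iff.1 hi]
    rfl
  rw [h1, h2]
  simpa using h0

theorem iterPartialD_sub {N : ℕ} {f g : (Fin N → ℂ) → ℂ} (hf : SmoothAtOne f) (hg : SmoothAtOne g)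
    (I : List ℕ) : iterPartialD I (f - g) =ᶠ[𝓝 1] iterPartialD I f - iterPartialD I g := by
  induction I with
  | nil => exact EventuallyEq.rfl
  | cons i I ih =>
    have e : iterPartialD I f - iterPartialD I g =
        iterPartialD I f + (-1 : ℂ) • iterPartialD I g := by simp [sub_eq_add_neg]
    rw [e] at ih
    refine (partialD_congr ih i).trans
      ((partialD_add (hf.iterPartialD I) ((hg.iterPartialD I).smul _) i).trans ?_)
    rw [partialD_const_smul]
    exact EventuallyEq.of_eq (by simp [iterPartialD, sub_eq_add_neg])

theorem iterPartialD_concat {N : ℕ} (f : (Fin N → ℂ) → ℂ) (I : List ℕ) (i : ℕ) :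
    iterPartialD (I ++ [i]) f = iterPartialD I (partialD i f) := by
  induction I with
  | nil => rfl
  | cons j I ih => simp only [List.cons_append, iterPartialD, ih]

theorem vanishOrder_of_iterPartialD {N : ℕ} {f : (Fin N → ℂ) → ℂ} (hs : SmoothAtOne f) (m : ℕ)
    (h : ∀ I : List (Fin N), I.length < m →
      iterPartialD (I.map fun i : Fin N => (i : ℕ)) f 1 = 0) : VanishOrder m f := by
  induction m generalizing f with
  | zero => exact hs
  | succ m ih =>
    refine ⟨hs, h [] (by simp), fun i => ih (hs.partialD i) fun I hI => ?_⟩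
    have := h (I ++ [i]) (by simpa using hI)
    rwa [List.map_append, List.map_singleton, iterPartialD_concat] at this

/-- Taylor expansion of a symmetric function in terms of monomial symmetric sums. -/
theorem vanishOrder_sub_symTaylor {N : ℕ} {f : (Fin N → ℂ) → ℂ} (hs : SmoothAtOne f)
    (hf : ∀ (σ : Equiv.Perm (Fin N)) x, f (x ∘ σ) = f x) (d : ℕ) :
    VanishOrder (d + 1) (f - polyFun (∑ r ∈ Finset.range (d + 1), ((r ! : ℂ)⁻¹) •
      sumLists d r fun ks => MvPolynomial.C (symCoeff f ks) * injSum ks ∅)) := by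
  refine vanishOrder_of_iterPartialD (VanishOrder.sub (m := 0) hs (smooth_polyFun _)) _
    fun I hI => ?_
  rw [(iterPartialD_sub hs (smooth_polyFun _) _).self_of_nhds, Pi.sub_apply,
    iterPartialD_eq_symCoeff hs hf, iterPartialD_polyFun_one, ← mul_sub]
  refine mul_eq_zero_of_right _ (sub_eq_zero.2 ?_)
  have hle : ∀ i, expOf I i ≤ d := fun i => by
    rw [expOf_apply]
    exact List.count_le_length.trans (by omega)
  have hcard : (expOf I).support.card ≤ d := by
    rw [expOf, Multiset.toFinsupp_support]
    exact (Multiset.toFinset_card_le _).trans (by simpa using by omega)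
  rw [MvPolynomial.coeff_sum, Finset.sum_eq_single (expOf I).support.card]
  · rw [MvPolynomial.coeff_smul, coeff_sumLists_injSum d _ (symCoeff f) ∅ _ hle,
      if_pos ⟨rfl, Finset.disjoint_empty_right _⟩, smul_eq_mul, ← mul_assoc, inv_mul_cancel₀,
      one_mul]
    exact_mod_cast Nat.factorial_ne_zero _
  · intro r _ hr
    rw [MvPolynomial.coeff_smul, coeff_sumLists_injSum d _ (symCoeff f) ∅ _ hle,
      if_neg (fun e => hr e.1.symm), smul_zero]
  · intro h
    exact absurd (Finset.mem_range.2 (by omega)) h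

/-! ### Symmetry of the Schur generating function -/

theorem rename_det_alternant {N : ℕ} (e : Fin N → ℕ) (σ : Equiv.Perm (Fin N)) :
    MvPolynomial.rename σ (Matrix.det (Matrix.of fun i j : Fin N =>
      (MvPolynomial.X i : MvPolynomial (Fin N) ℂ) ^ e j)) =
      (Equiv.Perm.sign σ : ℤ) * Matrix.det (Matrix.of fun i j : Fin N =>
      (MvPolynomial.X i : MvPolynomial (Fin N) ℂ) ^ e j) := by
  rw [← Matrix.det_permute, AlgHom.map_det]
  congr 1
  ext1 i j
  simp

theorem rename_alternantPoly {N : ℕ} (l : Signature N) (σ : Equiv.Perm (Fin N)) :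
    MvPolynomial.rename σ (alternantPoly l) = (Equiv.Perm.sign σ : ℤ) * alternantPoly l :=
  rename_det_alternant _ σ

theorem vandermondePoly_eq_det (N : ℕ) : vandermondePoly N =
    (∏ p : Fin N × Fin N with p.1 < p.2, (-1)) * Matrix.det (Matrix.of fun i j : Fin N =>
      (MvPolynomial.X i : MvPolynomial (Fin N) ℂ) ^ (j : ℕ)) := by
  have h : (Matrix.of fun i j : Fin N => (MvPolynomial.X i : MvPolynomial (Fin N) ℂ) ^ (j : ℕ)) =
      Matrix.vandermonde MvPolynomial.X := rfl
  rw [h, Matrix.det_vandermonde, vandermondePoly]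
  have h2 : ∏ i : Fin N, ∏ j ∈ Finset.Ioi i,
      (MvPolynomial.X j - MvPolynomial.X i : MvPolynomial (Fin N) ℂ) =
      ∏ p : Fin N × Fin N with p.1 < p.2, (MvPolynomial.X p.2 - MvPolynomial.X p.1) := by
    rw [Finset.prod_filter, Fintype.prod_prod_type]
    refine Finset.prod_congr rfl fun i _ => ?_
    rw [← Finset.prod_filter]
    refine Finset.prod_congr ?_ fun _ _ => rfl
    ext j
    simp
  rw [h2, ← Finset.prod_mul_distrib]
  exact Finset.prod_congr rfl fun p _ => by ring

theorem rename_vandermondePoly (N : ℕ) (σ : Equiv.Perm (Fin N)) :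
    MvPolynomial.rename σ (vandermondePoly N) = (Equiv.Perm.sign σ : ℤ) * vandermondePoly N := by
  rw [vandermondePoly_eq_det, map_mul, rename_det_alternant]
  simp only [map_prod, map_neg, map_one]
  ring

theorem vandermondePoly_ne_zero (N : ℕ) : vandermondePoly N ≠ 0 := by
  refine Finset.prod_ne_zero_iff.2 fun p hp => ?_
  exact (X_sub_X_irreducible (Finset.mem_filter.1 hp).2.ne).ne_zero

/-- The alternant and the Vandermonde product acquire the same sign, which cancels in the quotient.
-/
theorem rename_schurPoly {N : ℕ} (l : Signature N) (σ : Equiv.Perm (Fin N)) :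
    MvPolynomial.rename σ (schurPoly l) = schurPoly l := by
  have h : alternantPoly l = vandermondePoly N * schurPoly l :=
    (vandermondePoly_dvd_alternantPoly l).choose_spec
  have h1 := congrArg (MvPolynomial.rename σ) h
  rw [map_mul, rename_alternantPoly, rename_vandermondePoly, h, mul_assoc] at h1
  have hs : ((Equiv.Perm.sign σ : ℤ) : MvPolynomial (Fin N) ℂ) ≠ 0 := by
    rcases Int.units_eq_one_or (Equiv.Perm.sign σ) with e | e <;> simp [e]
  exact (mul_left_cancel₀ (vandermondePoly_ne_zero N) (mul_left_cancel₀ hs h1)).symm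

theorem schur_comp_perm {N : ℕ} (l : Signature N) (σ : Equiv.Perm (Fin N)) (x : Fin N → ℂ) :
    schur l (x ∘ σ) = schur l x := by
  unfold schur
  rw [← MvPolynomial.eval_rename, rename_schurPoly]
  congr 2
  exact Equiv.prod_comp σ x

theorem logSchurGF_comp_perm {N : ℕ} (ρ : Measure (Signature N)) (σ : Equiv.Perm (Fin N))
    (x : Fin N → ℂ) : logSchurGF ρ (x ∘ σ) = logSchurGF ρ x := by
  simp only [logSchurGF, schurGF, schurTerm, schur_comp_perm]

/-! ### The Taylor polynomial in terms of power sums -/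

theorem sum_Icc_one {A : Type*} [AddCommMonoid A] (d : ℕ) (f : ℕ → A) :
    ∑ k ∈ Finset.Icc 1 d, f k = ∑ i ∈ Finset.range d, f (i + 1) := by
  induction d with
  | zero => simp
  | succ d ih => rw [Finset.sum_Icc_succ_top (by omega), ih, Finset.sum_range_succ]

/-- A polynomial expressing a monomial symmetric sum in terms of the power sums. -/
def injSumPoly (ks : List ℕ) : MvPolynomial ℕ ℂ :=
  open Classical in
  if h : ∀ k ∈ ks, 1 ≤ k then (exists_injSum_eq_atPsum ks h).choose else 0

theorem atPsum_injSumPoly (N : ℕ) {ks : List ℕ} (h : ∀ k ∈ ks, 1 ≤ k) :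
    atPsum N (injSumPoly ks) = injSum ks ∅ := by
  rw [injSumPoly, dif_pos h]
  exact ((exists_injSum_eq_atPsum ks h).choose_spec N).symm

/-- The coefficient of the power sum `p_{j + 1}` in a symmetric Taylor polynomial. -/
def linCoeff (d : ℕ) (a : Multiset ℕ → ℂ) (j : ℕ) : ℂ :=
  (if j < d then a {j + 1} else 0) - ∑ i ∈ Finset.range d, ∑ i' ∈ Finset.range d,
    if i + i' + 1 = j then a {i + 1, i' + 1} / 2 else 0

/-- The part of a symmetric Taylor polynomial which is not linear in the power sums. -/
def restPart (d : ℕ) (a : Multiset ℕ → ℂ) : MvPolynomial ℕ ℂ :=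
  quadForm d (fun i j => a {i + 1, j + 1}) + ∑ r ∈ Finset.range (d - 2),
    MvPolynomial.C (((r + 3)! : ℂ)⁻¹) * sumLists d (r + 3) fun ks =>
      MvPolynomial.C (a ks) * injSumPoly ks

theorem sum_range_linCoeff_mul {A : Type*} [CommRing A] [Algebra ℂ A] (d : ℕ)
    (a : Multiset ℕ → ℂ) (p : ℕ → A) :
    ∑ j ∈ Finset.range (2 * d), linCoeff d a j • p (j + 1) =
      ∑ i ∈ Finset.range d, a {i + 1} • p (i + 1) - ∑ i ∈ Finset.range d,
        ∑ i' ∈ Finset.range d, (a {i + 1, i' + 1} / 2) • p (i + 1 + (i' + 1)) := by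
  simp only [linCoeff, sub_smul, Finset.sum_sub_distrib, Finset.sum_smul, ite_smul, zero_smul]
  congr 1
  · rw [← Finset.sum_filter]
    refine Finset.sum_congr ?_ fun _ _ => rfl
    ext j
    simp only [Finset.mem_filter, Finset.mem_range]
    omega
  · rw [Finset.sum_comm]
    refine Finset.sum_congr rfl fun i hi => ?_
    rw [Finset.sum_comm]
    refine Finset.sum_congr rfl fun i' hi' => ?_
    rw [Finset.sum_ite_eq, if_pos]
    · congr 2
      ring
    · simp only [Finset.mem_range] at *
      omega

/-- For r = 2 the sum over distinct indices is p_k p_l - p_{k+l}. The product goes to the quadratic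
form and the correction p_{k+l} to the linear part, which therefore extends to 2d; its coefficient
stays bounded and is negligible against N. Terms with r ≥ 3 form the rest. -/
theorem symTaylor_eq {N : ℕ} {d : ℕ} (hd : 2 ≤ d) {a : Multiset ℕ → ℂ} (ha : a 0 = 0) :
    ∑ r ∈ Finset.range (d + 1), ((r ! : ℂ)⁻¹) •
      sumLists d r (fun ks => MvPolynomial.C (a ks) * injSum (N := N) ks ∅) =
      ∑ j ∈ Finset.range (2 * d), linCoeff d a j • MvPolynomial.psum (Fin N) ℂ (j + 1) +
        atPsum N (restPart d a) := by
  obtain ⟨e, rfl⟩ := Nat.exists_eq_add_of_le hd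
  rw [show 2 + e + 1 = 3 + e by ring, Finset.sum_range_add, sum_range_linCoeff_mul, restPart,
    map_add, map_sum, show 2 + e - 2 = e by omega, ← add_assoc]
  congr 1
  · rw [Finset.sum_range_succ, Finset.sum_range_succ, Finset.sum_range_one]
    simp only [sumLists, injSum_singleton, injSum_pair, sum_Icc_one, quadForm, map_sum, map_mul,
      Multiset.coe_nil, ha, Multiset.coe_singleton]
    simp only [atPsum, MvPolynomial.aeval_X, MvPolynomial.algHom_C, MvPolynomial.algebraMap_eq,
      MvPolynomial.smul_eq_C_mul, Finset.mul_sum, mul_sub, Finset.sum_sub_distrib]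
    have h2 : ∀ i j : ℕ, (([i + 1, j + 1] : List ℕ) : Multiset ℕ) = {i + 1, j + 1} :=
      fun i j => rfl
    have h3 : ∀ z : ℂ, MvPolynomial.C (σ := Fin N) (z / 2) =
        MvPolynomial.C ((2 ! : ℂ)⁻¹) * MvPolynomial.C z := fun z => by
      rw [← map_mul]
      congr 1
      simp [Nat.factorial]
      ring
    simp only [h2, h3, mul_assoc, map_zero, zero_mul, mul_zero, zero_add, Nat.factorial_one,
      Nat.cast_one, inv_one, map_one, one_mul]
    ring
  · refine Finset.sum_congr rfl fun r _ => ?_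
    rw [map_mul, map_sumLists, MvPolynomial.smul_eq_C_mul, add_comm 3 r]
    congr 1
    · simp [atPsum, MvPolynomial.algebraMap_eq]
    · refine sumLists_congr fun ks _ hks => ?_
      rw [map_mul, atPsum_injSumPoly N hks]
      simp [atPsum, MvPolynomial.algebraMap_eq]

theorem vanishOrder_one_polyFun {N : ℕ} {p : MvPolynomial (Fin N) ℂ}
    (h : MvPolynomial.constantCoeff p = 0) : VanishOrder 1 (polyFun p) := by
  refine vanishOrder_polyFun fun s hs => Nat.one_le_iff_ne_zero.2 fun h0 => hs ?_
  rw [(Finsupp.degree_eq_zero_iff s).1 h0]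
  exact h

theorem vanishOrder_atPsum_restPart (N d : ℕ) (a : Multiset ℕ → ℂ) :
    VanishOrder 1 (polyFun (atPsum N (restPart d a))) := by
  refine vanishOrder_one_polyFun ?_
  rw [restPart, map_add, map_add, quadForm]
  simp only [map_sum, map_mul, map_sumLists]
  have h1 : ∀ j : ℕ, MvPolynomial.constantCoeff (atPsum N (MvPolynomial.X j)) = 0 := fun j => by
    simp [atPsum, MvPolynomial.psum]
  simp only [h1, mul_zero, Finset.sum_const_zero, zero_add]
  refine Finset.sum_eq_zero fun r _ => mul_eq_zero_of_right _ ?_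
  -- Zero is written as a sum over the same lists, so that the two sides can be compared termwise.
  rw [show (0 : ℂ) = (AddMonoidHom.mulLeft (0 : ℂ)) (sumLists d (r + 3) fun _ => 0) by simp,
    map_sumLists]
  refine sumLists_congr fun ks hlen hks => ?_
  rw [AddMonoidHom.coe_mulLeft, zero_mul, atPsum_injSumPoly N hks]
  rcases ks with - | ⟨k, ks⟩
  · simp at hlen
  · rw [constantCoeff_injSum k ks (hks k (by simp)), mul_zero]

theorem PolyLim.zero : PolyLim (fun _ => 0) 0 := by
  simpa using PolyLim.C (c := fun _ => 0) (l := 0) tendsto_const_nhds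

theorem PolyLim.const (p : MvPolynomial ℕ ℂ) : PolyLim (fun _ => p) p := by
  induction p using MvPolynomial.induction_on with
  | C a => exact PolyLim.C tendsto_const_nhds
  | add p q hp hq => exact hp.add hq
  | mul_X p i hp => exact hp.mul (PolyLim.X i)

theorem PolyLim.sum {ι : Type*} (s : Finset ι) {p : ι → ℕ → MvPolynomial ℕ ℂ}
    {p' : ι → MvPolynomial ℕ ℂ} (h : ∀ i ∈ s, PolyLim (p i) (p' i)) :
    PolyLim (fun N => ∑ i ∈ s, p i N) (∑ i ∈ s, p' i) := by
  classical
  induction s using Finset.induction_on with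
  | empty => simpa using PolyLim.zero
  | insert i s hi ih =>
    simp only [Finset.sum_insert hi]
    exact (h i (by simp)).add (ih fun j hj => h j (by simp [hj]))

theorem PolyLim.sumLists_zero (d r : ℕ) {p : ℕ → List ℕ → MvPolynomial ℕ ℂ}
    (h : ∀ ks, ks.length = r → (∀ k ∈ ks, 1 ≤ k) → PolyLim (fun N => p N ks) 0) :
    PolyLim (fun N => sumLists d r (p N)) 0 := by
  induction r generalizing p with
  | zero => exact h [] rfl (by simp)
  | succ r ih =>
    have := PolyLim.sum (Finset.Icc 1 d) (p' := fun _ => 0) fun k hk =>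
      ih (p := fun N ks => p N (k :: ks)) fun ks hks hks' => h (k :: ks) (by simp [hks]) (by
        intro l hl
        rcases List.mem_cons.1 hl with rfl | hl
        · exact (Finset.mem_Icc.1 hk).1
        · exact hks' l hl)
    simpa [sumLists] using this

theorem PolyLim.restPart (d : ℕ) {a : ℕ → Multiset ℕ → ℂ} {β : ℕ → ℕ → ℂ}
    (h2 : ∀ i j, Tendsto (fun N => a N {i + 1, j + 1}) atTop (𝓝 (β i j)))
    (h3 : ∀ K : Multiset ℕ, 3 ≤ K.card → (∀ k ∈ K, 1 ≤ k) → Tendsto (fun N => a N K) atTop (𝓝 0)) :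
    PolyLim (fun N => restPart d (a N)) (quadForm d β) := by
  have := PolyLim.add (p := fun N => quadForm d fun i j => a N {i + 1, j + 1})
    (p' := quadForm d β) (q := fun N => ∑ r ∈ Finset.range (d - 2),
      MvPolynomial.C (((r + 3)! : ℂ)⁻¹) * sumLists d (r + 3) fun ks =>
      MvPolynomial.C (a N ks) * injSumPoly ks)
    (q' := ∑ r ∈ Finset.range (d - 2), MvPolynomial.C (((r + 3)! : ℂ)⁻¹) * 0)
    (PolyLim.sum _ fun i _ => PolyLim.sum _ fun j _ =>
      (PolyLim.C ((h2 i j).div_const 2)).mul ((PolyLim.X i).mul (PolyLim.X j)))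
    (PolyLim.sum _ fun r _ => (PolyLim.const _).mul (PolyLim.sumLists_zero d _ fun ks hlen hks => by
      simpa using (PolyLim.C (h3 ks (by simp [hlen]) (by simpa using hks))).mul
        (PolyLim.const (injSumPoly ks))))
  simpa [SchurCLT.restPart] using this

theorem PolyLim.truncExp (d : ℕ) {w : ℕ → MvPolynomial ℕ ℂ} {w' : MvPolynomial ℕ ℂ}
    (h : PolyLim w w') : PolyLim (fun N => truncExp d (w N)) (truncExp d w') := by
  have hpow : ∀ n, PolyLim (fun N => w N ^ n) (w' ^ n) := fun n => by
    induction n with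
    | zero => simpa using PolyLim.const 1
    | succ n ih => simpa [pow_succ] using ih.mul h
  simp only [SchurCLT.truncExp, MvPolynomial.smul_eq_C_mul]
  exact PolyLim.sum _ fun n _ => (PolyLim.const _).mul (hpow n)

/-! ### Asymptotics: from the CLT hypotheses to the limits of all joint moments. -/

/-! ### Limits of the Taylor coefficients -/

section Limits

variable {ρ : (N : ℕ) → Measure (Signature N)} {c : ℕ → ℝ} {d : ℕ → ℕ → ℝ}
  (happ : IsCLTAppropriate ρ c d)

include happ

theorem tendsto_symCoeff_one {k : ℕ} (hk : 1 ≤ k) :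
    Tendsto (fun N : ℕ => symCoeff (logSchurGF (ρ N)) {k} / N) atTop (𝓝 (c k / k !)) := by
  refine ((happ.limit_one 0 k hk).div_const (k ! : ℂ)).congr fun N => ?_
  simp [symCoeff, idxFrom, div_right_comm]

theorem tendsto_symCoeff_three {K : Multiset ℕ} (hK : 3 ≤ K.card) (hK1 : ∀ k ∈ K, 1 ≤ k) :
    Tendsto (fun N : ℕ => symCoeff (logSchurGF (ρ N)) K) atTop (𝓝 0) := by
  have h1 := happ.limit_three (idxFrom 0 (K.sort (· ≤ ·))) (by
    have h2 : ({0, 1, 2} : Finset ℕ) ⊆ (idxFrom 0 (K.sort (· ≤ ·))).toFinset := by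
      intro b hb
      have hb3 : b < 3 := by
        simp only [Finset.mem_insert, Finset.mem_singleton] at hb
        omega
      rw [List.mem_toFinset, ← List.count_pos_iff, count_idxFrom, if_pos (Nat.zero_le _),
        Nat.sub_zero]
      have hlen : b < (K.sort (· ≤ ·)).length := by rw [Multiset.length_sort]; omega
      rw [List.getD_eq_getElem _ _ hlen]
      exact hK1 _ ((Multiset.mem_sort (· ≤ ·)).1 (List.getElem_mem hlen))
    exact le_trans (by simp) (Finset.card_le_card h2))
  simpa [symCoeff] using h1.div_const (((K.map Nat.factorial).prod : ℕ) : ℂ)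

variable [∀ N, IsProbabilityMeasure (ρ N)] (hρ : ∀ N, 1 ≤ N → ConvergesNearOne (ρ N))

include hρ in
-- The limit in the second hypothesis is the same for the index pairs (0, 1) and (1, 0), and the
-- partial derivatives commute.
theorem IsCLTAppropriate.symm {k l : ℕ} (hk : 1 ≤ k) (hl : 1 ≤ l) : d k l = d l k := by
  have h1 := happ.limit_two 0 1 k l (by simp) hk hl
  have h2 := happ.limit_two 1 0 l k (by simp) hl hk
  have h3 : Tendsto (fun N : ℕ => iterPartialD (List.replicate k 0 ++ List.replicate l 1)
      (logSchurGF (ρ N)) 1) atTop (𝓝 (d l k : ℂ)) := by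
    refine h2.congr' ?_
    filter_upwards [eventually_ge_atTop 1] with N hN
    exact (iterPartialD_perm (smooth_logSchurGF (hρ N hN)) List.perm_append_comm).self_of_nhds
  exact_mod_cast tendsto_nhds_unique h1 h3

include hρ in
theorem tendsto_symCoeff_two {k l : ℕ} (hk : 1 ≤ k) (hl : 1 ≤ l) :
    Tendsto (fun N : ℕ => symCoeff (logSchurGF (ρ N)) {k, l}) atTop
      (𝓝 (d k l / ((k ! : ℂ) * l !))) := by
  wlog hkl : k ≤ l generalizing k l
  · rw [Multiset.pair_comm, happ.symm hρ hk hl, mul_comm]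
    exact this hl hk (by omega)
  refine ((happ.limit_two 0 1 k l (by simp) hk hl).div_const ((k ! : ℂ) * l !)).congr fun N => ?_
  have : ({k, l} : Multiset ℕ).sort (· ≤ ·) = [k, l] := by
    rw [Multiset.insert_eq_cons, Multiset.sort_cons _ _ _ (by simpa using hkl),
      Multiset.sort_singleton]
  rw [symCoeff, this]
  simp [idxFrom]

omit happ in
theorem symCoeff_zero (N : ℕ) : symCoeff (logSchurGF (ρ N)) 0 = 0 := by
  simp [symCoeff, idxFrom, iterPartialD, logSchurGF, schurGF_one]

end Limits

/-! ### Expectations as sums -/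

theorem integrable_of_hasSum {N : ℕ} {ρ : Measure (Signature N)} [IsProbabilityMeasure ρ]
    {F : Signature N → ℝ} {z : ℂ} (h : HasSum (fun l => (ρ.real {l} : ℂ) * (F l : ℂ)) z) :
    Integrable F ρ := by
  refine ⟨Measurable.of_discrete.aestronglyMeasurable, ?_⟩
  have h1 : Summable fun l => ρ.real {l} * ‖F l‖ := by
    simpa [abs_of_nonneg measureReal_nonneg] using h.summable.norm
  rw [HasFiniteIntegral, lintegral_countable']
  refine lt_of_eq_of_lt (tsum_congr fun l => ?_) h1.tsum_ofReal_lt_top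
  rw [ENNReal.ofReal_mul measureReal_nonneg, Measure.real, ENNReal.ofReal_toReal (measure_ne_top _ _),
    ofReal_norm, mul_comm]

theorem integral_of_hasSum {N : ℕ} {ρ : Measure (Signature N)} [IsProbabilityMeasure ρ]
    {F : Signature N → ℝ} {z : ℂ} (h : HasSum (fun l => (ρ.real {l} : ℂ) * (F l : ℂ)) z) :
    ((∫ l, F l ∂ρ : ℝ) : ℂ) = z := by
  rw [integral_countable (integrable_of_hasSum h), Complex.ofReal_tsum, ← h.tsum_eq]
  exact tsum_congr fun l => by simp

/-! ### Limits of joint moments -/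

/-- The truncated symbol `(1 + z) (1 / z + ∑_{j < D} c_{j + 1} / j! z ^ j)`. -/
def limSymbol (c : ℕ → ℝ) (D : ℕ) : LaurentPolynomial ℂ :=
  (1 + LaurentPolynomial.T 1) * (LaurentPolynomial.T (-1) + ∑ j ∈ Finset.range D,
    LaurentPolynomial.C (c (j + 1) / j ! : ℂ) * LaurentPolynomial.T j)

/-- The coefficients `d_{i + 1, j + 1} / ((i + 1)! (j + 1)!)`. -/
def limBeta (d : ℕ → ℕ → ℝ) (i j : ℕ) : ℂ := d (i + 1) (j + 1) / (((i + 1)! : ℂ) * (j + 1)!)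

/-- The normalized coefficients of the power sums in the logarithm of the generating function. -/
def linSeq (ρ : (N : ℕ) → Measure (Signature N)) (D N j : ℕ) : ℂ :=
  linCoeff D (symCoeff (logSchurGF (ρ N))) j / N

section Limits

variable {ρ : (N : ℕ) → Measure (Signature N)} [∀ N, IsProbabilityMeasure (ρ N)]
  (hρ : ∀ N, 1 ≤ N → ConvergesNearOne (ρ N)) {c : ℕ → ℝ} {d : ℕ → ℕ → ℝ}
  (happ : IsCLTAppropriate ρ c d)

include hρ happ

/-- Only the one-index derivatives grow like N; the corrections from two distinct indices converge,
hence vanish after division by N. -/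
theorem tendsto_linSeq (D j : ℕ) : Tendsto (fun N => linSeq ρ D N j) atTop
    (𝓝 (if j < D then (c (j + 1) / (j + 1)! : ℂ) else 0)) := by
  have h1 : Tendsto (fun N : ℕ => if j < D then symCoeff (logSchurGF (ρ N)) {j + 1} / N else 0)
      atTop (𝓝 (if j < D then (c (j + 1) / (j + 1)! : ℂ) else 0)) := by
    split_ifs
    · exact tendsto_symCoeff_one happ (by omega)
    · exact tendsto_const_nhds
  have h2 : Tendsto (fun N : ℕ => ∑ i ∈ Finset.range D, ∑ i' ∈ Finset.range D,
      (if i + i' + 1 = j then symCoeff (logSchurGF (ρ N)) {i + 1, i' + 1} / 2 else 0) * (N : ℂ)⁻¹)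
      atTop (𝓝 (∑ i ∈ Finset.range D, ∑ i' ∈ Finset.range D,
        (if i + i' + 1 = j then limBeta d i i' / 2 else 0) * 0)) := by
    refine tendsto_finsetSum _ fun i _ => tendsto_finsetSum _ fun i' _ => Tendsto.mul ?_
      tendsto_inv_atTop_nhds_zero_nat
    split_ifs
    · exact (tendsto_symCoeff_two happ hρ (by omega) (by omega)).div_const 2
    · exact tendsto_const_nhds
  have h3 := h1.sub h2
  simp only [mul_zero, Finset.sum_const_zero, sub_zero] at h3
  refine h3.congr fun N => ?_
  simp only [← Finset.sum_mul]
  rw [linSeq, linCoeff, sub_div, ← div_eq_mul_inv]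
  congr 1
  split_ifs <;> simp

theorem symb_cltOp (D : ℕ) : Symb (cltOp (2 * D) (linSeq ρ D)) (limSymbol c D) := by
  refine Symb.mul (Symb.one.add Symb.shift) (Symb.deriv.add ?_)
  have h1 := Symb.sum (Finset.range (2 * D))
    (X := fun j => scalarOp (fun N => ((j : ℂ) + 1) * linSeq ρ D N j) * shiftOp ^ j) fun j _ =>
    (Symb.scalar ((tendsto_linSeq hρ happ D j).const_mul ((j : ℂ) + 1))).mul (Symb.shift.pow j)
  convert h1 using 1
  have h2 : Finset.range D ⊆ Finset.range (2 * D) := Finset.range_subset_range.2 (by omega)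
  rw [← Finset.sum_subset h2 fun j _ hj => by
    rw [if_neg (by simpa using hj), mul_zero, map_zero, zero_mul]]
  refine Finset.sum_congr rfl fun j hj => ?_
  rw [if_pos (Finset.mem_range.1 hj), LaurentPolynomial.T_pow, mul_one, Nat.factorial_succ]
  congr 2
  have h3 : (j : ℂ) + 1 ≠ 0 := by exact_mod_cast Nat.succ_ne_zero j
  push_cast
  field_simp

theorem hasSum_powerSum_linSeq {D : ℕ} (hD : 2 ≤ D) {N : ℕ} (hN : 1 ≤ N) (y : ℕ → ℂ) (ks : List ℕ)
    (hks : ks.sum ≤ D) : HasSum (fun l => ((ρ N).real {l} : ℂ) *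
      (ks.map fun k => (powerSum k l : ℂ) / (N : ℂ) ^ k - y k).prod)
      (vev N ((ks.map fun k => secondQ (cltOp (2 * D) (linSeq ρ D) ^ k) N +
        algebraMap ℂ _ (-y k)).prod
          (atPsum N (truncExp D (restPart D (symCoeff (logSchurGF (ρ N))))) * vac N))) := by
  have hN0 : N ≠ 0 := by omega
  have hN' : (N : ℂ) ≠ 0 := Nat.cast_ne_zero.2 hN0
  refine hasSum_powerSum hN0 (hρ N hN) _ _ (symb_cltOp hρ happ D) _
    (vanishOrder_atPsum_restPart _ _ _) D ?_ y ks hks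
  have h1 := vanishOrder_sub_symTaylor (smooth_logSchurGF (hρ N hN)) (logSchurGF_comp_perm (ρ N)) D
  rw [symTaylor_eq hD (symCoeff_zero N), polyFun_add, ← sub_sub] at h1
  convert h1 using 4
  simp only [linPart, map_sum, linSeq]
  refine Finset.sum_congr rfl fun j _ => ?_
  rw [mul_div_cancel₀ _ hN']
  simp [atPsum, MvPolynomial.algebraMap_eq, MvPolynomial.smul_eq_C_mul]

theorem hasSum_real_powerSum {D : ℕ} (hD : 2 ≤ D) {N : ℕ} (hN : 1 ≤ N) (y : ℕ → ℝ) (ks : List ℕ)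
    (hks : ks.sum ≤ D) : HasSum (fun l => ((ρ N).real {l} : ℂ) *
      ((ks.map fun k => powerSum k l / (N : ℝ) ^ k - y k).prod : ℝ))
      (vev N ((ks.map fun k => secondQ (cltOp (2 * D) (linSeq ρ D) ^ k) N +
        algebraMap ℂ _ (-(y k : ℂ))).prod
          (atPsum N (truncExp D (restPart D (symCoeff (logSchurGF (ρ N))))) * vac N))) := by
  convert hasSum_powerSum_linSeq hρ happ hD hN (fun k => (y k : ℂ)) ks hks using 3 with l
  rw [← Complex.ofRealHom_eq_coe, map_list_prod, List.map_map]
  congr 2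
  funext k
  simp

theorem integrable_powerSum_sub {N : ℕ} (hN : 1 ≤ N) (y : ℕ → ℝ) (ks : List ℕ) :
    Integrable (fun l => (ks.map fun k => powerSum k l / (N : ℝ) ^ k - y k).prod) (ρ N) :=
  integrable_of_hasSum (hasSum_real_powerSum hρ happ (D := ks.sum + 2) (by omega) hN y ks (by omega))

theorem integrable_prod_powerSum {N : ℕ} (hN : 1 ≤ N) (ks : List ℕ) :
    Integrable (fun l => (ks.map fun k => powerSum k l).prod) (ρ N) := by
  have h := (integrable_powerSum_sub hρ happ hN (fun _ => 0) ks).const_mul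
    (ks.map fun k => (N : ℝ) ^ k).prod
  refine h.congr (Eventually.of_forall fun l => ?_)
  simp only
  rw [← List.prod_map_mul]
  congr 2
  funext k
  have hN' : (N : ℝ) ^ k ≠ 0 := pow_ne_zero _ (by exact_mod_cast (by omega : N ≠ 0))
  rw [sub_zero, mul_div_cancel₀ _ hN']

theorem isTest_restPart (D : ℕ) :
    IsTest (fun N => atPsum N (truncExp D (restPart D (symCoeff (logSchurGF (ρ N))))) * vac N)
      (truncExp D (quadForm D (limBeta d))) := by
  have h : PolyLim (fun N => restPart D (symCoeff (logSchurGF (ρ N)))) (quadForm D (limBeta d)) :=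
    PolyLim.restPart D (fun i j => tendsto_symCoeff_two happ hρ (by omega) (by omega))
      fun K hK hK1 => tendsto_symCoeff_three happ hK hK1
  simpa using isTest_vac.poly_mul (h.truncExp D)

theorem limBeta_symm (i j : ℕ) : limBeta d i j = limBeta d j i := by
  rw [limBeta, limBeta, happ.symm hρ (by omega) (by omega), mul_comm]

theorem tendsto_vev {D : ℕ} (y : ℕ → ℕ → ℂ) (ks : List ℕ) (hks : ks.length ≤ D)
    (hy : ∀ k ∈ ks, Tendsto (fun N => y N k - vacTrace (cltOp (2 * D) (linSeq ρ D) ^ k) N)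
      atTop (𝓝 0)) :
    Tendsto (fun N => vev N ((ks.map fun k => secondQ (cltOp (2 * D) (linSeq ρ D) ^ k) N +
        algebraMap ℂ _ (-y N k)).prod
          (atPsum N (truncExp D (restPart D (symCoeff (logSchurGF (ρ N))))) * vac N))) atTop
      (𝓝 (wickRec (covForm D (limBeta d)) (ks.map fun k => limSymbol c D ^ k))) := by
  have h := (isTest_restPart hρ happ D).tendsto_perturb
    (fun k => (cltOp (2 * D) (linSeq ρ D) ^ k, limSymbol c D ^ k))
    (fun k => (symb_cltOp hρ happ D).pow k) y ks hy [] (by simp)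
  rw [List.nil_append, List.map_map, gwick_truncExp D (limBeta_symm hρ happ) _ _ (by simpa)] at h
  exact h

/-- With a single factor centred by its vacuum trace, the Wick sum is empty and the limit is 0. So
the true mean may replace the trace as the centring, although neither is shown to converge. -/
theorem tendsto_mean_sub_vacTrace {D : ℕ} (hD : 2 ≤ D) {k : ℕ} (hk : k ≤ D) :
    Tendsto (fun N => (((∫ l, powerSum k l ∂(ρ N)) / (N : ℝ) ^ k : ℝ) : ℂ) -
      vacTrace (cltOp (2 * D) (linSeq ρ D) ^ k) N) atTop (𝓝 0) := by
  have h1 := tendsto_vev hρ happ (D := D)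
    (fun N k => vacTrace (cltOp (2 * D) (linSeq ρ D) ^ k) N) [k] (by simpa using by omega)
    fun k _ => by simp
  have h2 := tendsto_vev hρ happ (D := D)
    (fun N k => vacTrace (cltOp (2 * D) (linSeq ρ D) ^ k) N) [] (by simp) fun k _ => by simp
  simp only [List.map_cons, List.map_nil, wickRec_cons, extractSum] at h1
  simp only [List.map_nil, wickRec_nil] at h2
  refine h1.congr' ?_
  filter_upwards [eventually_ge_atTop 1] with N hN
  -- With no operators the identity expresses total probability: the test vector has staircase
  -- coefficient exactly 1.
  have e0 := (hasSum_real_powerSum hρ happ hD hN (fun _ => 0) [] (by simp))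
  have e1 := integral_of_hasSum (hasSum_real_powerSum hρ happ hD hN (fun _ => 0) [k] (by simpa))
  have e0' := integral_of_hasSum e0
  simp only [List.map_cons, List.map_nil, List.prod_cons, List.prod_nil, mul_one, sub_zero,
    integral_div, integral_const, probReal_univ, smul_eq_mul, Complex.ofReal_one,
    Complex.ofReal_zero, neg_zero, map_zero, add_zero] at e1 e0' ⊢
  rw [e1, LinearMap.add_apply, map_add, Module.algebraMap_end_apply, map_smul, smul_eq_mul]
  rw [Module.End.one_apply] at e0'
  rw [← e0', mul_one, sub_eq_add_neg]

theorem tendsto_fluctuation_aux {D : ℕ} (hD : 2 ≤ D) (ks : List ℕ) (hks : ks.sum ≤ D)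
    (hlen : ks.length ≤ D) (hk : ∀ k ∈ ks, k ≤ D) :
    Tendsto (fun N => ((∫ l, (ks.map fun k => fluctuation (ρ N) k l).prod ∂(ρ N) : ℝ) : ℂ)) atTop
      (𝓝 (wickRec (covForm D (limBeta d)) (ks.map fun k => limSymbol c D ^ k))) := by
  refine (tendsto_vev hρ happ (fun N k => (((∫ l, powerSum k l ∂(ρ N)) / (N : ℝ) ^ k : ℝ) : ℂ)) ks
    hlen fun k hk' => tendsto_mean_sub_vacTrace hρ happ hD (hk k hk')).congr' ?_
  filter_upwards [eventually_ge_atTop 1] with N hN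
  rw [← integral_of_hasSum (hasSum_real_powerSum hρ happ hD hN
    (fun k => (∫ l, powerSum k l ∂(ρ N)) / (N : ℝ) ^ k) ks hks)]
  simp only [fluctuation, sub_div]

/-- The limiting covariance. -/
def limCov (c : ℕ → ℝ) (d : ℕ → ℕ → ℝ) (k l : ℕ) : ℝ :=
  (covForm (k + l + 2) (limBeta d) (limSymbol c (k + l + 2) ^ k)
    (limSymbol c (k + l + 2) ^ l)).re

theorem tendsto_fluctuation_two {D k l : ℕ} (hD : k + l + 2 ≤ D) :
    Tendsto (fun N => ((∫ x, fluctuation (ρ N) k x * fluctuation (ρ N) l x ∂(ρ N) : ℝ) : ℂ)) atTop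
      (𝓝 (covForm D (limBeta d) (limSymbol c D ^ k) (limSymbol c D ^ l))) := by
  have := tendsto_fluctuation_aux hρ happ (D := D) (by omega) [k, l] (by simpa using by omega)
    (by simpa using by omega) (by
      intro m hm
      simp only [List.mem_cons, List.not_mem_nil, or_false] at hm
      omega)
  simpa [wickRec_cons, wickRec_nil, extractSum] using this

/-- Both sides are limits of the same real second moments, which do not involve the truncation level
D. This gives independence of D and reality at once. -/
theorem covForm_eq_limCov {D k l : ℕ} (hD : k + l + 2 ≤ D) :
    covForm D (limBeta d) (limSymbol c D ^ k) (limSymbol c D ^ l) = limCov c d k l := by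
  have h1 := tendsto_fluctuation_two hρ happ hD
  have h2 := tendsto_fluctuation_two hρ happ (le_refl (k + l + 2))
  have h3 := (Complex.continuous_re.tendsto _).comp h2
  have h4 := (Complex.continuous_ofReal.tendsto _).comp h3
  exact tendsto_nhds_unique h1 h4

theorem tendsto_limCov (k l : ℕ) :
    Tendsto (fun N => ∫ x, fluctuation (ρ N) k x * fluctuation (ρ N) l x ∂(ρ N)) atTop
      (𝓝 (limCov c d k l)) :=
  (Complex.continuous_re.tendsto _).comp (tendsto_fluctuation_two hρ happ (le_refl (k + l + 2)))

omit [∀ N, IsProbabilityMeasure (ρ N)] hρ happ in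
theorem wickRec_map_eq {E E' R R' : Type*} [Semiring R] [Semiring R'] (S : E → E → R)
    (S' : E' → E' → R') (F : R →+* R') (f : E → E') (L : List E)
    (h : ∀ x ∈ L, ∀ y ∈ L, S' (f x) (f y) = F (S x y)) :
    wickRec S' (L.map f) = F (wickRec S L) := by
  induction hn : L.length using Nat.strong_induction_on generalizing L with
  | _ n ih =>
  rcases L with - | ⟨x, L⟩
  · simp [wickRec_nil]
  have hsub : ∀ a : Fin L.length, ∀ y ∈ L.eraseIdx a, y ∈ x :: L := fun a y hy =>
    List.mem_cons_of_mem _ (List.mem_of_mem_eraseIdx hy)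
  rw [List.map_cons, wickRec_cons, wickRec_cons, extractSum_map, ← sum_eraseIdx_eq,
    ← sum_eraseIdx_eq, map_sum]
  refine Finset.sum_congr rfl fun a _ => ?_
  rw [map_mul, h x (by simp) _ (by simp), ih _ ?_ _ (fun y hy z hz =>
    h y (hsub a y hy) z (hsub a z hz)) rfl]
  have := List.length_eraseIdx_le L a
  simp only [List.length_cons] at hn
  omega

theorem tendsto_fluctuation (ks : List ℕ) :
    Tendsto (fun N => ∫ l, (ks.map fun k => fluctuation (ρ N) k l).prod ∂(ρ N)) atTop
      (𝓝 (wickRec (limCov c d) ks)) := by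
  have hmem : ∀ k ∈ ks, k ≤ ks.sum := fun k hk => List.le_sum_of_mem hk
  -- The level exceeds k + l + 2 for any two entries of the list, equal ones included, so that every
  -- covariance can be replaced by `limCov`.
  have h := tendsto_fluctuation_aux hρ happ (D := 2 * ks.sum + ks.length + 2) (by omega) ks
    (by omega) (by omega) fun k hk => (hmem k hk).trans (by omega)
  rw [wickRec_map_eq (limCov c d) _ Complex.ofRealHom _ ks fun k hk l hl =>
    covForm_eq_limCov hρ happ (by have := hmem k hk; have := hmem l hl; omega)] at h
  exact (Complex.continuous_re.tendsto _).comp h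

theorem limCov_symm (k l : ℕ) : limCov c d k l = limCov c d l k := by
  refine tendsto_nhds_unique (tendsto_limCov hρ happ k l) ((tendsto_limCov hρ happ l k).congr ?_)
  intro N
  simp only [mul_comm]

/-- The quadratic form is a limit of second moments of linear combinations of the fluctuations. -/
theorem limCov_nonneg {ι : Type*} (k : ι → ℕ) (s : Finset ι) (f : ι → ℝ) :
    0 ≤ ∑ i ∈ s, ∑ j ∈ s, f i * f j * limCov c d (k i) (k j) := by
  have h1 : Tendsto (fun N => ∑ i ∈ s, ∑ j ∈ s, f i * f j *
      ∫ x, fluctuation (ρ N) (k i) x * fluctuation (ρ N) (k j) x ∂(ρ N)) atTop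
      (𝓝 (∑ i ∈ s, ∑ j ∈ s, f i * f j * limCov c d (k i) (k j))) :=
    tendsto_finsetSum _ fun i _ => tendsto_finsetSum _ fun j _ =>
      (tendsto_limCov hρ happ _ _).const_mul _
  refine ge_of_tendsto h1 ?_
  filter_upwards [eventually_ge_atTop 1] with N hN
  have hint : ∀ k l : ℕ, Integrable (fun x => fluctuation (ρ N) k x * fluctuation (ρ N) l x) (ρ N) :=
    fun k l => by
      simpa [fluctuation, sub_div] using integrable_powerSum_sub hρ happ hN
        (fun k => (∫ l, powerSum k l ∂(ρ N)) / (N : ℝ) ^ k) [k, l]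
  have h2 : ∑ i ∈ s, ∑ j ∈ s, f i * f j *
      ∫ x, fluctuation (ρ N) (k i) x * fluctuation (ρ N) (k j) x ∂(ρ N) =
      ∫ x, (∑ i ∈ s, f i * fluctuation (ρ N) (k i) x) ^ 2 ∂(ρ N) := by
    simp only [← integral_const_mul]
    rw [Finset.sum_congr rfl fun i _ => (integral_finsetSum s fun j _ =>
      (hint (k i) (k j)).const_mul (f i * f j)).symm, ← integral_finsetSum]
    · congr 1
      funext x
      rw [sq, Finset.sum_mul_sum]
      exact Finset.sum_congr rfl fun i _ => Finset.sum_congr rfl fun j _ => by ring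
    · exact fun i _ => integrable_finsetSum s fun j _ => (hint (k i) (k j)).const_mul (f i * f j)
  rw [h2]
  exact integral_nonneg fun x => sq_nonneg _

theorem tendsto_cov (k l : ℕ) :
    Tendsto (fun N : ℕ => cov[powerSum k, powerSum l; ρ N] / (N : ℝ) ^ (k + l)) atTop
      (𝓝 (limCov c d k l)) := by
  refine (tendsto_limCov hρ happ k l).congr fun N => ?_
  rw [covariance, ← integral_div]
  congr 1
  funext x
  rw [fluctuation, fluctuation, div_mul_div_comm, pow_add]

end Limits

/-! ### Complex analysis: the covariance form as a double contour integral. -/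

/-! ### Termwise integration over circles -/

theorem hasSum_circleIntegral {ι : Type*} [Countable ι] {h : ι → ℂ → ℂ} {H : ℂ → ℂ} {R : ℝ}
    (hR : 0 ≤ R) {M : ι → ℝ} (hM : Summable M)
    (hc : ∀ n, ContinuousOn (h n) (Metric.sphere 0 R))
    (hb : ∀ n, ∀ z ∈ Metric.sphere (0 : ℂ) R, ‖h n z‖ ≤ M n)
    (hs : ∀ z ∈ Metric.sphere (0 : ℂ) R, HasSum (fun n => h n z) (H z)) :
    HasSum (fun n => ∮ z in C(0, R), h n z) (∮ z in C(0, R), H z) := by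
  have hmem : ∀ θ, circleMap 0 R θ ∈ Metric.sphere (0 : ℂ) R := circleMap_mem_sphere 0 hR
  refine intervalIntegral.hasSum_integral_of_dominated_convergence (fun n _ => R * M n)
    (fun n => ?_) (fun n => Eventually.of_forall fun θ _ => ?_)
    (Eventually.of_forall fun θ _ => hM.mul_left R) ?_ (Eventually.of_forall fun θ _ => ?_)
  · have h1 : Continuous fun θ => h n (circleMap 0 R θ) :=
      (hc n).comp_continuous (continuous_circleMap 0 R) hmem
    simp only [deriv_circleMap, smul_eq_mul]
    exact (((continuous_circleMap 0 R).mul continuous_const).mul h1).aestronglyMeasurable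
  · rw [norm_smul]
    refine mul_le_mul (le_of_eq ?_) (hb n _ (hmem θ)) (norm_nonneg _) hR
    simp [abs_of_nonneg hR]
  · exact intervalIntegrable_const
  · exact (hs _ (hmem θ)).const_smul _

/-- A kernel expanded in products of powers of z and w separates the variables: each term is a
product of two single integrals. Absolute convergence on the two circles permits both interchanges.
-/
theorem hasSum_double_circleIntegral {ι : Type*} [Countable ι] {U V : ℂ → ℂ} {K : ℂ → ℂ → ℂ}
    {q : ι → ℂ} {p m : ι → ℤ} {R S : ℝ} (hR : 0 < R) (hS : 0 < S)
    (hU : ContinuousOn U (Metric.sphere 0 R)) (hV : ContinuousOn V (Metric.sphere 0 S))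
    (hsum : Summable fun n => ‖q n‖ * R ^ p n * S ^ m n)
    (hK : ∀ z ∈ Metric.sphere (0 : ℂ) R, ∀ w ∈ Metric.sphere (0 : ℂ) S,
      HasSum (fun n => q n * z ^ p n * w ^ m n) (K z w)) :
    HasSum (fun n => q n * (∮ z in C(0, R), U z * z ^ p n) * ∮ w in C(0, S), V w * w ^ m n)
      (∮ z in C(0, R), ∮ w in C(0, S), U z * V w * K z w) := by
  obtain ⟨A, hA⟩ := (isCompact_sphere (0 : ℂ) R).exists_bound_of_continuousOn hU
  obtain ⟨B, hB⟩ := (isCompact_sphere (0 : ℂ) S).exists_bound_of_continuousOn hV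
  have hA0 : 0 ≤ A := (norm_nonneg _).trans (hA (R : ℂ) (by simp [abs_of_pos hR]))
  have hB0 : 0 ≤ B := (norm_nonneg _).trans (hB (S : ℂ) (by simp [abs_of_pos hS]))
  have hpow : ∀ {R : ℝ} (_ : 0 < R) (k : ℤ),
      ContinuousOn (fun z : ℂ => z ^ k) (Metric.sphere 0 R) := fun {R} hR k =>
    continuousOn_id.zpow₀ k fun z hz => Or.inl (ne_zero_of_mem_sphere hR.ne' ⟨z, hz⟩)
  have hnorm : ∀ {R : ℝ} {z : ℂ} (_ : z ∈ Metric.sphere (0 : ℂ) R) (k : ℤ), ‖z ^ k‖ = R ^ k :=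
    fun {R z} hz k => by rw [norm_zpow, mem_sphere_zero_iff_norm.1 hz]
  have hVm : ∀ n, ‖∮ w in C(0, S), V w * w ^ m n‖ ≤ 2 * Real.pi * S * (B * S ^ m n) := fun n => by
    refine circleIntegral.norm_integral_le_of_norm_le_const hS.le fun w hw => ?_
    rw [norm_mul, hnorm hw]
    exact mul_le_mul_of_nonneg_right (hB w hw) (zpow_nonneg hS.le _)
  have inner : ∀ z ∈ Metric.sphere (0 : ℂ) R, HasSum
      (fun n => q n * (∮ w in C(0, S), V w * w ^ m n) * (U z * z ^ p n))
      (∮ w in C(0, S), U z * V w * K z w) := fun z hz => by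
    have h1 := hasSum_circleIntegral (h := fun n w => U z * V w * (q n * z ^ p n * w ^ m n))
      (H := fun w => U z * V w * K z w) hS.le (hsum.mul_left (A * B)) (fun n =>
        (continuousOn_const.mul hV).mul (continuousOn_const.mul (hpow hS _))) (fun n w hw => by
        rw [norm_mul, norm_mul, norm_mul, norm_mul, hnorm hz, hnorm hw]
        exact mul_le_mul_of_nonneg_right (mul_le_mul (hA z hz) (hB w hw) (norm_nonneg _) hA0)
          (by positivity)) fun w hw => (hK z hz w hw).mul_left _
    refine h1.congr_fun fun n => ?_
    have h2 : ∀ w, U z * V w * (q n * z ^ p n * w ^ m n) =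
        (q n * U z * z ^ p n) * (V w * w ^ m n) := fun w => by ring
    simp only [h2, circleIntegral.integral_const_mul]
    ring
  have h1 := hasSum_circleIntegral
    (h := fun n z => q n * (∮ w in C(0, S), V w * w ^ m n) * (U z * z ^ p n))
    (H := fun z => ∮ w in C(0, S), U z * V w * K z w) hR.le
    (hsum.mul_left (2 * Real.pi * S * B * A)) (fun n =>
      continuousOn_const.mul (hU.mul (hpow hR _))) (fun n z hz => by
      rw [norm_mul, norm_mul, norm_mul, hnorm hz]
      calc ‖q n‖ * ‖∮ w in C(0, S), V w * w ^ m n‖ * (‖U z‖ * R ^ p n)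
          ≤ ‖q n‖ * (2 * Real.pi * S * (B * S ^ m n)) * (A * R ^ p n) := by
            have := hVm n
            have := hA z hz
            gcongr
        _ = _ := by ring) inner
  refine h1.congr_fun fun n => ?_
  rw [circleIntegral.integral_const_mul]
  ring

/-! ### Laurent coefficients as contour integrals -/

/-- The value of a Laurent polynomial at a nonzero complex number. -/
def evalAt (f : LaurentPolynomial ℂ) (z : ℂ) : ℂ :=
  open Classical in
  if hz : z ≠ 0 then LaurentPolynomial.eval₂ (RingHom.id ℂ) (Units.mk0 z hz) f else 0

theorem evalAt_eq (f : LaurentPolynomial ℂ) {z : ℂ} (hz : z ≠ 0) :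
    evalAt f z = LaurentPolynomial.eval₂ (RingHom.id ℂ) (Units.mk0 z hz) f := dif_pos hz

theorem evalAt_C_mul_T (a : ℂ) (n : ℤ) {z : ℂ} (hz : z ≠ 0) :
    evalAt (LaurentPolynomial.C a * LaurentPolynomial.T n) z = a * z ^ n := by
  rw [evalAt_eq _ hz, LaurentPolynomial.eval₂_C_mul_T]
  simp

theorem integral_zpow {R : ℝ} (hR : 0 < R) (n : ℤ) :
    ∮ z in C(0, R), z ^ n = 2 * Real.pi * Complex.I * if n = -1 then 1 else 0 := by
  split_ifs with h
  · subst h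
    simpa using circleIntegral.integral_sub_center_inv 0 hR.ne'
  · simpa using circleIntegral.integral_sub_zpow_of_ne h 0 0 R

theorem continuousOn_evalAt (f : LaurentPolynomial ℂ) {R : ℝ} (hR : 0 < R) :
    ContinuousOn (evalAt f) (Metric.sphere 0 R) := by
  have hne : ∀ z ∈ Metric.sphere (0 : ℂ) R, z ≠ 0 := fun z hz =>
    ne_zero_of_mem_sphere hR.ne' ⟨z, hz⟩
  induction f using LaurentPolynomial.induction_on' with
  | add f g hf hg =>
    refine (hf.add hg).congr fun z hz => ?_
    change evalAt (f + g) z = evalAt f z + evalAt g z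
    simp only [evalAt_eq _ (hne z hz), map_add]
  | C_mul_T n a =>
    refine ContinuousOn.congr (f := fun z : ℂ => a * z ^ n) ?_ fun z hz =>
      evalAt_C_mul_T a n (hne z hz)
    exact continuousOn_const.mul (continuousOn_id.zpow₀ n fun z hz => Or.inl (hne z hz))

theorem integral_evalAt_mul_zpow (f : LaurentPolynomial ℂ) {R : ℝ} (hR : 0 < R) (m : ℤ) :
    ∮ z in C(0, R), evalAt f z * z ^ m = 2 * Real.pi * Complex.I * f.coeff (-m - 1) := by
  have hne : ∀ z ∈ Metric.sphere (0 : ℂ) R, z ≠ 0 := fun z hz =>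
    ne_zero_of_mem_sphere hR.ne' ⟨z, hz⟩
  have hint : ∀ f, CircleIntegrable (fun z => evalAt f z * z ^ m) 0 R := fun f =>
    ((continuousOn_evalAt f hR).mul (continuousOn_id.zpow₀ m fun z hz =>
      Or.inl (hne z hz))).circleIntegrable hR.le
  induction f using LaurentPolynomial.induction_on' with
  | add f g hf hg =>
    rw [AddMonoidAlgebra.coeff_add, Finsupp.add_apply, mul_add, ← hf, ← hg,
      ← circleIntegral.integral_add (hint f) (hint g)]
    refine circleIntegral.integral_congr hR.le fun z hz => ?_
    simp only [evalAt_eq _ (hne z hz), map_add, add_mul]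
  | C_mul_T n a =>
    rw [circleIntegral.integral_congr hR.le (g := fun z => a * z ^ (n + m)) fun z hz => by
      simp only [evalAt_C_mul_T a n (hne z hz), zpow_add₀ (hne z hz), mul_assoc],
      circleIntegral.integral_const_mul, integral_zpow hR, coeff_C_mul_T]
    have : n + m = -1 ↔ n = -m - 1 := by omega
    simp only [this]
    split_ifs <;> ring

/-! ### Power series -/

section PowerSeries

variable {e : ℕ → ℂ} {r : ℝ} (hr : 0 < r) (he : Summable fun j => ‖e j‖ * r ^ j)

include he in
theorem summable_powerSeries {z : ℂ} (hz : ‖z‖ ≤ r) : Summable fun j => e j * z ^ j := by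
  refine Summable.of_norm_bounded he fun j => ?_
  rw [norm_mul, norm_pow]
  gcongr

include he in
theorem differentiableOn_powerSeries :
    DifferentiableOn ℂ (fun z => ∑' j, e j * z ^ j) (Metric.ball 0 r) := by
  refine Complex.differentiableOn_tsum_of_summable_norm he
    (fun j => ((differentiable_id.pow j).const_mul (e j)).differentiableOn) Metric.isOpen_ball
    fun j z hz => ?_
  rw [norm_mul, norm_pow]
  have : ‖z‖ ≤ r := (mem_ball_zero_iff.1 hz).le
  gcongr

include hr he in
theorem summable_shift (D : ℕ) : Summable fun j => ‖e (j + D)‖ * r ^ j := by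
  have h1 := ((summable_nat_add_iff D).2 he).mul_right (r ^ D)⁻¹
  refine h1.congr fun j => ?_
  rw [pow_add]
  field_simp

include he in
theorem powerSeries_eq (D : ℕ) {z : ℂ} (hz : ‖z‖ ≤ r) : ∑' j, e j * z ^ j =
    ∑ j ∈ Finset.range D, e j * z ^ j + z ^ D * ∑' j, e (j + D) * z ^ j := by
  rw [← (summable_powerSeries he hz).sum_add_tsum_nat_add D, ← tsum_mul_left]
  congr 1
  exact tsum_congr fun j => by ring

end PowerSeries

/-! ### The covariance as a contour integral -/

theorem mul_evalAt_limSymbol (c : ℕ → ℝ) (D : ℕ) {z : ℂ} (hz : z ≠ 0) :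
    z * evalAt (limSymbol c D) z =
      (1 + z) * (1 + z * ∑ j ∈ Finset.range D, (c (j + 1) / j ! : ℂ) * z ^ j) := by
  rw [evalAt_eq _ hz, limSymbol]
  simp only [map_mul, map_add, map_one, map_sum, LaurentPolynomial.eval₂_C,
    LaurentPolynomial.eval₂_T, RingHom.id_apply, zpow_one, zpow_neg, zpow_natCast, Units.val_mk0,
    Units.val_pow_eq_pow_val, Units.val_inv_eq_inv_val]
  field_simp

theorem evalAt_pow (f : LaurentPolynomial ℂ) (k : ℕ) {z : ℂ} (hz : z ≠ 0) :
    evalAt (f ^ k) z = evalAt f z ^ k := by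
  rw [evalAt_eq _ hz, evalAt_eq _ hz, map_pow]

theorem integral_eq_zero_of_differentiableOn {f g : ℂ → ℂ} {r R : ℝ} (hR : 0 < R) (hRr : R < r)
    (hf : DifferentiableOn ℂ f (Metric.ball 0 r)) (hg : Set.EqOn g f (Metric.sphere 0 R)) :
    ∮ z in C(0, R), g z = 0 := by
  rw [circleIntegral.integral_congr hR.le hg]
  refine DiffContOnCl.circleIntegral_eq_zero hR.le (DifferentiableOn.diffContOnCl ?_)
  rw [closure_ball _ hR.ne']
  exact hf.mono (Metric.closedBall_subset_ball hRr)

/-- z times the symbol is a polynomial, so the k-th power has a pole of order at most k at 0; below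
that order Cauchy's theorem gives zero. -/
theorem coeff_limSymbol_pow_eq_zero (c : ℕ → ℝ) (D : ℕ) {k : ℕ} {n : ℤ} (hn : n < -k) :
    (limSymbol c D ^ k).coeff n = 0 := by
  have h1 := integral_evalAt_mul_zpow (limSymbol c D ^ k) one_pos (-n - 1)
  have h2 : ∮ z in C(0, 1), evalAt (limSymbol c D ^ k) z * z ^ (-n - 1) = 0 := by
    refine integral_eq_zero_of_differentiableOn (r := 2) one_pos (by norm_num)
      (f := fun z => ((1 + z) * (1 + z * ∑ j ∈ Finset.range D, (c (j + 1) / j ! : ℂ) * z ^ j)) ^ k *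
        z ^ (-n - 1 - k).toNat) (by fun_prop) fun z hz => ?_
    have hz0 : z ≠ 0 := ne_zero_of_mem_sphere one_ne_zero ⟨z, hz⟩
    simp only
    rw [← mul_evalAt_limSymbol c D hz0, evalAt_pow _ _ hz0, mul_pow, ← zpow_natCast z,
      ← zpow_natCast z, Int.toNat_of_nonneg (by omega), mul_right_comm, ← zpow_add₀ hz0, mul_comm]
    congr 2
    ring
  rw [h2, show -(-n - 1) - 1 = n by ring] at h1
  exact (mul_eq_zero.1 h1.symm).resolve_left Complex.two_pi_I_ne_zero

/-- Laurent coefficients of the powers of the full symbol. -/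
theorem integral_symbol {c : ℕ → ℝ} {r : ℝ}
    (he : Summable fun j : ℕ => ‖(c (j + 1) / j ! : ℂ)‖ * r ^ j) {R : ℝ} (hR : 0 < R) (hRr : R < r)
    {D k : ℕ} {m : ℤ} (hm : k ≤ m + D + 1) :
    ∮ z in C(0, R), (1 / z + 1 + (1 + z) * ∑' j, (c (j + 1) / j ! : ℂ) * z ^ j) ^ k * z ^ m =
      2 * Real.pi * Complex.I * (limSymbol c D ^ k).coeff (-m - 1) := by
  have hr : 0 < r := hR.trans hRr
  set S : ℂ → ℂ := fun z => ∑' j, (c (j + 1) / j ! : ℂ) * z ^ j with hS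
  set B : ℂ → ℂ := fun z => ∑' j : ℕ, (c (j + D + 1) / (j + D)! : ℂ) * z ^ j with hB
  set W : ℂ → ℂ := fun z => (1 + z) * (1 + z * S z) with hW
  set W' : ℂ → ℂ := fun z =>
    (1 + z) * (1 + z * ∑ j ∈ Finset.range D, (c (j + 1) / j ! : ℂ) * z ^ j) with hW'
  have hSd : DifferentiableOn ℂ S (Metric.ball 0 r) := differentiableOn_powerSeries he
  have hBd : DifferentiableOn ℂ B (Metric.ball 0 r) :=
    differentiableOn_powerSeries (summable_shift hr he D)
  have hWd : DifferentiableOn ℂ W (Metric.ball 0 r) := by fun_prop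
  have hWd' : DifferentiableOn ℂ W' (Metric.ball 0 r) := by fun_prop
  have hne : ∀ z ∈ Metric.sphere (0 : ℂ) R, z ≠ 0 := fun z hz =>
    ne_zero_of_mem_sphere hR.ne' ⟨z, hz⟩
  -- The full and the truncated symbol are z⁻¹W and z⁻¹W' with W - W' divisible by z^(D+1).
  -- Factoring W^k - W'^k leaves the total power z^(m+D+1-k), nonnegative by `hm`, so the difference
  -- extends holomorphically over 0.
  have hdiff : ∀ z ∈ Metric.sphere (0 : ℂ) R, (1 / z + 1 + (1 + z) * S z) ^ k * z ^ m -
      evalAt (limSymbol c D ^ k) z * z ^ m = z ^ (m + D + 1 - k).toNat * ((1 + z) * B z *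
        ∑ i ∈ Finset.range k, W z ^ i * W' z ^ (k - 1 - i)) := fun z hz => by
    have hz0 := hne z hz
    have hzr : ‖z‖ ≤ r := (mem_sphere_zero_iff_norm.1 hz).le.trans hRr.le
    have e1 : 1 / z + 1 + (1 + z) * S z = z⁻¹ * W z := by
      simp only [hW]
      field_simp
    have e2 : evalAt (limSymbol c D) z = z⁻¹ * W' z := by
      rw [eq_inv_mul_iff_mul_eq₀ hz0, mul_evalAt_limSymbol c D hz0]
    have e3 : W z - W' z = z ^ (D + 1) * ((1 + z) * B z) := by
      have := powerSeries_eq he D hzr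
      simp only [hW, hW', hS, hB, this]
      ring
    have e4 := geom_sum₂_mul (W z) (W' z) k
    rw [e3] at e4
    have e5 : z ^ (m + D + 1 - k).toNat = z⁻¹ ^ k * z ^ m * z ^ (D + 1) := by
      rw [← zpow_natCast, Int.toNat_of_nonneg (by omega), inv_pow, ← zpow_natCast z k,
        ← zpow_natCast z (D + 1), ← zpow_neg, ← zpow_add₀ hz0, ← zpow_add₀ hz0]
      congr 1
      push_cast
      ring
    rw [e1, evalAt_pow _ _ hz0, e2, e5, mul_pow z⁻¹ (W z), mul_pow z⁻¹ (W' z)]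
    clear_value W W'
    linear_combination (-(z⁻¹ ^ k * z ^ m)) * e4
  have h0 : ∮ z in C(0, R), ((1 / z + 1 + (1 + z) * S z) ^ k * z ^ m -
      evalAt (limSymbol c D ^ k) z * z ^ m) = 0 :=
    integral_eq_zero_of_differentiableOn hR hRr (by fun_prop) hdiff
  have hsub : Metric.sphere (0 : ℂ) R ⊆ Metric.ball 0 r := fun z hz => by
    rw [mem_ball_zero_iff, mem_sphere_zero_iff_norm.1 hz]; exact hRr
  have hzm : ContinuousOn (fun z : ℂ => z ^ m) (Metric.sphere 0 R) :=
    continuousOn_id.zpow₀ m fun z hz => Or.inl (hne z hz)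
  have hcont : ContinuousOn (fun z => (1 / z + 1 + (1 + z) * S z) ^ k * z ^ m)
      (Metric.sphere 0 R) := by
    have hSc := hSd.continuousOn.mono hsub
    have hinv : ContinuousOn (fun z : ℂ => 1 / z) (Metric.sphere 0 R) :=
      continuousOn_const.div continuousOn_id hne
    exact ((((hinv.add continuousOn_const).add
      ((continuousOn_const.add continuousOn_id).mul hSc)).pow k).mul hzm)
  have hcont' : ContinuousOn (fun z => evalAt (limSymbol c D ^ k) z * z ^ m)
      (Metric.sphere 0 R) := (continuousOn_evalAt _ hR).mul hzm
  rw [circleIntegral.integral_sub (hcont.circleIntegrable hR.le) (hcont'.circleIntegrable hR.le),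
    sub_eq_zero] at h0
  rw [h0, integral_evalAt_mul_zpow _ hR]

theorem pairing_T (f : LaurentPolynomial ℂ) (i : ℕ) :
    pairing f (LaurentPolynomial.T ((i : ℤ) + 1)) = ((i : ℂ) + 1) * f.coeff (-(i : ℤ) - 1) := by
  induction f using LaurentPolynomial.induction_on' with
  | add f g hf hg => rw [pairing_add_left, hf, hg, AddMonoidAlgebra.coeff_add, Finsupp.add_apply, mul_add]
  | C_mul_T n a =>
    have h1 := coeff_C_mul_T 1 ((i : ℤ) + 1) (-n)
    rw [map_one, one_mul] at h1
    rw [pairing_C_mul_T, coeff_C_mul_T, h1]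
    by_cases h : n = -(i : ℤ) - 1
    · subst h
      have : (-(-(i : ℤ) - 1)).toNat = i + 1 := by omega
      rw [if_pos (by ring), if_pos rfl, this]
      push_cast
      ring
    · rw [if_neg (by omega), if_neg h]
      ring

/-- Only negative powers of f contribute to the pairing, and by assumption at most D of them;
reindexing gives the range that appears in the expansion of 1/(z - w)². -/
theorem pairing_eq_sum {f : LaurentPolynomial ℂ} {D : ℕ} (hf : ∀ n < -(D : ℤ), f.coeff n = 0)
    (g : LaurentPolynomial ℂ) : pairing f g = ∑ n ∈ Finset.range D,
      ((n : ℂ) + 1) * f.coeff (-(n : ℤ) - 1) * g.coeff ((n : ℤ) + 1) := by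
  classical
  set J := (Finset.range D).image fun n : ℕ => -(n : ℤ) - 1 with hJ
  have h1 : pairing f g = ∑ w ∈ f.coeff.support ∪ J,
      ((-w).toNat : ℂ) * f.coeff w * g.coeff (-w) :=
    Finset.sum_subset Finset.subset_union_left fun w _ hw => by
      simp [Finsupp.notMem_support_iff.1 hw]
  rw [h1, ← Finset.sum_subset Finset.subset_union_right fun w _ hw => ?_, hJ, Finset.sum_image]
  · refine Finset.sum_congr rfl fun n _ => ?_
    rw [show (-(-(n : ℤ) - 1)).toNat = n + 1 by omega, show -(-(n : ℤ) - 1) = n + 1 by ring]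
    push_cast
    rfl
  · intro a _ b _ hab
    simpa using hab
  · by_cases h : w < -(D : ℤ)
    · rw [hf w h, mul_zero, zero_mul]
    · rw [show (-w).toNat = 0 from ?_, Nat.cast_zero, zero_mul, zero_mul]
      by_contra h0
      exact hw (Finset.mem_image.2 ⟨(-w).toNat - 1, Finset.mem_range.2 (by omega), by omega⟩)

/-- The derivative of the geometric series in z/w. Its coefficients n + 1 are the weights of
`pairing`, and the nesting of the two contours is what selects this expansion. -/
theorem hasSum_inv_sub_sq {z w : ℂ} (hzw : ‖z‖ < ‖w‖) :
    HasSum (fun n : ℕ => ((n : ℂ) + 1) * z ^ (n : ℤ) * w ^ (-(n : ℤ) - 2)) (1 / (z - w) ^ 2) := by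
  have hw : w ≠ 0 := norm_pos_iff.1 ((norm_nonneg z).trans_lt hzw)
  have hne : w - z ≠ 0 := fun h => by rw [sub_eq_zero.1 h] at hzw; exact lt_irrefl _ hzw
  have h1 := (hasSum_choose_mul_geometric_of_norm_lt_one 1 (r := z / w) (by
    rwa [norm_div, div_lt_one (norm_pos_iff.2 hw)])).mul_left (w ^ (-2 : ℤ))
  have h2 : w ^ (-2 : ℤ) * (1 / (1 - z / w) ^ (1 + 1)) = 1 / (z - w) ^ 2 := by
    rw [← neg_sub w z, neg_sq, one_sub_div hw, zpow_neg]
    norm_cast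
    rw [div_pow]
    field_simp
    ring
  rw [h2] at h1
  refine h1.congr_fun fun n => ?_
  rw [Nat.choose_one_right, div_pow, sub_eq_add_neg (-(n : ℤ)) 2, zpow_add₀ hw, zpow_neg w n,
    zpow_natCast, zpow_natCast]
  push_cast
  ring

theorem limitF_one_add (c : ℕ → ℝ) (z : ℂ) :
    limitF c (1 + z) = ∑' j, (c (j + 1) / j ! : ℂ) * z ^ j := by
  simp only [limitF, add_sub_cancel_left]

theorem limBeta_mul_pairing (d : ℕ → ℕ → ℝ) (f g : LaurentPolynomial ℂ) (i j : ℕ) :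
    limBeta d i j * pairing f (LaurentPolynomial.T ((i : ℤ) + 1)) *
      pairing g (LaurentPolynomial.T ((j : ℤ) + 1)) =
      (d (i + 1) (j + 1) / ((i ! : ℂ) * j !)) * f.coeff (-(i : ℤ) - 1) * g.coeff (-(j : ℤ) - 1) := by
  rw [pairing_T, pairing_T, limBeta, Nat.factorial_succ, Nat.factorial_succ]
  have h1 : ∀ n : ℕ, (n : ℂ) + 1 ≠ 0 := fun n => by exact_mod_cast Nat.succ_ne_zero n
  have h2 : ∀ n : ℕ, (n ! : ℂ) ≠ 0 := fun n => by exact_mod_cast Nat.factorial_ne_zero n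
  have hi := h1 i
  have hj := h1 j
  have hi' := h2 i
  have hj' := h2 j
  push_cast
  field_simp

/-- The double contour integral of the limiting covariance is a finite sum over the Laurent
coefficients of the symbol. -/
theorem covIntegral_eq {c : ℕ → ℝ} {d : ℕ → ℕ → ℝ} {r : ℝ}
    (hc : Summable fun j : ℕ => ‖(c (j + 1) / j ! : ℂ)‖ * r ^ j)
    (hd : Summable fun p : ℕ × ℕ =>
      ‖(d (p.1 + 1) (p.2 + 1) / ((p.1 ! : ℂ) * p.2 !) : ℂ)‖ * r ^ p.1 * r ^ p.2)
    {ε : ℝ} (hε : 0 < ε) (hεr : 2 * ε < r) {k₁ k₂ D : ℕ} (hD : k₁ + k₂ ≤ D) :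
    covIntegral c d ε k₁ k₂ =
      covForm D (limBeta d) (limSymbol c D ^ k₁) (limSymbol c D ^ k₂) := by
  set f := limSymbol c D ^ k₁ with hf
  set g := limSymbol c D ^ k₂ with hg
  have hf0 : ∀ n : ℤ, n < -k₁ → f.coeff n = 0 := fun n hn => coeff_limSymbol_pow_eq_zero c D hn
  have hg0 : ∀ n : ℤ, n < -k₂ → g.coeff n = 0 := fun n hn => coeff_limSymbol_pow_eq_zero c D hn
  set A : ℂ → ℂ := fun z => 1 / z + 1 + (1 + z) * ∑' j, (c (j + 1) / j ! : ℂ) * z ^ j with hA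
  have hAc : ∀ R : ℝ, 0 < R → R < r → ∀ k : ℕ,
      ContinuousOn (fun z => A z ^ k) (Metric.sphere 0 R) := fun R hR hRr k => by
    have hsub : Metric.sphere (0 : ℂ) R ⊆ Metric.ball 0 r := fun z hz => by
      rw [mem_ball_zero_iff, mem_sphere_zero_iff_norm.1 hz]; exact hRr
    have hSc := (differentiableOn_powerSeries hc).continuousOn.mono hsub
    have hinv : ContinuousOn (fun z : ℂ => 1 / z) (Metric.sphere 0 R) :=
      continuousOn_const.div continuousOn_id fun z hz => ne_zero_of_mem_sphere hR.ne' ⟨z, hz⟩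
    exact ((hinv.add continuousOn_const).add
      ((continuousOn_const.add continuousOn_id).mul hSc)).pow k
  -- The Taylor terms of G and the terms of 1/(z - w)² form one family of monomials q z^a w^b,
  -- matching the β-term and the pairing in `covForm`.
  let q : (ℕ × ℕ) ⊕ ℕ → ℂ := Sum.elim
    (fun p => d (p.1 + 1) (p.2 + 1) / ((p.1 ! : ℂ) * p.2 !)) fun n => (n : ℂ) + 1
  let a : (ℕ × ℕ) ⊕ ℕ → ℤ := Sum.elim (fun p => p.1) fun n => n
  let b : (ℕ × ℕ) ⊕ ℕ → ℤ := Sum.elim (fun p => p.2) fun n => -(n : ℤ) - 2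
  have hε2 : 0 < 2 * ε := by positivity
  have hrpos : 0 < r := hε2.trans hεr
  have hK : ∀ z ∈ Metric.sphere (0 : ℂ) ε, ∀ w ∈ Metric.sphere (0 : ℂ) (2 * ε),
      HasSum (fun n => q n * z ^ a n * w ^ b n) (limitQ d z w) := fun z hz w hw => by
    rw [mem_sphere_zero_iff_norm] at hz hw
    refine HasSum.sum ?_ (hasSum_inv_sub_sq (by rw [hz, hw]; linarith))
    have h1 : Summable fun p : ℕ × ℕ =>
        (d (p.1 + 1) (p.2 + 1) / ((p.1 ! : ℂ) * p.2 !) : ℂ) * z ^ p.1 * w ^ p.2 := by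
      refine Summable.of_norm_bounded hd fun p => ?_
      rw [norm_mul, norm_mul, norm_pow, norm_pow, hz, hw]
      have : ε ≤ r := by linarith
      gcongr
    have h2 := h1.hasSum
    simp only [limitG, add_sub_cancel_left]
    exact h2
  have hsum : Summable fun n => ‖q n‖ * ε ^ a n * (2 * ε) ^ b n := by
    refine (HasSum.sum (Summable.hasSum ?_) (Summable.hasSum ?_)).summable
    · refine Summable.of_nonneg_of_le (fun p => by
        simp only [Function.comp_apply]; positivity) (fun p => ?_) hd
      have : ε ≤ r := by linarith
      simp only [Function.comp_apply, q, a, b, Sum.elim_inl, zpow_natCast]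
      gcongr
    · have h1 := (hasSum_inv_sub_sq (z := (ε : ℂ)) (w := ((2 * ε : ℝ) : ℂ)) (by
        rw [Complex.norm_real, Complex.norm_real, Real.norm_of_nonneg hε.le,
          Real.norm_of_nonneg hε2.le]
        linarith)).summable.norm
      refine h1.congr fun n => ?_
      simp only [Function.comp_apply, q, a, b, Sum.elim_inr]
      rw [norm_mul, norm_mul, norm_zpow, norm_zpow, Complex.norm_real, Complex.norm_real,
        Real.norm_of_nonneg hε.le, Real.norm_of_nonneg hε2.le]
  have hmain := (hasSum_double_circleIntegral hε hε2 (hAc ε hε (by linarith) k₁)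
    (hAc (2 * ε) hε2 hεr k₂) hsum hK).mul_left (1 / (2 * (Real.pi : ℂ) * Complex.I) ^ 2)
  have hpi := Complex.two_pi_I_ne_zero
  have hcov : covIntegral c d ε k₁ k₂ = 1 / (2 * (Real.pi : ℂ) * Complex.I) ^ 2 *
      ∮ z in C(0, ε), ∮ w in C(0, 2 * ε), A z ^ k₁ * A w ^ k₂ * limitQ d z w := by
    simp only [covIntegral, limitF_one_add, hA]
  rw [← hcov] at hmain
  have hfI : ∀ m : ℤ, -1 ≤ m + D - k₁ → ∮ z in C(0, ε), A z ^ k₁ * z ^ m =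
      2 * Real.pi * Complex.I * f.coeff (-m - 1) := fun m hm =>
    integral_symbol hc hε (by linarith) (by omega)
  have hgI : ∀ m : ℤ, -1 ≤ m + D - k₂ → ∮ z in C(0, 2 * ε), A z ^ k₂ * z ^ m =
      2 * Real.pi * Complex.I * g.coeff (-m - 1) := fun m hm =>
    integral_symbol hc hε2 hεr (by omega)
  have hterms := hmain.congr_fun (g := fun n => q n * f.coeff (-a n - 1) * g.coeff (-b n - 1)) ?_
  swap
  · intro n
    have ha : 0 ≤ a n := by rcases n with p | n <;> simp [a]
    rw [hfI (a n) (by omega)]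
    -- For a ≥ k₁ the z-integral is zero and the w-integral is not needed. Otherwise the exponent of
    -- w is at least -k₁ - 1, within the range where k₁ + k₂ ≤ D allows the symbol to be truncated.
    by_cases hn : a n < k₁
    · have hb : -(k₁ : ℤ) - 1 ≤ b n := by
        rcases n with p | n
        · simp only [b, Sum.elim_inl]; omega
        · simp only [a, b, Sum.elim_inr] at hn ⊢; omega
      rw [hgI (b n) (by omega)]
      field_simp
    · rw [hf0 _ (by omega)]
      ring
  have hfin : HasSum (fun n => q n * f.coeff (-a n - 1) * g.coeff (-b n - 1))
      (covForm D (limBeta d) f g) := by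
    rw [covForm, add_comm]
    refine HasSum.sum ?_ ?_
    · simp only [limBeta_mul_pairing, ← Finset.sum_product']
      refine hasSum_sum_of_ne_finset_zero fun p hp => ?_
      simp only [Function.comp_apply, q, a, b, Sum.elim_inl]
      rw [Finset.mem_product, Finset.mem_range, Finset.mem_range, not_and_or] at hp
      rcases hp with hp | hp
      · rw [hf0 _ (by omega)]; ring
      · rw [hg0 _ (by omega)]; ring
    · rw [pairing_eq_sum (D := D) (fun n hn => hf0 n (by omega))]
      have h1 : ∀ n : ℕ, -(-(n : ℤ) - 2) - 1 = n + 1 := fun n => by ring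
      simp only [Function.comp_def, q, a, b, Sum.elim_inr, h1]
      refine hasSum_sum_of_ne_finset_zero fun n hn => ?_
      rw [Finset.mem_range] at hn
      rw [hf0 _ (by omega)]; ring
  exact hterms.unique hfin

/-- Evaluating both series at the real point 1 + r inside the domains of convergence gives absolute
convergence at radius r. -/
theorem IsCLTAppropriate.exists_radius {ρ : (N : ℕ) → Measure (Signature N)} {c : ℕ → ℝ}
    {d : ℕ → ℕ → ℝ} (happ : IsCLTAppropriate ρ c d) : ∃ r > 0,
    (Summable fun j : ℕ => ‖(c (j + 1) / j ! : ℂ)‖ * r ^ j) ∧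
    Summable fun p : ℕ × ℕ =>
      ‖(d (p.1 + 1) (p.2 + 1) / ((p.1 ! : ℂ) * p.2 !) : ℂ)‖ * r ^ p.1 * r ^ p.2 := by
  obtain ⟨r₁, hr₁, h₁⟩ := happ.summable_one
  obtain ⟨r₂, hr₂, h₂⟩ := happ.summable_two
  set r := min r₁ r₂ / 2 with hr
  have hpos : 0 < min r₁ r₂ := lt_min hr₁ hr₂
  have hr0 : 0 < r := by positivity
  have hle : r < min r₁ r₂ := half_lt_self hpos
  have hnorm : ‖1 + (r : ℂ) - 1‖ = r := by
    rw [add_sub_cancel_left, Complex.norm_real, Real.norm_of_nonneg hr0.le]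
  refine ⟨r, hr0, ?_, ?_⟩
  · refine (h₁ (1 + r) (by rw [hnorm]; exact hle.trans_le (min_le_left _ _))).norm.congr fun j => ?_
    rw [norm_mul, norm_pow, hnorm]
  · have hlt : ‖1 + (r : ℂ) - 1‖ < r₂ := by rw [hnorm]; exact hle.trans_le (min_le_right _ _)
    refine (h₂ (1 + r) (1 + r) hlt hlt).norm.congr fun p => ?_
    rw [norm_mul, norm_mul, norm_pow, norm_pow, hnorm]

end SchurCLT

end

theorem theorem2p3
    (ρ : (N : ℕ) → Measure (SchurCLT.Signature N)) [∀ N, IsProbabilityMeasure (ρ N)]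
    (hρ : ∀ N, 1 ≤ N → SchurCLT.ConvergesNearOne (ρ N))
    (c : ℕ → ℝ) (d : ℕ → ℕ → ℝ) (happ : SchurCLT.IsCLTAppropriate ρ c d) :
    -- all joint moments of the power sums are finite
    (∀ N, 1 ≤ N → ∀ (s : ℕ) (k : Fin s → ℕ+),
      Integrable (fun l => ∏ i, SchurCLT.powerSum (k i : ℕ) l) (ρ N)) ∧
    -- there is a centered Gaussian vector `ξ = (ξ 1, ξ 2, …)`
    ∃ (Ω : Type) (_ : MeasurableSpace Ω) (P : Measure Ω) (ξ : ℕ+ → Ω → ℝ),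
      IsGaussianProcess ξ P ∧ (∀ k, ∫ ω, ξ k ω ∂P = 0) ∧
      -- the covariances converge to those of `ξ`, given by the double contour integral
      (∀ k₁ k₂ : ℕ+, Tendsto
        (fun N : ℕ => cov[SchurCLT.powerSum (k₁ : ℕ), SchurCLT.powerSum (k₂ : ℕ); ρ N] /
          (N : ℝ) ^ ((k₁ : ℕ) + (k₂ : ℕ)))
        atTop (𝓝 cov[ξ k₁, ξ k₂; P])) ∧
      (∃ ε₀ > 0, ∀ ε : ℝ, 0 < ε → ε < ε₀ → ∀ k₁ k₂ : ℕ+,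
        ((cov[ξ k₁, ξ k₂; P] : ℝ) : ℂ) = SchurCLT.covIntegral c d ε k₁ k₂) ∧
      -- all joint moments of the fluctuations converge to those of `ξ`
      ∀ (s : ℕ) (k : Fin s → ℕ+), Tendsto
        (fun N : ℕ => ∫ l, ∏ i, SchurCLT.fluctuation (ρ N) (k i : ℕ) l ∂(ρ N))
        atTop (𝓝 (∫ ω, ∏ i, ξ (k i) ω ∂P)) := by
  have hlist : ∀ {s : ℕ} (k : Fin s → ℕ+) (F : ℕ+ → ℝ),
      ∏ i, F (k i) = ((List.ofFn k).map F).prod := fun k F => by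
    rw [List.map_ofFn, List.prod_ofFn]
    rfl
  obtain ⟨Ω, mΩ, P, ξ, hξ, hmean, hcov, hwick⟩ := SchurCLT.exists_gaussian
    (fun k l => SchurCLT.limCov c d k l) (fun k l => SchurCLT.limCov_symm hρ happ k l)
    fun f => SchurCLT.limCov_nonneg hρ happ (fun k : ℕ+ => (k : ℕ)) f.support f
  refine ⟨fun N hN s k => ?_, Ω, mΩ, P, ξ, hξ, hmean, fun k₁ k₂ => ?_, ?_, fun s k => ?_⟩
  · have h := SchurCLT.integrable_prod_powerSum hρ happ hN ((List.ofFn k).map fun k : ℕ+ => (k : ℕ))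
    refine h.congr (Eventually.of_forall fun l => ?_)
    simp only [hlist k fun j => SchurCLT.powerSum (j : ℕ) l, List.map_map, Function.comp_def]
  · rw [hcov]
    exact SchurCLT.tendsto_cov hρ happ k₁ k₂
  · obtain ⟨r, hr, hc, hd⟩ := happ.exists_radius
    -- The outer contour has radius 2ε and must stay within the common radius of convergence r,
    -- which does not depend on k₁ and k₂.
    refine ⟨r / 2, by positivity, fun ε hε hεr k₁ k₂ => ?_⟩
    rw [hcov, ← SchurCLT.covForm_eq_limCov hρ happ le_rfl,
      SchurCLT.covIntegral_eq hc hd hε (by linarith) (Nat.le_add_right (_ + _) 2)]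
  · have hlim : ∫ ω, ∏ i, ξ (k i) ω ∂P =
        SchurCLT.wickRec (fun k l : ℕ+ => SchurCLT.limCov c d k l) (List.ofFn k) := by
      rw [← hwick]
      congr 1
      funext ω
      exact hlist k fun j => ξ j ω
    rw [hlim]
    have h := SchurCLT.tendsto_fluctuation hρ happ ((List.ofFn k).map fun k : ℕ+ => (k : ℕ))
    rw [SchurCLT.wickRec_map_eq (fun k l : ℕ+ => SchurCLT.limCov c d k l) _ (RingHom.id ℝ) _ _
      fun _ _ _ _ => rfl, RingHom.id_apply] at h
    refine h.congr fun N => ?_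
    congr 1
    funext l
    simp only [hlist k fun j => SchurCLT.fluctuation (ρ N) (j : ℕ) l, List.map_map,
      Function.comp_def]
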